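/- Let $d\ge 1$ be an integer, $\nu\ge 0$ and $T^*>0$ real numbers, and let $1\le p,q\le\infty$ with Hölder conjugates $p',q'$ (so $\frac1p+\frac1{p'}=\frac1q+\frac1{q'}=1$). Let $v=v(t,x)$ be a vector field on $\mathbb{R}_+\times\mathbb{R}^d$ with values in $\mathbb{R}^d$ which belongs to $L^{p'}(\mathbb{R}_+,\dot W^{1,q'}(\mathbb{R}^d))$ and satisfies $\operatorname{div} v(t)=0$ in the sense of distributions for almost every $t\ge 0$. Here $\dot W^{1,q'}(\mathbb{R}^d)$ is the space of locally integrable fields whose weak gradient lies in $L^{q'}(\mathbb{R}^d)$, and the membership of $v$ means that $v$ is measurable in $(t,x)$, that $v\in L^{p'}([0,T],L^1(B_R))$ for all $T,R>0$ (where $B_R$ is the ball of radius $R$ centred at $0$), and that the weak spatial gradient satisfies $\nabla v\in L^{p'}(\mathbb{R}_+,L^{q'}(\mathbb{R}^d))$. Let $a\in L^p([0,T^*],L^q(\mathbb{R}^d))$ be a real-valued distributional solution of the Cauchy problem $$\partial_t a+\nabla\cdot(av)-\nu\Delta a=0,\qquad a(0)=0,$$ that is, for every $\varphi\in C_c^\infty(\mathbb{R}\times\mathbb{R}^d)$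 and almost every $T\in[0,T^*]$, $$\int_0^T\!\!\int_{\mathbb{R}^d} a(t,x)\bigl(\partial_t\varphi(t,x)+v(t,x)\cdot\nabla\varphi(t,x)+\nu\Delta\varphi(t,x)\bigr)\,dx\,dt=\int_{\mathbb{R}^d}a(T,x)\varphi(T,x)\,dx .$$ Then $a=0$ almost everywhere on $[0,T^*]\times\mathbb{R}^d$. -/

import Mathlib

open MeasureTheory Set
open scoped ENNReal Laplacian

/-- `f ∈ L^p(τ; L^q(μ))`: the function `f = f(t, x)` is measurable in `(t, x)` and the function
`t ↦ ‖f(t)‖_{L^q(μ)}` has a finite `L^p(τ)` norm. -/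
def MemMixedLp {E F : Type*} [MeasurableSpace E] [NormedAddCommGroup F]
    (f : ℝ → E → F) (p q : ℝ≥0∞) (τ : Measure ℝ) (μ : Measure E) : Prop :=
  AEStronglyMeasurable (Function.uncurry f) (τ.prod μ) ∧
    eLpNorm (fun t => eLpNorm (f t) q μ) p τ < ∞

/-- Test functions: smooth and compactly supported real-valued functions. -/
def IsTestFunction {X : Type*} [NormedAddCommGroup X] [NormedSpace ℝ X] (φ : X → ℝ) : Prop :=
  ContDiff ℝ ((⊤ : ℕ∞) : WithTop ℕ∞) φ ∧ HasCompactSupport φ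

/-- The locally integrable field `G` is the weak (distributional) gradient of the locally
integrable vector field `u` on `ℝ^d`. -/
def HasWeakGradient {d : ℕ} (u : EuclideanSpace ℝ (Fin d) → EuclideanSpace ℝ (Fin d))
    (G : EuclideanSpace ℝ (Fin d) → EuclideanSpace ℝ (Fin d) →L[ℝ] EuclideanSpace ℝ (Fin d)) :
    Prop :=
  LocallyIntegrable u ∧ LocallyIntegrable G ∧
    ∀ ψ : EuclideanSpace ℝ (Fin d) → ℝ, IsTestFunction ψ → ∀ e : EuclideanSpace ℝ (Fin d),
      ∫ x, (fderiv ℝ ψ x e) • u x = - ∫ x, ψ x • G x e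

/-- `v ∈ L^r(ℝ₊; Ẇ^{1,s}(ℝ^d))`. Here `Ẇ^{1,s}` is the space of the locally integrable fields
whose weak gradient belongs to `L^s`. The gradient does not see an additive function of time;
as usual for functions of time with values in a space of locally integrable functions,
`v ∈ L^r([0,T]; L^1(B_R))` for all `T` and `R`. The gradient has a finite `L^r(ℝ₊; L^s)` norm. -/
def MemLpHomogeneousSobolev {d : ℕ}
    (v : ℝ → EuclideanSpace ℝ (Fin d) → EuclideanSpace ℝ (Fin d)) (r s : ℝ≥0∞) : Prop :=
  (∀ T R : ℝ, MemMixedLp v r 1 (volume.restrict (Icc 0 T))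
    (volume.restrict (Metric.ball 0 R))) ∧
  ∃ G : ℝ → EuclideanSpace ℝ (Fin d) → EuclideanSpace ℝ (Fin d) →L[ℝ] EuclideanSpace ℝ (Fin d),
    (∀ᵐ t ∂(volume.restrict (Ici (0 : ℝ))), HasWeakGradient (v t) (G t)) ∧
    MemMixedLp G r s (volume.restrict (Ici (0 : ℝ))) volume

/-- `div v(t) = 0` in the sense of distributions on `ℝ^d`, for almost every `t ≥ 0`. -/
def IsDivergenceFree {d : ℕ}
    (v : ℝ → EuclideanSpace ℝ (Fin d) → EuclideanSpace ℝ (Fin d)) : Prop :=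
  ∀ᵐ t ∂(volume.restrict (Ici (0 : ℝ))),
    ∀ ψ : EuclideanSpace ℝ (Fin d) → ℝ, IsTestFunction ψ →
      ∫ x, inner ℝ (v t x) (gradient ψ x) = 0

/-- `a` is a distributional solution on `[0,T] × ℝ^d` of
`∂ₜ a + ∇ · (a v) - ν Δ a = 0`, `a(0) = 0`.
The test functions need not vanish at `t = 0`, so that the identity contains the initial condition.
Since `a` is a class of functions modulo null sets, `a(s)` makes sense for almost every `s`. -/
def IsDistributionalSolution {d : ℕ} (ν T : ℝ)
    (v : ℝ → EuclideanSpace ℝ (Fin d) → EuclideanSpace ℝ (Fin d))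
    (a : ℝ → EuclideanSpace ℝ (Fin d) → ℝ) : Prop :=
  ∀ φ : ℝ × EuclideanSpace ℝ (Fin d) → ℝ, IsTestFunction φ →
    ∀ᵐ s ∂(volume.restrict (Icc 0 T)),
      ∫ z in Icc 0 s ×ˢ (univ : Set (EuclideanSpace ℝ (Fin d))),
          a z.1 z.2 *
            (deriv (fun t => φ (t, z.2)) z.1
              + inner ℝ (v z.1 z.2) (gradient (fun x => φ (z.1, x)) z.2)
              + ν * (Δ (fun x => φ (z.1, x))) z.2)
        = ∫ x, a s x * φ (s, x)

/-!
Uniqueness for transport-diffusion equations with a divergence free velocity in a homogeneous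
Sobolev space.

Let `ρ` be a mollifier at scale `ε`. The mollified solution `a_ε` solves the same equation with an
additional commutator term. By the mean value formula for weak gradients
(`HasWeakGradient.translate_sub_ae_eq`) and because `∇v` is trace-free, this commutator is bounded
in `L¹` by the modulus of continuity of the products `a(· + h) ∇v(· + k)`
(`lintegral_transportCommutator_le`), so that it tends to zero with `ε`
(`tendsto_lintegral_transportCommutator`). The balance of `β(a_ε)`, with the convex function
`β(u) = √(1 + u²) - 1` in place of `|u|`, has no source other than the commutator and the fluxes
through a cutoff.

The difficulty is the behaviour at infinity. Neither `a` nor `v` need be integrable there, `v` may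
grow linearly, and only `∇v` has a norm that can be used. The cutoff at scale `R` therefore moves
with the velocity `c_R(t)`, the average of `v(t)` over a ball of radius `R / 4` at distance `R` from the
origin (`lintegral_smoothAbs_mul_cutoff_le`). The frame moves by `O(R)` only
(`exists_enorm_frameVelocity_le`), so the transition zone of the cutoff stays in an annulus
`R ≤ |x| ≤ ΛR`. There `v - c_R` is controlled, after division by `R`, by the gradient outside the
ball of radius `R / 4`: the points of the annulus are joined to the averaging ball by paths that
avoid the origin (`setLIntegral_annulus_mul_sub_average_le`). The flux is thus at most a constant
times the product of the tails of `a` in `L^q` and of `∇v` in `L^{q'}`, which vanishes as `R → ∞`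
since one of the two exponents is finite (`tendsto_lintegral_tail`). The balance is integrated
twice in time, which produces the weight `T - t`, so that it suffices to bound the space-time mass
of `β(a_ε)`.

The diffusion contributes `R⁻²` times the mass on a ball of radius `ΛR` (`exists_smoothMass_le`).
As the mass on balls is `O(R^d)` uniformly in `ε` (`smoothMass_le`), `d` iterations of this bound
leave a remainder that vanishes as `R → ∞` (`exists_iterated_bound`). Then `ε → 0` and `R → ∞`, in
this order, give `β(a) = 0` (`setLIntegral_smoothAbs_eq_zero`).

These arguments are applied to representatives for which all assumptions hold at every time
(`IsDistributionalSolution.exists_isNormalizedSolution`).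
-/

open Filter Topology

variable {d : ℕ}

/-! ### Translations and tails in Lebesgue spaces -/

/-- Hölder inequality for a product of two functions that are translated independently. -/
theorem lintegral_translate_mul_le {E F F' : Type*} [NormedAddCommGroup E] [MeasurableSpace E]
    [BorelSpace E] [SecondCountableTopology E] [NormedAddCommGroup F] [NormedAddCommGroup F']
    {μ : Measure E} [μ.IsAddRightInvariant]
    {q q' : ℝ≥0∞} (hq : ENNReal.HolderConjugate q q') {f : E → F} {g : E → F'}
    (hf : AEStronglyMeasurable f μ) (hg : AEStronglyMeasurable g μ) (h k : E) :
    ∫⁻ x, ‖f (x + h)‖ₑ * ‖g (x + k)‖ₑ ∂μ ≤ eLpNorm f q μ * eLpNorm g q' μ := by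
  have hmp (h : E) : MeasurePreserving (fun x => x + h) μ μ := measurePreserving_add_right μ h
  have hf' := (hf.comp_measurePreserving (hmp h)).norm
  have hg' := (hg.comp_measurePreserving (hmp k)).norm
  have := eLpNorm_smul_le_mul_eLpNorm (p := q) (q := q') (r := 1) hg' hf'
  rw [eLpNorm_one_eq_lintegral_enorm] at this
  simp only [Pi.smul_apply', smul_eq_mul, enorm_mul, enorm_norm, Function.comp] at this
  refine this.trans (le_of_eq ?_)
  rw [eLpNorm_norm (fun x => f (x + h)), eLpNorm_norm (fun x => g (x + k))]
  congr 1
  · exact eLpNorm_comp_measurePreserving hf (hmp h)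
  · exact eLpNorm_comp_measurePreserving hg (hmp k)

theorem MeasureTheory.MemLp.tendsto_eLpNorm_translate_sub {F : Type*} [NormedAddCommGroup F]
    {p : ℝ≥0∞} (hp1 : 1 ≤ p) (hp : p ≠ ∞) {f : EuclideanSpace ℝ (Fin d) → F}
    (hf : MemLp f p volume) :
    Tendsto (fun h => eLpNorm (fun x => f (x + h) - f x) p volume) (𝓝 0) (𝓝 0) := by
  have : Fact (1 ≤ p) := ⟨hp1⟩
  let g : EuclideanSpace ℝ (Fin d) → C(EuclideanSpace ℝ (Fin d), EuclideanSpace ℝ (Fin d)) :=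
    fun h => ⟨fun x => x + h, by fun_prop⟩
  have hgc : Continuous g := by
    refine ContinuousMap.continuous_of_continuous_uncurry _ ?_
    simp only [g, Function.uncurry_def, ContinuousMap.coe_mk]
    fun_prop
  have hmp (h) : MeasurePreserving (g h) volume volume := measurePreserving_add_right volume h
  have key := Filter.Tendsto.compMeasurePreservingLp (f := fun _ => hf.toLp f) (l := 𝓝 0)
    tendsto_const_nhds (hgc.tendsto 0) hmp (hmp 0) hp
  have h0 : Lp.compMeasurePreserving (g 0) (hmp 0) (hf.toLp f) = hf.toLp f := by
    rw [Lp.toLp_compMeasurePreserving hf (hmp 0)]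
    congr 1
    ext x; simp [g]
  rw [h0, Lp.tendsto_Lp_iff_tendsto_eLpNorm'] at key
  refine key.congr fun h => ?_
  rw [Lp.toLp_compMeasurePreserving hf (hmp h)]
  refine eLpNorm_congr_ae ?_
  filter_upwards [MemLp.coeFn_toLp (hf.comp_measurePreserving (hmp h)), hf.coeFn_toLp] with x h1 h2
  exact congrArg₂ (· - ·) h1 h2

/-- The product of `a ∈ L^q` and `g ∈ L^{q'}` is continuous in `L¹` under independent small
translations of the two factors. One of the exponents may be infinite, and translations are then not
continuous on that factor alone; a common translation of both factors, harmless since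
`a g ∈ L¹`, reduces to the case in which only the factor with the finite exponent moves. -/
theorem MeasureTheory.MemLp.tendsto_lintegral_translate_smul_sub {F : Type*} [NormedAddCommGroup F]
    [NormedSpace ℝ F] {q q' : ℝ≥0∞} (hq : ENNReal.HolderConjugate q q')
    {a : EuclideanSpace ℝ (Fin d) → ℝ} {g : EuclideanSpace ℝ (Fin d) → F}
    (ha : MemLp a q volume) (hg : MemLp g q' volume) :
    Tendsto (fun hk : EuclideanSpace ℝ (Fin d) × EuclideanSpace ℝ (Fin d) =>
      ∫⁻ x, ‖a (x + hk.1) • g (x + hk.2) - a x • g x‖ₑ) (𝓝 0) (𝓝 0) := by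
  have hq1 : 1 ≤ q := hq.one_le
  have hq1' : 1 ≤ q' := hq.symm.one_le
  have hmp (h : EuclideanSpace ℝ (Fin d)) :
      MeasurePreserving (fun x => x + h) volume volume := measurePreserving_add_right volume h
  have hag : MemLp (fun x => a x • g x) 1 volume := hg.smul ha
  have hag0 := hag.tendsto_eLpNorm_translate_sub le_rfl ENNReal.one_ne_top
  -- the factor that moves relative to the other one is `a` if `q' = ∞`, and `g` otherwise
  rcases eq_or_ne q' ∞ with h | h
  · have hq2 : q ≠ ∞ := by
      rintro rfl
      subst h
      have := hq.inv_add_inv_eq_one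
      simp at this
    have ha0 := ha.tendsto_eLpNorm_translate_sub hq1 hq2
    have t1 : Tendsto (fun hk : EuclideanSpace ℝ (Fin d) × EuclideanSpace ℝ (Fin d) =>
        eLpNorm (fun x => a (x + (hk.1 - hk.2)) - a x) q volume * eLpNorm g q' volume +
        eLpNorm (fun x => a (x + hk.2) • g (x + hk.2) - a x • g x) 1 volume) (𝓝 0) (𝓝 0) := by
      have e1 : Tendsto (fun hk : EuclideanSpace ℝ (Fin d) × EuclideanSpace ℝ (Fin d) =>
        hk.1 - hk.2) (𝓝 0) (𝓝 0) := by
        have : Continuous (fun hk : EuclideanSpace ℝ (Fin d) × EuclideanSpace ℝ (Fin d) =>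
          hk.1 - hk.2) := by fun_prop
        simpa using this.tendsto 0
      have := (ENNReal.Tendsto.mul_const (ha0.comp e1) (Or.inr hg.2.ne)).add
        (hag0.comp (continuous_snd.tendsto
            (0 : EuclideanSpace ℝ (Fin d) × EuclideanSpace ℝ (Fin d))))
      simpa using this
    refine tendsto_of_tendsto_of_tendsto_of_le_of_le tendsto_const_nhds t1 (fun _ => zero_le) ?_
    rintro ⟨h, k⟩
    have hk := hg.1.comp_measurePreserving (hmp k)
    have hk' := ha.1.comp_measurePreserving (hmp k)
    have hm : AEStronglyMeasurable (fun x => a (x + k) • g (x + k) - a x • g x) volume :=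
      (hk'.smul hk).sub (ha.1.smul hg.1)
    have hm2 : AEStronglyMeasurable (fun x => a (x + (h - k)) - a x) volume :=
      (ha.1.comp_measurePreserving (hmp (h - k))).sub ha.1
    calc ∫⁻ x, ‖a (x + h) • g (x + k) - a x • g x‖ₑ
        ≤ ∫⁻ x, (‖a (x + k + (h - k)) - a (x + k)‖ₑ * ‖g (x + k)‖ₑ
            + ‖a (x + k) • g (x + k) - a x • g x‖ₑ) := by
          refine lintegral_mono fun x => ?_
          have e : a (x + h) • g (x + k) - a x • g x =
            (a (x + k + (h - k)) - a (x + k)) • g (x + k)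
              + (a (x + k) • g (x + k) - a x • g x) := by
            rw [show x + k + (h - k) = x + h by abel, sub_smul]; abel
          rw [e]
          refine (enorm_add_le _ _).trans ?_
          rw [enorm_smul]
      _ = (∫⁻ x, ‖a (x + k + (h - k)) - a (x + k)‖ₑ * ‖g (x + k)‖ₑ)
            + ∫⁻ x, ‖a (x + k) • g (x + k) - a x • g x‖ₑ := lintegral_add_right' _ hm.enorm
      _ ≤ _ := by
          simp only [eLpNorm_one_eq_lintegral_enorm]
          gcongr
          exact lintegral_translate_mul_le hq hm2 hg.1 k k
  · have hg0 := hg.tendsto_eLpNorm_translate_sub hq1' h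
    have t1 : Tendsto (fun hk : EuclideanSpace ℝ (Fin d) × EuclideanSpace ℝ (Fin d) =>
        eLpNorm a q volume * eLpNorm (fun x => g (x + (hk.2 - hk.1)) - g x) q' volume +
        eLpNorm (fun x => a (x + hk.1) • g (x + hk.1) - a x • g x) 1 volume) (𝓝 0) (𝓝 0) := by
      have e1 : Tendsto (fun hk : EuclideanSpace ℝ (Fin d) × EuclideanSpace ℝ (Fin d) =>
        hk.2 - hk.1) (𝓝 0) (𝓝 0) := by
        have : Continuous (fun hk : EuclideanSpace ℝ (Fin d) × EuclideanSpace ℝ (Fin d) =>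
          hk.2 - hk.1) := by fun_prop
        simpa using this.tendsto 0
      have := (ENNReal.Tendsto.const_mul (hg0.comp e1) (Or.inr ha.2.ne)).add
        (hag0.comp (continuous_fst.tendsto
            (0 : EuclideanSpace ℝ (Fin d) × EuclideanSpace ℝ (Fin d))))
      simpa using this
    refine tendsto_of_tendsto_of_tendsto_of_le_of_le tendsto_const_nhds t1 (fun _ => zero_le) ?_
    rintro ⟨h, k⟩
    have hh := ha.1.comp_measurePreserving (hmp h)
    have hk' := hg.1.comp_measurePreserving (hmp h)
    have hm : AEStronglyMeasurable (fun x => a (x + h) • g (x + h) - a x • g x) volume :=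
      (hh.smul hk').sub (ha.1.smul hg.1)
    have hm2 : AEStronglyMeasurable (fun x => g (x + (k - h)) - g x) volume :=
      (hg.1.comp_measurePreserving (hmp (k - h))).sub hg.1
    calc ∫⁻ x, ‖a (x + h) • g (x + k) - a x • g x‖ₑ
        ≤ ∫⁻ x, (‖a (x + h)‖ₑ * ‖g (x + h + (k - h)) - g (x + h)‖ₑ
            + ‖a (x + h) • g (x + h) - a x • g x‖ₑ) := by
          refine lintegral_mono fun x => ?_
          have e : a (x + h) • g (x + k) - a x • g x =
            a (x + h) • (g (x + h + (k - h)) - g (x + h))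
              + (a (x + h) • g (x + h) - a x • g x) := by
            rw [show x + h + (k - h) = x + k by abel, smul_sub]; abel
          rw [e]
          refine (enorm_add_le _ _).trans ?_
          rw [enorm_smul]
      _ = (∫⁻ x, ‖a (x + h)‖ₑ * ‖g (x + h + (k - h)) - g (x + h)‖ₑ)
            + ∫⁻ x, ‖a (x + h) • g (x + h) - a x • g x‖ₑ := lintegral_add_right' _ hm.enorm
      _ ≤ _ := by
          simp only [eLpNorm_one_eq_lintegral_enorm]
          gcongr
          exact lintegral_translate_mul_le hq ha.1 hm2 h h

theorem MeasureTheory.MemLp.tendsto_eLpNorm_indicator_compl_ball {F : Type*} [NormedAddCommGroup F]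
    {p : ℝ≥0∞} (hp1 : 1 ≤ p) (hp : p ≠ ∞) {f : EuclideanSpace ℝ (Fin d) → F}
    (hf : MemLp f p volume) :
    Tendsto (fun R : ℝ => eLpNorm ((Metric.ball 0 R)ᶜ.indicator f) p volume) atTop (𝓝 0) := by
  have hp0 : p ≠ 0 := (one_pos.trans_le hp1).ne'
  have hpr : 0 < p.toReal := ENNReal.toReal_pos hp0 hp
  have hfin := lintegral_rpow_enorm_lt_top_of_eLpNorm_lt_top hp0 hp hf.2
  have key : Tendsto (fun R : ℝ => ∫⁻ x, ‖(Metric.ball 0 R)ᶜ.indicator f x‖ₑ ^ p.toReal)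
      atTop (𝓝 (∫⁻ x : EuclideanSpace ℝ (Fin d), 0)) := by
    refine tendsto_lintegral_filter_of_dominated_convergence' (fun x => ‖f x‖ₑ ^ p.toReal) ?_ ?_
      hfin.ne ?_
    · refine Eventually.of_forall fun R => ?_
      exact ((hf.1.indicator Metric.isOpen_ball.measurableSet.compl).enorm).pow_const _
    · refine Eventually.of_forall fun R => Eventually.of_forall fun x => ?_
      gcongr
      exact enorm_indicator_le_enorm_self _ _
    · refine Eventually.of_forall fun x => tendsto_const_nhds.congr' ?_
      filter_upwards [eventually_gt_atTop ‖x‖] with R hR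
      rw [indicator_of_notMem (by simpa using hR)]
      simp [hpr]
  rw [lintegral_zero] at key
  have h2 := (ENNReal.continuous_rpow_const (y := 1 / p.toReal)).tendsto 0 |>.comp key
  rw [ENNReal.zero_rpow_of_pos (by positivity)] at h2
  refine h2.congr fun R => ?_
  rw [eLpNorm_eq_lintegral_rpow_enorm_toReal hp0 hp]
  rfl

theorem measurable_eLpNorm_slice {X Y F : Type*} [MeasurableSpace X] [MeasurableSpace Y]
    [NormedAddCommGroup F] {μ : Measure Y} [SFinite μ] {f : X → Y → F}
    (hf : StronglyMeasurable (Function.uncurry f)) (p : ℝ≥0∞) :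
    Measurable (fun t => eLpNorm (f t) p μ) := by
  have hfe : Measurable (fun z : X × Y => ‖f z.1 z.2‖ₑ) := hf.enorm
  rcases eq_or_ne p 0 with rfl | hp0
  · simp
  rcases eq_or_ne p ∞ with rfl | hp
  -- the sublevel sets of an essential supremum are described by measures of sections
  · refine measurable_of_Iic fun c => ?_
    have : (fun t => eLpNorm (f t) ∞ μ) ⁻¹' Iic c
        = {t | μ (Prod.mk t ⁻¹' {z : X × Y | c < ‖f z.1 z.2‖ₑ}) = 0} := by
      ext t
      simp only [mem_preimage, mem_Iic, mem_ofPred_eq, eLpNorm_exponent_top, eLpNormEssSup]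
      constructor
      · intro h
        have h2 : ∀ᵐ y ∂μ, ‖f t y‖ₑ ≤ c :=
          (ENNReal.ae_le_essSup (fun y => ‖f t y‖ₑ)).mono fun y hy => hy.trans h
        rw [ae_iff] at h2
        simpa using h2
      · intro h
        refine essSup_le_of_ae_le c ?_
        rw [Filter.EventuallyLE, ae_iff]
        simpa using h
    rw [this]
    exact (measurable_measure_prodMk_left (measurableSet_lt measurable_const hfe))
      (measurableSet_singleton 0)
  · simp_rw [eLpNorm_eq_lintegral_rpow_enorm_toReal hp0 hp]
    exact ((hfe.pow_const _).lintegral_prod_right').pow_const _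

theorem measurable_eLpNorm_indicator {F : Type*} [NormedAddCommGroup F]
    {f : ℝ → EuclideanSpace ℝ (Fin d) → F} (hf : StronglyMeasurable (Function.uncurry f))
    {Z : Set (EuclideanSpace ℝ (Fin d))} (hZ : MeasurableSet Z) (q : ℝ≥0∞) :
    Measurable fun t => eLpNorm (Z.indicator (f t)) q volume := by
  have : StronglyMeasurable (Function.uncurry fun t => Z.indicator (f t)) :=
    hf.indicator (hZ.preimage measurable_snd)
  exact measurable_eLpNorm_slice this q

/-! ### Test functions and the mean value formula for weak gradients -/

theorem IsTestFunction.comp_sub_const {X : Type*} [NormedAddCommGroup X] [NormedSpace ℝ X]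
    {φ : X → ℝ} (hφ : IsTestFunction φ) (z : X) : IsTestFunction (fun x => φ (x - z)) :=
  ⟨hφ.1.comp (contDiff_id.sub contDiff_const),
    hφ.2.comp_homeomorph (Homeomorph.subRight z)⟩

theorem IsTestFunction.fderiv_apply {X : Type*} [NormedAddCommGroup X] [NormedSpace ℝ X]
    {φ : X → ℝ} (hφ : IsTestFunction φ) (e : X) : IsTestFunction (fun x => fderiv ℝ φ x e) :=
  ⟨(hφ.1.fderiv_right (m := ((⊤ : ℕ∞) : WithTop ℕ∞)) (by simp)).clm_apply contDiff_const,
    hφ.2.fderiv_apply (𝕜 := ℝ) e⟩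

theorem IsTestFunction.continuous {X : Type*} [NormedAddCommGroup X] [NormedSpace ℝ X]
    {φ : X → ℝ} (hφ : IsTestFunction φ) : Continuous φ := hφ.1.continuous

theorem IsTestFunction.integrable {X : Type*} [NormedAddCommGroup X] [NormedSpace ℝ X]
    [MeasurableSpace X] [OpensMeasurableSpace X] {μ : Measure X} [IsFiniteMeasureOnCompacts μ]
    {φ : X → ℝ} (hφ : IsTestFunction φ) : Integrable φ μ :=
  hφ.continuous.integrable_of_hasCompactSupport hφ.2

theorem HasCompactSupport.exists_forall_norm_le {X : Type*} [SeminormedAddCommGroup X]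
    {F : Type*} [NormedAddCommGroup F] {φ : X → F} (hφ : HasCompactSupport φ) :
    ∃ R : ℝ, 0 < R ∧ ∀ x, φ x ≠ 0 → ‖x‖ ≤ R := by
  obtain ⟨R, hR0, hR⟩ := hφ.isCompact.isBounded.subset_closedBall_lt 0 0
  exact ⟨R, hR0, fun x hx => by simpa using hR (subset_tsupport _ hx)⟩

theorem lintegral_ball_translate_le {F : Type*} [NormedAddCommGroup F]
    (f : EuclideanSpace ℝ (Fin d) → F) {z : EuclideanSpace ℝ (Fin d)} {R M : ℝ} (hz : ‖z‖ ≤ M) :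
    ∫⁻ x in Metric.closedBall 0 R, ‖f (x + z)‖ₑ ≤ ∫⁻ x in Metric.closedBall 0 (R + M), ‖f x‖ₑ := by
  rw [← lintegral_indicator Metric.isClosed_closedBall.measurableSet,
    ← lintegral_indicator Metric.isClosed_closedBall.measurableSet,
    ← lintegral_add_right_eq_self (f := (Metric.closedBall 0 (R + M)).indicator _) z]
  refine lintegral_mono fun x => ?_
  by_cases hx : x ∈ Metric.closedBall 0 R
  · have hxz : x + z ∈ Metric.closedBall 0 (R + M) := by
      rw [mem_closedBall_zero_iff] at hx ⊢
      exact (norm_add_le _ _).trans (by linarith)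
    rw [indicator_of_mem hx, indicator_of_mem hxz]
  · rw [indicator_of_notMem hx]
    exact zero_le

theorem MeasureTheory.LocallyIntegrable.lintegral_closedBall_lt_top {F : Type*}
    [NormedAddCommGroup F]
    {f : EuclideanSpace ℝ (Fin d) → F} (hf : LocallyIntegrable f) (R : ℝ) :
    ∫⁻ x in Metric.closedBall 0 R, ‖f x‖ₑ < ∞ :=
  (hf.integrableOn_isCompact (isCompact_closedBall 0 R)).2

theorem MeasureTheory.LocallyIntegrable.integrable_prod_smul_translate {F : Type*}
    [NormedAddCommGroup F] [NormedSpace ℝ F]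
    {f : EuclideanSpace ℝ (Fin d) → F} (hf : LocallyIntegrable f) (hfm : StronglyMeasurable f)
    {g : EuclideanSpace ℝ (Fin d) → ℝ} (hg : Continuous g) (hgs : HasCompactSupport g)
    (z : EuclideanSpace ℝ (Fin d)) :
    Integrable (fun p : EuclideanSpace ℝ (Fin d) × ℝ => g p.1 • f (p.1 + p.2 • z))
      (volume.prod (volume.restrict (Icc 0 1))) := by
  have hm : StronglyMeasurable
      (fun p : EuclideanSpace ℝ (Fin d) × ℝ => g p.1 • f (p.1 + p.2 • z)) :=
    (hg.stronglyMeasurable.comp_measurable measurable_fst).smul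
      (hfm.comp_measurable (by fun_prop))
  refine ⟨hm.aestronglyMeasurable, ?_⟩
  obtain ⟨C, hC⟩ := hgs.exists_bound_of_continuous hg
  obtain ⟨R, -, hR⟩ := hgs.exists_forall_norm_le
  rw [HasFiniteIntegral, lintegral_prod_symm' _ hm.enorm]
  have hb : ∀ s ∈ Icc (0 : ℝ) 1, ∫⁻ x, ‖g x • f (x + s • z)‖ₑ
      ≤ ENNReal.ofReal C * ∫⁻ x in Metric.closedBall 0 (R + ‖z‖), ‖f x‖ₑ := by
    intro s hs
    calc ∫⁻ x, ‖g x • f (x + s • z)‖ₑ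
        ≤ ∫⁻ x, ENNReal.ofReal C *
            (Metric.closedBall 0 R).indicator (fun x => ‖f (x + s • z)‖ₑ) x := by
          refine lintegral_mono fun x => ?_
          by_cases hx : g x = 0
          · simp [hx]
          · rw [indicator_of_mem (by simpa using hR x hx), enorm_smul]
            gcongr
            rw [← ofReal_norm]
            exact ENNReal.ofReal_le_ofReal (hC x)
      _ = ENNReal.ofReal C * ∫⁻ x in Metric.closedBall 0 R, ‖f (x + s • z)‖ₑ := by
          rw [lintegral_const_mul' _ _ ENNReal.ofReal_ne_top,
            lintegral_indicator Metric.isClosed_closedBall.measurableSet]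
      _ ≤ _ := by
          refine mul_le_mul' le_rfl (lintegral_ball_translate_le f ?_)
          rw [norm_smul, Real.norm_of_nonneg hs.1]
          exact mul_le_of_le_one_left (norm_nonneg _) hs.2
  refine (setLIntegral_mono measurable_const hb).trans_lt ?_
  simp only [lintegral_const, Measure.restrict_apply, MeasurableSet.univ, univ_inter,
    Real.volume_Icc, sub_zero, ENNReal.ofReal_one, mul_one]
  exact ENNReal.mul_lt_top ENNReal.ofReal_lt_top (hf.lintegral_closedBall_lt_top _)

theorem MeasureTheory.LocallyIntegrable.integral_translate {F : Type*}
    [NormedAddCommGroup F] [NormedSpace ℝ F]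
    {f : EuclideanSpace ℝ (Fin d) → F} (hf : LocallyIntegrable f) (hfm : StronglyMeasurable f)
    (z : EuclideanSpace ℝ (Fin d)) :
    LocallyIntegrable (fun x => ∫ s in Icc (0 : ℝ) 1, f (x + s • z)) := by
  rw [locallyIntegrable_iff]
  intro k hk
  obtain ⟨R, hR⟩ := hk.isBounded.subset_closedBall 0
  let b : ContDiffBump (0 : EuclideanSpace ℝ (Fin d)) := ⟨|R| + 1, |R| + 2, by positivity,
      by linarith⟩
  have h1 := (hf.integrable_prod_smul_translate hfm b.continuous b.hasCompactSupport
    z).integral_prod_left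
  refine (h1.integrableOn (s := k)).congr_fun (fun x hx => ?_) hk.measurableSet
  have : b x = 1 := b.one_of_mem_closedBall (Metric.closedBall_subset_closedBall (by
    change R ≤ |R| + 1; linarith [le_abs_self R]) (hR hx))
  simp [this]

/-- A locally integrable field with a weak gradient satisfies the mean value formula: for every
shift `z`, the increment `u (x + z) - u x` is the integral of the gradient along the segment, for
almost every `x`. -/
theorem HasWeakGradient.translate_sub_ae_eq
    {u : EuclideanSpace ℝ (Fin d) → EuclideanSpace ℝ (Fin d)}
    {G : EuclideanSpace ℝ (Fin d) → EuclideanSpace ℝ (Fin d) →L[ℝ] EuclideanSpace ℝ (Fin d)}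
    (h : HasWeakGradient u G) (hum : StronglyMeasurable u) (hGm : StronglyMeasurable G)
    (z : EuclideanSpace ℝ (Fin d)) :
    ∀ᵐ x, u (x + z) - u x = ∫ s in Icc (0 : ℝ) 1, G (x + s • z) z := by
  obtain ⟨hu, hG, hw⟩ := h
  have hGz : LocallyIntegrable (fun x => G x z) := by
    rw [locallyIntegrable_iff] at hG ⊢
    exact fun k hk => (hG k hk).apply_continuousLinearMap z
  have hGzm : StronglyMeasurable (fun x => G x z) :=
    (ContinuousLinearMap.apply ℝ (EuclideanSpace ℝ
        (Fin d)) z).continuous.comp_stronglyMeasurable hGm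
  have huz : LocallyIntegrable (fun x => u (x + z)) := by
    rw [locallyIntegrable_iff]
    intro k hk
    have := hu.integrableOn_isCompact
        (hk.image (continuous_id.add continuous_const) : IsCompact ((fun x => x + z) '' k))
    exact ((measurePreserving_add_right volume z).integrableOn_image
      (MeasurableEquiv.addRight z).measurableEmbedding).1 this
  refine ae_eq_of_integral_contDiff_smul_eq (huz.sub hu) (hGz.integral_translate hGzm z) ?_
  intro g hg hgs
  have hgt : IsTestFunction g := ⟨hg, hgs⟩
  -- Both sides are tested against `g`; the shifts are moved onto the test function.
  have hR : ∫ x, g x • ∫ s in Icc (0 : ℝ) 1, G (x + s • z) z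
      = - ∫ s in Icc (0 : ℝ) 1, ∫ x, (fderiv ℝ g (x - s • z) z) • u x := by
    have hI := hGz.integrable_prod_smul_translate hGzm hgt.continuous hgs z
    calc ∫ x, g x • ∫ s in Icc (0 : ℝ) 1, G (x + s • z) z
        = ∫ x, ∫ s in Icc (0 : ℝ) 1, g x • G (x + s • z) z := by
          congr 1 with x : 1
          exact (integral_smul _ _).symm
      _ = ∫ s in Icc (0 : ℝ) 1, ∫ x, g x • G (x + s • z) z := integral_integral_swap hI
      _ = ∫ s in Icc (0 : ℝ) 1, - ∫ x, (fderiv ℝ g (x - s • z) z) • u x := by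
          congr 1 with s : 1
          have h1 := hw (fun x => g (x - s • z)) (hgt.comp_sub_const _) z
          have e : ∀ x, fderiv ℝ (fun x => g (x - s • z)) x = fderiv ℝ g (x - s • z) :=
            fun x => fderiv_comp_sub _
          simp only [e] at h1
          rw [h1, neg_neg, ← integral_add_right_eq_self (fun x => g (x - s • z) • G x z) (s • z)]
          simp
      _ = _ := integral_neg _
  have hL : ∫ x, g x • (u (x + z) - u x)
      = - ∫ x, ∫ s in Icc (0 : ℝ) 1, (fderiv ℝ g (x - s • z) z) • u x := by
    have i1 : Integrable (fun x => g (x - z) • u x) :=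
      hu.integrable_smul_left_of_hasCompactSupport (hgt.comp_sub_const z).continuous
        (hgt.comp_sub_const z).2
    have i2 : Integrable (fun x => g x • u x) :=
      hu.integrable_smul_left_of_hasCompactSupport hgt.continuous hgs
    have i3 : Integrable (fun x => g x • u (x + z)) :=
      huz.integrable_smul_left_of_hasCompactSupport hgt.continuous hgs
    calc ∫ x, g x • (u (x + z) - u x)
        = (∫ x, g x • u (x + z)) - ∫ x, g x • u x := by
          simp_rw [smul_sub]; exact integral_sub i3 i2
      _ = (∫ x, g (x - z) • u x) - ∫ x, g x • u x := by
          rw [← integral_add_right_eq_self (fun x => g (x - z) • u x) z]; simp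
      _ = ∫ x, (g (x - z) - g x) • u x := by
          simp_rw [sub_smul]; exact (integral_sub i1 i2).symm
      _ = ∫ x, - ∫ s in Icc (0 : ℝ) 1, (fderiv ℝ g (x - s • z) z) • u x := by
          congr 1 with x : 1
          rw [integral_smul_const, ← neg_smul]
          congr 1
          have hd : ∀ s ∈ uIcc (0 : ℝ) 1, HasDerivAt (fun s : ℝ => g (x - s • z))
              (- fderiv ℝ g (x - s • z) z) s := by
            intro s _
            have h1 : HasDerivAt (fun s : ℝ => x - s • z) (-z) s := by
              simpa using ((hasDerivAt_id s).smul_const z).const_sub x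
            have h2 : HasDerivAt (fun s : ℝ => g (x - s • z)) (fderiv ℝ g (x - s • z) (-z)) s :=
              ((hg.differentiable (by simp)).differentiableAt
                (x := x - s • z)).hasFDerivAt.comp_hasDerivAt s h1
            simpa using h2
          have := intervalIntegral.integral_eq_sub_of_hasDerivAt hd (by
            refine Continuous.intervalIntegrable ?_ _ _
            have := (hgt.fderiv_apply z).continuous
            fun_prop)
          rw [intervalIntegral.integral_neg, intervalIntegral.integral_of_le zero_le_one,
            ← integral_Icc_eq_integral_Ioc] at this
          simp at this
          rw [this]
      _ = _ := integral_neg _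
  rw [hR]
  refine hL.trans ?_
  congr 1
  refine integral_integral_swap ?_
  obtain ⟨C, hC⟩ := (hgt.fderiv_apply z).2.exists_bound_of_continuous
      (hgt.fderiv_apply z).continuous
  obtain ⟨R, -, hR'⟩ := (hgt.fderiv_apply z).2.exists_forall_norm_le
  have hfc := (hgt.fderiv_apply z).continuous
  have hB : Integrable (fun p : EuclideanSpace ℝ (Fin d) × ℝ =>
      (Metric.closedBall 0 (R + ‖z‖)).indicator u p.1 )
          (volume.prod (volume.restrict (Icc (0 : ℝ) 1))) :=
    ((hu.integrableOn_isCompact (isCompact_closedBall 0 (R + ‖z‖))).integrable_indicator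
      Metric.isClosed_closedBall.measurableSet).comp_fst _
  refine (hB.norm.const_mul C).mono' ?_ ?_
  · refine ((Continuous.stronglyMeasurable
      (f := fun p : EuclideanSpace ℝ (Fin d) × ℝ => fderiv ℝ g (p.1 - p.2 • z) z)
          (by fun_prop)).smul (hum.comp_measurable measurable_fst)).aestronglyMeasurable
  · have hs : ∀ᵐ p : EuclideanSpace ℝ (Fin d) × ℝ ∂(volume.prod (volume.restrict (Icc (0 : ℝ) 1))),
      p.2 ∈ Icc (0 : ℝ) 1 :=
      Measure.quasiMeasurePreserving_snd.ae (ae_restrict_mem measurableSet_Icc)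
    filter_upwards [hs] with p hp
    simp only [Function.uncurry]
    by_cases h0 : fderiv ℝ g (p.1 - p.2 • z) z = 0
    · rw [h0, zero_smul, norm_zero]
      exact mul_nonneg ((norm_nonneg _).trans (hC 0)) (norm_nonneg _)
    · have h1 := hR' _ h0
      have h2 : ‖p.2 • z‖ ≤ ‖z‖ := by
        rw [norm_smul, Real.norm_of_nonneg hp.1]
        exact mul_le_of_le_one_left (norm_nonneg _) hp.2
      have h3 : ‖p.1‖ ≤ R + ‖z‖ := by
        have := norm_add_le (p.1 - p.2 • z) (p.2 • z)
        rw [sub_add_cancel] at this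
        linarith
      rw [indicator_of_mem (by simpa using h3), norm_smul]
      gcongr
      exact hC _

/-! ### The commutator of transport and mollification -/

theorem MeasureTheory.StronglyMeasurable.clm_apply_fun {X E F : Type*} [MeasurableSpace X]
    [NormedAddCommGroup E] [NormedSpace ℝ E] [NormedAddCommGroup F] [NormedSpace ℝ F]
    {L : X → E →L[ℝ] F} {w : X → E} (hL : StronglyMeasurable L) (hw : StronglyMeasurable w) :
    StronglyMeasurable (fun x => L x (w x)) :=
  isBoundedBilinearMap_apply.continuous.comp_stronglyMeasurable (hL.prodMk hw)

theorem inner_gradient_right_eq_fderiv (ψ : EuclideanSpace ℝ (Fin d) → ℝ)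
    (x w : EuclideanSpace ℝ (Fin d)) : inner ℝ w (gradient ψ x) = fderiv ℝ ψ x w := by
  rw [real_inner_comm, gradient, InnerProductSpace.toDual_symm_apply]

theorem EuclideanSpace.map_eq_sum_single {F : Type*} [NormedAddCommGroup F] [NormedSpace ℝ F]
    (L : EuclideanSpace ℝ (Fin d) →L[ℝ] F) (w : EuclideanSpace ℝ (Fin d)) :
    L w = ∑ i, w i • L (EuclideanSpace.single i 1) := by
  conv_lhs => rw [← (EuclideanSpace.basisFun (Fin d) ℝ).sum_repr w]
  simp [map_sum]

/-- The distributional divergence is the trace of the weak gradient. -/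
theorem HasWeakGradient.trace_ae_eq_zero
    {u : EuclideanSpace ℝ (Fin d) → EuclideanSpace ℝ (Fin d)}
    {G : EuclideanSpace ℝ (Fin d) → EuclideanSpace ℝ (Fin d) →L[ℝ] EuclideanSpace ℝ (Fin d)}
    (h : HasWeakGradient u G)
    (hdiv : ∀ ψ : EuclideanSpace ℝ (Fin d) → ℝ, IsTestFunction ψ →
      ∫ x, fderiv ℝ ψ x (u x) = 0) :
    ∀ᵐ x, ∑ i, G x (EuclideanSpace.single i 1) i = 0 := by
  obtain ⟨hu, hG, hw⟩ := h
  have hproj (f : EuclideanSpace ℝ (Fin d) → EuclideanSpace ℝ (Fin d)) (hf : LocallyIntegrable f)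
      (i : Fin d) : LocallyIntegrable (fun x => f x i) := by
    rw [locallyIntegrable_iff] at hf ⊢
    exact fun k hk => (EuclideanSpace.proj (𝕜 := ℝ) i).integrable_comp (hf k hk)
  have hGz (z) : LocallyIntegrable (fun x => G x z) := by
    rw [locallyIntegrable_iff] at hG ⊢
    exact fun k hk => (hG k hk).apply_continuousLinearMap z
  refine ae_eq_zero_of_integral_contDiff_smul_eq_zero ?_ ?_
  · have := locallyIntegrable_finsetSum (μ := volume)
      (f := fun i x => G x (EuclideanSpace.single i 1) i) Finset.univ
      (fun i _ => hproj _ (hGz (EuclideanSpace.single i 1)) i)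
    exact this
  · intro g hg hgs
    have hgt : IsTestFunction g := ⟨hg, hgs⟩
    have h1 (i : Fin d) : ∫ x, fderiv ℝ g x (EuclideanSpace.single i 1) * u x i
        = - ∫ x, g x * G x (EuclideanSpace.single i 1) i := by
      have e := congrArg (EuclideanSpace.proj (𝕜 := ℝ) i) (hw g hgt (EuclideanSpace.single i 1))
      rw [map_neg, ← ContinuousLinearMap.integral_comp_comm,
        ← ContinuousLinearMap.integral_comp_comm] at e
      · simpa using e
      · exact (hGz _).integrable_smul_left_of_hasCompactSupport hgt.continuous hgs
      · exact hu.integrable_smul_left_of_hasCompactSupport (hgt.fderiv_apply _).continuous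
          (hgt.fderiv_apply _).2
    have h2 := hdiv g hgt
    simp only [EuclideanSpace.map_eq_sum_single (fderiv ℝ g _) (u _)] at h2
    rw [integral_finsetSum] at h2
    · simp only [smul_eq_mul, Finset.mul_sum]
      rw [integral_finsetSum]
      · rw [← neg_eq_zero, ← Finset.sum_neg_distrib, ← h2]
        refine Finset.sum_congr rfl fun i _ => ?_
        rw [← h1]
        simp only [smul_eq_mul, mul_comm]
      · intro i _
        exact (hproj _ (hGz _) i).integrable_smul_left_of_hasCompactSupport hgt.continuous hgs
    · intro i _
      simp only [smul_eq_mul, mul_comm (u _ i)]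
      exact (hproj _ hu i).integrable_smul_left_of_hasCompactSupport
        (hgt.fderiv_apply _).continuous (hgt.fderiv_apply _).2

/-- Integration by parts against a linear field. If `L` is trace-free the integral vanishes; this
is the cancellation behind the commutator estimate. -/
theorem IsTestFunction.integral_fderiv_apply_linear {ρ : EuclideanSpace ℝ (Fin d) → ℝ}
    (hρ : IsTestFunction ρ) (L : EuclideanSpace ℝ (Fin d) →L[ℝ] EuclideanSpace ℝ (Fin d)) :
    ∫ z, fderiv ℝ ρ z (L z) = - (∑ i, L (EuclideanSpace.single i 1) i) * ∫ z, ρ z := by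
  simp only [EuclideanSpace.map_eq_sum_single (fderiv ℝ ρ _) (L _), smul_eq_mul]
  have hLi (i : Fin d) : ContDiff ℝ ((⊤ : ℕ∞) : WithTop ℕ∞) (fun z => L z i) :=
    ((EuclideanSpace.proj (𝕜 := ℝ) i).comp L).contDiff
  have hd (i : Fin d) (z w) : fderiv ℝ (fun z => L z i) z w = L w i := by
    have := ((EuclideanSpace.proj (𝕜 := ℝ) i).comp L).hasFDerivAt (x := z)
    exact congrArg (fun A => A w) this.fderiv
  have hi (f : EuclideanSpace ℝ (Fin d) → ℝ) (hf : Continuous f) {g} (hg : IsTestFunction g) :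
      Integrable (fun z => f z * g z) :=
    (hf.mul hg.continuous).integrable_of_hasCompactSupport (hg.2.mul_left)
  rw [integral_finsetSum _ (fun i _ => hi _ (hLi i).continuous (hρ.fderiv_apply _)),
    neg_mul, Finset.sum_mul, ← Finset.sum_neg_distrib]
  refine Finset.sum_congr rfl fun i _ => ?_
  rw [integral_mul_fderiv_eq_neg_fderiv_mul_of_integrable]
  · simp only [hd, integral_const_mul]
  · simp only [hd]; exact hρ.integrable.const_mul _
  · exact hi _ (hLi i).continuous (hρ.fderiv_apply _)
  · exact hi _ (hLi i).continuous hρ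
  · exact fun x _ => (hLi i).differentiable (by simp) x
  · exact fun x _ => hρ.1.differentiable (by simp) x

/-- The rescaled kernel `K_ε(z) = ε^{-d} ρ(z/ε)`. -/
noncomputable def rescaledKernel (ρ : EuclideanSpace ℝ (Fin d) → ℝ) (ε : ℝ)
    (z : EuclideanSpace ℝ (Fin d)) : ℝ :=
  (ε ^ d)⁻¹ * ρ (ε⁻¹ • z)

theorem IsTestFunction.rescaledKernel {ρ : EuclideanSpace ℝ (Fin d) → ℝ}
    (hρ : IsTestFunction ρ) {ε : ℝ} (hε : 0 < ε) : IsTestFunction (rescaledKernel ρ ε) := by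
  refine ⟨contDiff_const.mul (hρ.1.comp (contDiff_const_smul ε⁻¹)), ?_⟩
  exact (hρ.2.comp_smul (inv_ne_zero hε.ne')).mul_left

theorem fderiv_rescaledKernel {ρ : EuclideanSpace ℝ (Fin d) → ℝ}
    (hρ : IsTestFunction ρ) (ε : ℝ) (z : EuclideanSpace ℝ (Fin d)) :
    fderiv ℝ (rescaledKernel ρ ε) z = ((ε ^ d)⁻¹ * ε⁻¹) • fderiv ℝ ρ (ε⁻¹ • z) := by
  have h1 : HasFDerivAt (fun z => ρ (ε⁻¹ • z))
      ((fderiv ℝ ρ (ε⁻¹ • z)).comp (ε⁻¹ • ContinuousLinearMap.id ℝ _)) z :=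
    ((hρ.1.differentiable (by simp)) (ε⁻¹ • z)).hasFDerivAt.comp z
      ((hasFDerivAt_id z).const_smul ε⁻¹)
  have h2 := h1.const_mul (ε ^ d)⁻¹
  refine h2.fderiv.trans ?_
  ext w
  simp [mul_assoc]

theorem integral_eq_smul_integral_sub_smul {F : Type*} [NormedAddCommGroup F] [NormedSpace ℝ F]
    (f : EuclideanSpace ℝ (Fin d) → F) {ε : ℝ} (hε : 0 < ε) (x : EuclideanSpace ℝ (Fin d)) :
    ∫ y, f y = ε ^ d • ∫ z, f (x - ε • z) := by
  rw [Measure.integral_comp_smul volume (fun z => f (x - z)) ε, smul_smul,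
    integral_sub_left_eq_self f volume x]
  simp only [finrank_euclideanSpace, Fintype.card_fin]
  rw [abs_of_pos (by positivity), mul_inv_cancel₀ (by positivity), one_smul]

/-- A standard mollifier. -/
theorem exists_mollifier (d : ℕ) : ∃ ρ : EuclideanSpace ℝ (Fin d) → ℝ, IsTestFunction ρ ∧
    (∀ z, ρ z ≠ 0 → ‖z‖ ≤ 1) ∧ ∫ z, ρ z = 1 := by
  let φ : ContDiffBump (0 : EuclideanSpace ℝ (Fin d)) := ⟨1 / 2, 1, by norm_num, by norm_num⟩
  refine ⟨φ.normed volume, ⟨φ.contDiff_normed, φ.hasCompactSupport_normed⟩, fun z hz => ?_,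
    φ.integral_normed⟩
  have : z ∈ Function.support (φ.normed volume) := hz
  rw [φ.support_normed_eq] at this
  exact (mem_ball_zero_iff.1 this).le

/-- The commutator of the transport operator `v · ∇` with the convolution by `K`:
`r(x) = ∫ a(y) (v(x) - v(y)) · ∇K(x - y) dy`. -/
noncomputable def transportCommutator (K : EuclideanSpace ℝ (Fin d) → ℝ)
    (v : EuclideanSpace ℝ (Fin d) → EuclideanSpace ℝ (Fin d)) (a : EuclideanSpace ℝ (Fin d) → ℝ)
    (x : EuclideanSpace ℝ (Fin d)) : ℝ :=
  ∫ y, a y * fderiv ℝ K (x - y) (v x - v y)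

/-- In the variable `z = (x - y) / ε` the commutator contains the difference quotients of `v`. -/
theorem transportCommutator_rescaledKernel {ρ : EuclideanSpace ℝ (Fin d) → ℝ}
    (hρ : IsTestFunction ρ) {ε : ℝ} (hε : 0 < ε)
    (v : EuclideanSpace ℝ (Fin d) → EuclideanSpace ℝ (Fin d)) (a : EuclideanSpace ℝ (Fin d) → ℝ)
    (x : EuclideanSpace ℝ (Fin d)) :
    transportCommutator (rescaledKernel ρ ε) v a x =
      ∫ z, fderiv ℝ ρ z (a (x - ε • z) • ε⁻¹ • (v x - v (x - ε • z))) := by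
  rw [transportCommutator, integral_eq_smul_integral_sub_smul _ hε x, ← integral_smul]
  congr 1 with z
  rw [sub_sub_cancel, fderiv_rescaledKernel hρ, smul_smul, inv_mul_cancel₀ hε.ne', one_smul]
  simp only [_root_.smul_apply, map_smul, smul_eq_mul]
  field_simp

/-- No integrability of `g` is needed: if the integrand on the right is not integrable, the right
side is infinite. -/
theorem enorm_smul_integral_sub_le {F : Type*} [NormedAddCommGroup F] [NormedSpace ℝ F]
    [CompleteSpace F]
    {X : Type*} [MeasurableSpace X] {μ : Measure X} [IsProbabilityMeasure μ] (c : ℝ) (w : F)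
    {g : X → F} (hg : AEStronglyMeasurable g μ) :
    ‖c • (∫ s, g s ∂μ) - w‖ₑ ≤ ∫⁻ s, ‖c • g s - w‖ₑ ∂μ := by
  by_cases h : Integrable (fun s => c • g s - w) μ
  · have h2 : Integrable (fun s => c • g s) μ := by
      refine (h.add (integrable_const w)).congr (Eventually.of_forall fun s => ?_)
      simp
    have := integral_sub h2 (integrable_const w)
    rw [integral_smul, integral_const, probReal_univ, one_smul] at this
    rw [← this]
    exact enorm_integral_le_lintegral_enorm _
  · have : ∫⁻ s, ‖c • g s - w‖ₑ ∂μ = ∞ := by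
      by_contra h3
      exact h ⟨(hg.const_smul c).sub aestronglyMeasurable_const, lt_top_iff_ne_top.2 h3⟩
    rw [this]; exact le_top

/-- A function `g` with vanishing integral may be subtracted before the norm is taken. No
integrability of `f` is needed: if `f - g` is not integrable, the right side is infinite. -/
theorem enorm_integral_le_lintegral_enorm_sub {F : Type*} [NormedAddCommGroup F] [NormedSpace ℝ F]
    {X : Type*} [MeasurableSpace X] {μ : Measure X} {f g : X → F}
    (hf : AEStronglyMeasurable f μ) (hg : Integrable g μ) (hg0 : ∫ x, g x ∂μ = 0) :
    ‖∫ x, f x ∂μ‖ₑ ≤ ∫⁻ x, ‖f x - g x‖ₑ ∂μ := by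
  by_cases h : Integrable (fun x => f x - g x) μ
  · have h2 : Integrable f μ :=
      (h.add hg).congr (Eventually.of_forall fun s => by simp)
    have := integral_sub h2 hg
    rw [hg0, sub_zero] at this
    rw [← this]
    exact enorm_integral_le_lintegral_enorm _
  · have : ∫⁻ x, ‖f x - g x‖ₑ ∂μ = ∞ := by
      by_contra h3
      exact h ⟨hf.sub hg.1, lt_top_iff_ne_top.2 h3⟩
    rw [this]; exact le_top

/-- The commutator is bounded in `L¹` by the modulus of continuity in `L¹` of the products
`a(· + h) G(· + k)`: the increments of `v` are integrals of `G`, and the trace-free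
`a(x) G(x)` can be subtracted because `∫ ∇ρ(z) · G(x)z dz = -(tr G(x)) ∫ ρ = 0`. -/
theorem lintegral_transportCommutator_le {ρ : EuclideanSpace ℝ (Fin d) → ℝ}
    (hρ : IsTestFunction ρ) (hρs : ∀ z, ρ z ≠ 0 → ‖z‖ ≤ 1) {ε : ℝ} (hε : 0 < ε)
    {v : EuclideanSpace ℝ (Fin d) → EuclideanSpace ℝ (Fin d)}
    {G : EuclideanSpace ℝ (Fin d) → EuclideanSpace ℝ (Fin d) →L[ℝ] EuclideanSpace ℝ (Fin d)}
    (hvG : HasWeakGradient v G) (hv : StronglyMeasurable v) (hG : StronglyMeasurable G)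
    (htr : ∀ᵐ x, ∑ i, G x (EuclideanSpace.single i 1) i = 0)
    {a : EuclideanSpace ℝ (Fin d) → ℝ} (ha : StronglyMeasurable a) {ω : ℝ≥0∞}
    (hω : ∀ h k : EuclideanSpace ℝ (Fin d), ‖h‖ ≤ ε → ‖k‖ ≤ ε →
      ∫⁻ x, ‖a (x + h) • G (x + k) - a x • G x‖ₑ ≤ ω) :
    ∫⁻ x, ‖transportCommutator (rescaledKernel ρ ε) v a x‖ₑ
      ≤ (∫⁻ z, ‖fderiv ℝ ρ z‖ₑ * ‖z‖ₑ) * ω := by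
  have hdρ : Continuous (fderiv ℝ ρ) := hρ.1.continuous_fderiv (by simp)
  have hdρs : ∀ z, fderiv ℝ ρ z ≠ 0 → ‖z‖ ≤ 1 := by
    intro z hz
    have h1 : z ∈ tsupport ρ := support_fderiv_subset ℝ hz
    have h2 : tsupport ρ ⊆ Metric.closedBall 0 1 :=
      closure_minimal (fun z hz => by simpa using hρs z hz) Metric.isClosed_closedBall
    simpa using h2 h1
  have hm1 : StronglyMeasurable (fun p : EuclideanSpace ℝ (Fin d) × EuclideanSpace ℝ (Fin d) =>
      a (p.1 - ε • p.2) • ε⁻¹ • (v p.1 - v (p.1 - ε • p.2)) - a p.1 • G p.1 p.2) := by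
    refine StronglyMeasurable.sub ?_ ?_
    · refine (ha.comp_measurable (by fun_prop)).smul (StronglyMeasurable.fun_const_smul ?_ ε⁻¹)
      exact (hv.comp_measurable measurable_fst).sub (hv.comp_measurable (by fun_prop))
    · refine (ha.comp_measurable measurable_fst).smul ?_
      exact StronglyMeasurable.clm_apply_fun
          (hG.comp_measurable measurable_fst) measurable_snd.stronglyMeasurable
  have hm0 : StronglyMeasurable (fun p : EuclideanSpace ℝ (Fin d) × EuclideanSpace ℝ (Fin d) =>
      fderiv ℝ ρ p.2) := hdρ.stronglyMeasurable.comp_measurable measurable_snd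
  calc ∫⁻ x, ‖transportCommutator (rescaledKernel ρ ε) v a x‖ₑ
      ≤ ∫⁻ x, ∫⁻ z, ‖fderiv ℝ ρ z‖ₑ *
          ‖a (x - ε • z) • ε⁻¹ • (v x - v (x - ε • z)) - a x • G x z‖ₑ := by
        refine lintegral_mono_ae ?_
        filter_upwards [htr] with x hx
        rw [transportCommutator_rescaledKernel hρ hε]
        have h1 : ∫ z, fderiv ℝ ρ z (a x • G x z) = 0 := by
          have := hρ.integral_fderiv_apply_linear (a x • G x)
          simp only [_root_.smul_apply] at this
          rw [this]
          simp [← Finset.mul_sum, hx]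
        have h2 : Integrable (fun z => fderiv ℝ ρ z (a x • G x z)) := by
          refine Continuous.integrable_of_hasCompactSupport (by fun_prop) ?_
          refine HasCompactSupport.of_support_subset_isCompact (isCompact_closedBall 0 1) ?_
          intro z hz
          have := hdρs z (fun h => hz (by simp [h]))
          simpa using this
        refine (enorm_integral_le_lintegral_enorm_sub ?_ h2 h1).trans ?_
        · refine StronglyMeasurable.aestronglyMeasurable ?_
          refine StronglyMeasurable.clm_apply_fun hdρ.stronglyMeasurable ?_
          refine (ha.comp_measurable (by fun_prop)).smul (StronglyMeasurable.fun_const_smul ?_ ε⁻¹)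
          exact stronglyMeasurable_const.sub (hv.comp_measurable (by fun_prop))
        · refine lintegral_mono fun z => ?_
          rw [← map_sub]
          exact ContinuousLinearMap.le_opENorm _ _
    _ = ∫⁻ z, ∫⁻ x, ‖fderiv ℝ ρ z‖ₑ *
          ‖a (x - ε • z) • ε⁻¹ • (v x - v (x - ε • z)) - a x • G x z‖ₑ :=
        lintegral_lintegral_swap (hm0.enorm.mul hm1.enorm).aemeasurable
    _ ≤ ∫⁻ z, ‖fderiv ℝ ρ z‖ₑ * ‖z‖ₑ * ω := by
        refine lintegral_mono fun z => ?_
        rw [lintegral_const_mul' _ _ enorm_ne_top, mul_assoc]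
        by_cases hz : fderiv ℝ ρ z = 0
        · rw [hz, ← ofReal_norm, norm_zero, ENNReal.ofReal_zero, zero_mul, zero_mul]
        have hz1 := hdρs z hz
        gcongr
        have hf := hvG.translate_sub_ae_eq hv hG (ε • z)
        have hf2 := (measurePreserving_sub_right volume (ε • z)).quasiMeasurePreserving.ae hf
        simp only [sub_add_cancel] at hf2
        have : IsProbabilityMeasure (volume.restrict (Icc (0 : ℝ) 1)) := ⟨by simp⟩
        have hsm : StronglyMeasurable (fun p : EuclideanSpace ℝ (Fin d) × ℝ =>
            a (p.1 - ε • z) • G (p.1 - ε • z + p.2 • ε • z) - a p.1 • G p.1) := by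
          refine StronglyMeasurable.sub ?_ ?_
          · exact (ha.comp_measurable (by fun_prop)).smul (hG.comp_measurable (by fun_prop))
          · exact (ha.comp_measurable measurable_fst).smul (hG.comp_measurable measurable_fst)
        calc ∫⁻ x, ‖a (x - ε • z) • ε⁻¹ • (v x - v (x - ε • z)) - a x • G x z‖ₑ
            ≤ ∫⁻ x, ∫⁻ s in Icc (0 : ℝ) 1,
              ‖z‖ₑ * ‖a (x - ε • z) • G (x - ε • z + s • ε • z) - a x • G x‖ₑ := by
              refine lintegral_mono_ae ?_
              filter_upwards [hf2] with x hx
              rw [hx]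
              have e : ε⁻¹ • ∫ s in Icc (0 : ℝ) 1, G (x - ε • z + s • ε • z) (ε • z)
                  = ∫ s in Icc (0 : ℝ) 1, G (x - ε • z + s • ε • z) z := by
                rw [← integral_smul]
                congr 1 with s : 1
                rw [map_smul, smul_smul, inv_mul_cancel₀ hε.ne', one_smul]
              rw [e]
              refine (enorm_smul_integral_sub_le _ _ ?_).trans ?_
              · refine StronglyMeasurable.aestronglyMeasurable ?_
                exact StronglyMeasurable.clm_apply_fun
                  (hG.comp_measurable (by fun_prop)) stronglyMeasurable_const
              · refine lintegral_mono fun s => ?_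
                rw [mul_comm]
                exact ContinuousLinearMap.le_opENorm
                  (a (x - ε • z) • G (x - ε • z + s • ε • z) - a x • G x) z
          _ = ∫⁻ s in Icc (0 : ℝ) 1, ∫⁻ x,
              ‖z‖ₑ * ‖a (x - ε • z) • G (x - ε • z + s • ε • z) - a x • G x‖ₑ :=
              lintegral_lintegral_swap (hsm.enorm.const_mul _).aemeasurable
          _ ≤ ∫⁻ s in Icc (0 : ℝ) 1, ‖z‖ₑ * ω := by
              refine setLIntegral_mono measurable_const fun s hs => ?_
              rw [lintegral_const_mul' _ _ enorm_ne_top]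
              gcongr
              have := hω (-(ε • z)) (-((1 - s) • ε • z)) ?_ ?_
              · refine le_trans (le_of_eq (lintegral_congr fun x => ?_)) this
                rw [← sub_eq_add_neg,
                  show x - ε • z + s • ε • z = x + -((1 - s) • ε • z) by module]
              · rw [norm_neg, norm_smul, Real.norm_of_nonneg hε.le]
                exact mul_le_of_le_one_right hε.le hz1
              · rw [norm_neg, norm_smul, norm_smul, Real.norm_of_nonneg hε.le,
                  Real.norm_of_nonneg (by linarith [hs.2])]
                refine (mul_le_of_le_one_left (by positivity) (by linarith [hs.1])).trans ?_
                exact mul_le_of_le_one_right hε.le hz1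
          _ = ‖z‖ₑ * ω := by simp
    _ = _ := lintegral_mul_const _ (by fun_prop)

/-! ### Mollification -/

theorem MeasureTheory.LocallyIntegrable.integrable_clm_apply
    {E F : Type*} [NormedAddCommGroup E] [MeasurableSpace E] [OpensMeasurableSpace E]
    [NormedAddCommGroup F] [NormedSpace ℝ F] [SecondCountableTopology E]
    [LocallyCompactSpace E] {μ : Measure E}
    {v : E → F} (hv : LocallyIntegrable v μ)
    {L : E → F →L[ℝ] ℝ} (hL : Continuous L) (hLs : HasCompactSupport L) :
    Integrable (fun x => L x (v x)) μ := by
  have h1 : Integrable (fun x => ‖L x‖ • ‖v x‖) μ := by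
    have hn : LocallyIntegrable (fun x => ‖v x‖) μ :=
      fun x => (hv x).norm
    exact hn.integrable_smul_left_of_hasCompactSupport hL.norm hLs.norm
  refine h1.mono' ?_ ?_
  · exact isBoundedBilinearMap_apply.continuous.comp_aestronglyMeasurable
      (hL.aestronglyMeasurable.prodMk hv.aestronglyMeasurable)
  · exact Eventually.of_forall fun x => (L x).le_opNorm _

theorem ContDiff.fderiv_apply_const {E : Type*} [NormedAddCommGroup E] [NormedSpace ℝ E]
    {f : E → ℝ} (hf : ContDiff ℝ ((⊤ : ℕ∞) : WithTop ℕ∞) f) (e : E) :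
    ContDiff ℝ ((⊤ : ℕ∞) : WithTop ℕ∞) (fun x => fderiv ℝ f x e) :=
  (hf.fderiv_right (m := ((⊤ : ℕ∞) : WithTop ℕ∞)) (by simp)).clm_apply contDiff_const

theorem ContDiff.laplacian_eq_sum_fderiv {f : EuclideanSpace ℝ (Fin d) → ℝ}
    (hf : ContDiff ℝ ((⊤ : ℕ∞) : WithTop ℕ∞) f) (x : EuclideanSpace ℝ (Fin d)) :
    (Δ f) x = ∑ i, fderiv ℝ (fun y => fderiv ℝ f y (EuclideanSpace.single i 1)) x
      (EuclideanSpace.single i 1) := by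
  rw [InnerProductSpace.laplacian_eq_iteratedFDeriv_orthonormalBasis f
    (EuclideanSpace.basisFun (Fin d) ℝ)]
  refine Finset.sum_congr rfl fun i _ => ?_
  have hd : DifferentiableAt ℝ (fderiv ℝ f) x :=
    (hf.fderiv_right (m := ((⊤ : ℕ∞) : WithTop ℕ∞)) (by simp)).differentiable (by simp) x
  rw [iteratedFDeriv_two_apply]
  have := (hd.hasFDerivAt.clm_apply (hasFDerivAt_const (EuclideanSpace.single i (1 : ℝ)) x)).fderiv
  rw [this]
  simp

theorem IsTestFunction.sum {X ι : Type*} [NormedAddCommGroup X] [NormedSpace ℝ X] (s : Finset ι)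
    {φ : ι → X → ℝ} (hφ : ∀ i ∈ s, IsTestFunction (φ i)) :
    IsTestFunction (fun x => ∑ i ∈ s, φ i x) := by
  classical
  refine ⟨ContDiff.sum fun i hi => (hφ i hi).1, ?_⟩
  induction s using Finset.induction_on with
  | empty => simpa using! HasCompactSupport.zero
  | insert a t ha ih =>
    simp only [Finset.sum_insert ha]
    exact (hφ a (by simp)).2.add (ih fun i hi => hφ i (by simp [hi]))

theorem IsTestFunction.laplacian {f : EuclideanSpace ℝ (Fin d) → ℝ} (hf : IsTestFunction f) :
    IsTestFunction (Δ f) := by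
  have : (Δ f) = fun x => ∑ i, fderiv ℝ (fun y => fderiv ℝ f y (EuclideanSpace.single i 1)) x
      (EuclideanSpace.single i 1) := funext fun x => hf.1.laplacian_eq_sum_fderiv x
  rw [this]
  exact IsTestFunction.sum _ fun i _ => (hf.fderiv_apply _).fderiv_apply _

/-- The convolution `a ∗ K` of a locally integrable function with a kernel. -/
noncomputable def mollify (K a : EuclideanSpace ℝ (Fin d) → ℝ) (x : EuclideanSpace ℝ (Fin d)) : ℝ :=
  ∫ y, a y * K (x - y)

theorem mollify_eq_convolution (K a : EuclideanSpace ℝ (Fin d) → ℝ) :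
    mollify K a = MeasureTheory.convolution a K (ContinuousLinearMap.mul ℝ ℝ) volume := by
  ext x
  simp [mollify, convolution_def]

theorem contDiff_mollify {K a : EuclideanSpace ℝ (Fin d) → ℝ} (hK : IsTestFunction K)
    (ha : LocallyIntegrable a) : ContDiff ℝ ((⊤ : ℕ∞) : WithTop ℕ∞) (mollify K a) := by
  rw [mollify_eq_convolution]
  exact hK.2.contDiff_convolution_right _ ha hK.1

theorem fderiv_mollify_apply {K a : EuclideanSpace ℝ (Fin d) → ℝ} (hK : IsTestFunction K)
    (ha : LocallyIntegrable a) (x e : EuclideanSpace ℝ (Fin d)) :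
    fderiv ℝ (mollify K a) x e = mollify (fun z => fderiv ℝ K z e) a x := by
  rw [mollify_eq_convolution, (hK.2.hasFDerivAt_convolution_right _ ha
    (hK.1.of_le (by simp)) x).fderiv, convolution_precompR_apply _ ha (hK.2.fderiv (𝕜 := ℝ))
    (hK.1.continuous_fderiv (by simp)), mollify_eq_convolution]

theorem integrable_mul_comp_sub {K a : EuclideanSpace ℝ (Fin d) → ℝ} (hK : IsTestFunction K)
    (ha : LocallyIntegrable a) (x : EuclideanSpace ℝ (Fin d)) :
    Integrable (fun y => a y * K (x - y)) := by
  have hc : HasCompactSupport (fun y => K (x - y)) :=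
    hK.2.comp_homeomorph (Homeomorph.subLeft x)
  exact ha.integrable_smul_right_of_hasCompactSupport
    (hK.continuous.comp (by fun_prop)) hc

theorem laplacian_mollify {K a : EuclideanSpace ℝ (Fin d) → ℝ} (hK : IsTestFunction K)
    (ha : LocallyIntegrable a) (x : EuclideanSpace ℝ (Fin d)) :
    (Δ (mollify K a)) x = mollify (Δ K) a x := by
  rw [(contDiff_mollify hK ha).laplacian_eq_sum_fderiv]
  have h1 (i : Fin d) : (fun y => fderiv ℝ (mollify K a) y (EuclideanSpace.single i 1)) =
      mollify (fun z => fderiv ℝ K z (EuclideanSpace.single i 1)) a :=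
    funext fun y => fderiv_mollify_apply hK ha y _
  simp only [h1, fderiv_mollify_apply (hK.fderiv_apply _) ha]
  simp only [mollify, hK.1.laplacian_eq_sum_fderiv, Finset.mul_sum]
  rw [integral_finsetSum]
  exact fun i _ => integrable_mul_comp_sub ((hK.fderiv_apply _).fderiv_apply _) ha x

/-- The right-hand side of the mollified equation `∂ₜ (a ∗ K) = -div(a v) ∗ K + ν Δ (a ∗ K)`,
written with all derivatives on the kernel. -/
noncomputable def mollifiedRHS (ν : ℝ) (K : EuclideanSpace ℝ (Fin d) → ℝ)
    (v : EuclideanSpace ℝ (Fin d) → EuclideanSpace ℝ (Fin d)) (a : EuclideanSpace ℝ (Fin d) → ℝ)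
    (x : EuclideanSpace ℝ (Fin d)) : ℝ :=
  ∫ y, a y * (-(fderiv ℝ K (x - y) (v y)) + ν * (Δ K) (x - y))

theorem integrable_mul_fderiv_comp_sub {K a : EuclideanSpace ℝ (Fin d) → ℝ}
    {v : EuclideanSpace ℝ (Fin d) → EuclideanSpace ℝ (Fin d)} (hK : IsTestFunction K)
    (hav : LocallyIntegrable (fun x => a x • v x)) (x : EuclideanSpace ℝ (Fin d)) :
    Integrable (fun y => a y * fderiv ℝ K (x - y) (v y)) := by
  have hc : HasCompactSupport (fun y => fderiv ℝ K (x - y)) :=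
    (hK.2.fderiv (𝕜 := ℝ)).comp_homeomorph (Homeomorph.subLeft x)
  have := hav.integrable_clm_apply (L := fun y => fderiv ℝ K (x - y))
    ((hK.1.continuous_fderiv (by simp)).comp (by fun_prop)) hc
  simpa using this

/-- The mollified equation is the transport-diffusion equation with the velocity evaluated at `x`,
up to the commutator. -/
theorem mollifiedRHS_eq {ν : ℝ} {K a : EuclideanSpace ℝ (Fin d) → ℝ}
    {v : EuclideanSpace ℝ (Fin d) → EuclideanSpace ℝ (Fin d)} (hK : IsTestFunction K)
    (ha : LocallyIntegrable a) (hav : LocallyIntegrable (fun x => a x • v x))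
    (x : EuclideanSpace ℝ (Fin d)) :
    mollifiedRHS ν K v a x = transportCommutator K v a x - fderiv ℝ (mollify K a) x (v x)
      + ν * (Δ (mollify K a)) x := by
  have i1 := integrable_mul_fderiv_comp_sub hK hav x
  have i2 := integrable_mul_comp_sub hK.laplacian ha x
  have i3 := integrable_mul_comp_sub (hK.fderiv_apply (v x)) ha x
  rw [laplacian_mollify hK ha, fderiv_mollify_apply hK ha, mollify, mollify, mollifiedRHS,
    transportCommutator]
  simp only [map_sub, mul_sub, mul_add, mul_neg]
  have i1' : Integrable (fun y => -(a y * fderiv ℝ K (x - y) (v y))) := i1.neg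
  rw [integral_sub i3 i1, integral_add i1' (by simpa [mul_left_comm] using i2.const_mul ν),
    integral_neg, ← integral_const_mul]
  simp only [mul_left_comm]
  ring

/-! ### A smooth regularisation of the absolute value -/

/-- The smooth convex function `√(1 + u²) - 1`, used as a regularisation of `|u|`. -/
noncomputable def smoothAbs (u : ℝ) : ℝ := √(1 + u ^ 2) - 1

/-- The derivative of `smoothAbs`. -/
noncomputable def smoothSign (u : ℝ) : ℝ := u / √(1 + u ^ 2)

theorem contDiff_smoothAbs {n : WithTop ℕ∞} : ContDiff ℝ n smoothAbs := by
  unfold smoothAbs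
  exact ((contDiff_const.add (contDiff_id.pow 2)).sqrt fun u => by positivity).sub contDiff_const

theorem contDiff_smoothSign {n : WithTop ℕ∞} : ContDiff ℝ n smoothSign := by
  unfold smoothSign
  exact contDiff_id.div ((contDiff_const.add (contDiff_id.pow 2)).sqrt fun u => by positivity)
    fun u => by positivity

theorem hasDerivAt_smoothAbs (u : ℝ) : HasDerivAt smoothAbs (smoothSign u) u := by
  unfold smoothAbs smoothSign
  have h : HasDerivAt (fun u : ℝ => 1 + u ^ 2) (2 * u) u := by
    simpa using (hasDerivAt_pow 2 u).const_add 1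
  have := (h.sqrt (by positivity)).sub_const 1
  exact this.congr_deriv (mul_div_mul_left _ _ two_ne_zero)

theorem deriv_smoothSign_nonneg (u : ℝ) : 0 ≤ deriv smoothSign u := by
  have hs : (0 : ℝ) < 1 + u ^ 2 := by positivity
  have h : HasDerivAt (fun u : ℝ => 1 + u ^ 2) (2 * u) u := by
    simpa using (hasDerivAt_pow 2 u).const_add 1
  have h2 := (hasDerivAt_id u).div (h.sqrt (by positivity)) (by positivity)
  have h3 : deriv smoothSign u = _ := h2.deriv
  rw [h3]
  refine div_nonneg ?_ (by positivity)
  have e : √(1 + u ^ 2) * √(1 + u ^ 2) = 1 + u ^ 2 := Real.mul_self_sqrt hs.le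
  have hpos : 0 < √(1 + u ^ 2) := by positivity
  have : 1 * √(1 + u ^ 2) - u * (2 * u / (2 * √(1 + u ^ 2))) = 1 / √(1 + u ^ 2) := by
    field_simp
    rw [pow_two, e]; ring
  simp only [id]
  rw [this]; positivity

theorem abs_smoothSign_le_one (u : ℝ) : |smoothSign u| ≤ 1 := by
  have hs : (0 : ℝ) < √(1 + u ^ 2) := by positivity
  rw [smoothSign, abs_div, abs_of_pos hs, div_le_one hs]
  exact Real.abs_le_sqrt (by linarith)

theorem smoothAbs_nonneg (u : ℝ) : 0 ≤ smoothAbs u := by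
  rw [smoothAbs, sub_nonneg, Real.one_le_sqrt]
  nlinarith [sq_nonneg u]

theorem smoothAbs_zero : smoothAbs 0 = 0 := by simp [smoothAbs]

theorem smoothAbs_eq_zero_iff {u : ℝ} : smoothAbs u = 0 ↔ u = 0 := by
  rw [smoothAbs, sub_eq_zero, Real.sqrt_eq_one]
  simp

theorem abs_smoothAbs_sub_le (u w : ℝ) : |smoothAbs u - smoothAbs w| ≤ |u - w| := by
  have := Convex.norm_image_sub_le_of_norm_hasDerivWithin_le (s := univ) (C := 1)
    (fun x _ => (hasDerivAt_smoothAbs x).hasDerivWithinAt)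
    (fun x _ => abs_smoothSign_le_one x) convex_univ (mem_univ w) (mem_univ u)
  simpa using this

theorem smoothAbs_le_abs (u : ℝ) : smoothAbs u ≤ |u| := by
  have := abs_smoothAbs_sub_le u 0
  rw [smoothAbs_zero, sub_zero, sub_zero] at this
  exact (le_abs_self _).trans this

theorem enorm_smoothAbs_le (u : ℝ) : ‖smoothAbs u‖ₑ ≤ ‖u‖ₑ := by
  rw [enorm_le_iff_norm_le, Real.norm_of_nonneg (smoothAbs_nonneg u)]
  exact smoothAbs_le_abs u

theorem IsTestFunction.continuous_mul {X : Type*} [NormedAddCommGroup X] [NormedSpace ℝ X]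
    [MeasurableSpace X] [OpensMeasurableSpace X] {μ : Measure X} [IsFiniteMeasureOnCompacts μ]
    {φ f : X → ℝ} (hφ : IsTestFunction φ) (hf : Continuous f) :
    Integrable (fun x => f x * φ x) μ :=
  (hf.mul hφ.continuous).integrable_of_hasCompactSupport hφ.2.mul_left

theorem fderiv_smoothAbs_comp {f : EuclideanSpace ℝ (Fin d) → ℝ}
    (hf : ContDiff ℝ ((⊤ : ℕ∞) : WithTop ℕ∞) f) (x : EuclideanSpace ℝ (Fin d)) :
    fderiv ℝ (fun x => smoothAbs (f x)) x = smoothSign (f x) • fderiv ℝ f x :=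
  ((hasDerivAt_smoothAbs (f x)).comp_hasFDerivAt x
    (hf.differentiable (by simp) x).hasFDerivAt).fderiv

/-- The diffusion term is dissipative for the convex function `smoothAbs`. -/
theorem integral_smoothSign_mul_laplacian_le {f χ : EuclideanSpace ℝ (Fin d) → ℝ}
    (hf : ContDiff ℝ ((⊤ : ℕ∞) : WithTop ℕ∞) f) (hχ : IsTestFunction χ) (hχ0 : ∀ x, 0 ≤ χ x) :
    ∫ x, smoothSign (f x) * (Δ f) x * χ x ≤ ∫ x, smoothAbs (f x) * (Δ χ) x := by
  simp only [hf.laplacian_eq_sum_fderiv, hχ.1.laplacian_eq_sum_fderiv, Finset.mul_sum,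
    Finset.sum_mul]
  have cS : Continuous (fun x => smoothSign (f x)) :=
    (contDiff_smoothSign (n := 0)).continuous.comp hf.continuous
  have cA : Continuous (fun x => smoothAbs (f x)) :=
    (contDiff_smoothAbs (n := 0)).continuous.comp hf.continuous
  rw [integral_finsetSum, integral_finsetSum]
  rotate_left
  · exact fun i _ => ((hχ.fderiv_apply _).fderiv_apply _).continuous_mul cA
  · exact fun i _ => hχ.continuous_mul
      (cS.mul ((hf.fderiv_apply_const _).fderiv_apply_const _).continuous)
  refine Finset.sum_le_sum fun i _ => ?_
  set e : EuclideanSpace ℝ (Fin d) := EuclideanSpace.single i 1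
  have hfe := hf.fderiv_apply_const e
  have hSf : ContDiff ℝ ((⊤ : ℕ∞) : WithTop ℕ∞) (fun x => smoothSign (f x)) :=
    contDiff_smoothSign.comp hf
  have hAf : ContDiff ℝ ((⊤ : ℕ∞) : WithTop ℕ∞) (fun x => smoothAbs (f x)) :=
    contDiff_smoothAbs.comp hf
  have hSχ : IsTestFunction (fun x => smoothSign (f x) * χ x) :=
    ⟨hSf.mul hχ.1, hχ.2.mul_left⟩
  have hD (x) : fderiv ℝ (fun x => smoothSign (f x) * χ x) x e =
      deriv smoothSign (f x) * fderiv ℝ f x e * χ x + smoothSign (f x) * fderiv ℝ χ x e := by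
    have h1 : HasFDerivAt (fun x => smoothSign (f x)) (deriv smoothSign (f x) • fderiv ℝ f x) x :=
      ((contDiff_smoothSign (n := 1)).differentiable (by simp) (f x)).hasDerivAt.comp_hasFDerivAt x
        (hf.differentiable (by simp) x).hasFDerivAt
    refine (congrArg (fun L => L e)
      (h1.mul (hχ.1.differentiable (by simp) x).hasFDerivAt).fderiv).trans ?_
    simp; ring
  have s1 : ∫ x, smoothSign (f x) * fderiv ℝ (fun y => fderiv ℝ f y e) x e * χ x
      = - ∫ x, fderiv ℝ (fun x => smoothSign (f x) * χ x) x e * fderiv ℝ f x e := by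
    rw [← integral_mul_fderiv_eq_neg_fderiv_mul_of_integrable]
    · congr 1 with x; ring
    · simpa only [mul_comm] using (hSχ.fderiv_apply e).continuous_mul hfe.continuous
    · simpa only [mul_comm] using hSχ.continuous_mul (hfe.fderiv_apply_const e).continuous
    · simpa only [mul_comm] using hSχ.continuous_mul hfe.continuous
    · exact fun x _ => hSχ.1.differentiable (by simp) x
    · exact fun x _ => hfe.differentiable (by simp) x
  have s2 : ∫ x, smoothAbs (f x) * fderiv ℝ (fun y => fderiv ℝ χ y e) x e
      = - ∫ x, fderiv ℝ (fun x => smoothAbs (f x)) x e * fderiv ℝ χ x e := by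
    rw [← integral_mul_fderiv_eq_neg_fderiv_mul_of_integrable]
    · exact (hχ.fderiv_apply e).continuous_mul (hAf.fderiv_apply_const e).continuous
    · exact ((hχ.fderiv_apply e).fderiv_apply e).continuous_mul hAf.continuous
    · exact (hχ.fderiv_apply e).continuous_mul hAf.continuous
    · exact fun x _ => hAf.differentiable (by simp) x
    · exact fun x _ => (hχ.fderiv_apply e).1.differentiable (by simp) x
  rw [s1, s2, neg_le_neg_iff]
  refine integral_mono ?_ ?_ fun x => ?_
  · exact (hχ.fderiv_apply e).continuous_mul (hAf.fderiv_apply_const e).continuous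
  · simpa only [mul_comm] using (hSχ.fderiv_apply e).continuous_mul hfe.continuous
  · simp only [hD, fderiv_smoothAbs_comp hf]
    have := mul_nonneg (mul_nonneg (deriv_smoothSign_nonneg (f x)) (sq_nonneg (fderiv ℝ f x e)))
      (hχ0 x)
    simp only [_root_.smul_apply, smul_eq_mul]
    nlinarith

/-- Transport by a divergence free field `v` conserves `smoothAbs f` up to the flux through the
cutoff `χ`: the weak divergence is tested with `smoothAbs f * χ`, and only `v ∈ L¹_loc` is used. -/
theorem integral_smoothSign_mul_transport {f χ : EuclideanSpace ℝ (Fin d) → ℝ}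
    (hf : ContDiff ℝ ((⊤ : ℕ∞) : WithTop ℕ∞) f) (hχ : IsTestFunction χ)
    {v : EuclideanSpace ℝ (Fin d) → EuclideanSpace ℝ (Fin d)} (hv : LocallyIntegrable v)
    (hdiv : ∀ ψ : EuclideanSpace ℝ (Fin d) → ℝ, IsTestFunction ψ →
      ∫ x, fderiv ℝ ψ x (v x) = 0) :
    Integrable (fun x => smoothSign (f x) * fderiv ℝ f x (v x) * χ x) ∧
    Integrable (fun x => smoothAbs (f x) * fderiv ℝ χ x (v x)) ∧
    ∫ x, smoothSign (f x) * fderiv ℝ f x (v x) * χ x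
      = - ∫ x, smoothAbs (f x) * fderiv ℝ χ x (v x) := by
  have hSf : Continuous (fun x => smoothSign (f x)) :=
    (contDiff_smoothSign (n := 0)).continuous.comp hf.continuous
  have hAf : ContDiff ℝ ((⊤ : ℕ∞) : WithTop ℕ∞) (fun x => smoothAbs (f x)) :=
    contDiff_smoothAbs.comp hf
  have hψ : IsTestFunction (fun x => smoothAbs (f x) * χ x) := ⟨hAf.mul hχ.1, hχ.2.mul_left⟩
  have i1 : Integrable (fun x => smoothSign (f x) * fderiv ℝ f x (v x) * χ x) := by
    have := hv.integrable_clm_apply (L := fun x => χ x • smoothSign (f x) • fderiv ℝ f x)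
      (hχ.continuous.smul (hSf.smul (hf.continuous_fderiv (by simp)))) hχ.2.smul_right
    refine this.congr (Eventually.of_forall fun x => ?_)
    simp; ring
  have i2 : Integrable (fun x => smoothAbs (f x) * fderiv ℝ χ x (v x)) := by
    have := hv.integrable_clm_apply (L := fun x => smoothAbs (f x) • fderiv ℝ χ x)
      (hAf.continuous.smul (hχ.1.continuous_fderiv (by simp)))
      ((hχ.2.fderiv (𝕜 := ℝ)).mono fun x hx h0 => hx (by simp [h0]))
    refine this.congr (Eventually.of_forall fun x => ?_)
    simp
  refine ⟨i1, i2, ?_⟩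
  have h := hdiv _ hψ
  have hD (x) : fderiv ℝ (fun x => smoothAbs (f x) * χ x) x (v x) =
      smoothSign (f x) * fderiv ℝ f x (v x) * χ x + smoothAbs (f x) * fderiv ℝ χ x (v x) := by
    refine (congrArg (fun L => L (v x)) ((hAf.differentiable (by simp) x).hasFDerivAt.mul
      (hχ.1.differentiable (by simp) x).hasFDerivAt).fderiv).trans ?_
    rw [fderiv_smoothAbs_comp hf]
    simp; ring
  simp only [hD] at h
  rw [integral_add i1 i2] at h
  linarith

/-! ### The localized balance at a fixed time -/

theorem stronglyMeasurable_transportCommutator {K a : EuclideanSpace ℝ (Fin d) → ℝ}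
    {v : EuclideanSpace ℝ (Fin d) → EuclideanSpace ℝ (Fin d)} (hK : IsTestFunction K)
    (ha : StronglyMeasurable a) (hv : StronglyMeasurable v) :
    StronglyMeasurable (transportCommutator K v a) := by
  have : StronglyMeasurable (fun p : EuclideanSpace ℝ (Fin d) × EuclideanSpace ℝ (Fin d) =>
      a p.2 * fderiv ℝ K (p.1 - p.2) (v p.1 - v p.2)) := by
    refine (ha.comp_measurable measurable_snd).mul (StronglyMeasurable.clm_apply_fun ?_ ?_)
    · exact ((hK.1.continuous_fderiv (by simp)).comp (by fun_prop)).stronglyMeasurable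
    · exact (hv.comp_measurable measurable_fst).sub (hv.comp_measurable measurable_snd)
  exact this.integral_prod_right'

/-- The localized balance of `smoothAbs` of the mollified solution, at a fixed time: the flux of
the transport field through the cutoff `χ`, corrected by the velocity `c` with which the cutoff
moves, and the diffusion through the cutoff control the growth, up to the commutator. -/
theorem ofReal_integral_smoothAbs_balance_le {ν : ℝ} (hν : 0 ≤ ν)
    {K a χ : EuclideanSpace ℝ (Fin d) → ℝ}
    {v : EuclideanSpace ℝ (Fin d) → EuclideanSpace ℝ (Fin d)}
    (hK : IsTestFunction K) (ha : LocallyIntegrable a) (ham : StronglyMeasurable a)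
    (hav : LocallyIntegrable (fun x => a x • v x)) (hv : LocallyIntegrable v)
    (hvm : StronglyMeasurable v)
    (hdiv : ∀ ψ : EuclideanSpace ℝ (Fin d) → ℝ, IsTestFunction ψ →
      ∫ x, fderiv ℝ ψ x (v x) = 0)
    (hχ : IsTestFunction χ) (hχ0 : ∀ x, 0 ≤ χ x) (hχ1 : ∀ x, χ x ≤ 1)
    (c : EuclideanSpace ℝ (Fin d)) :
    ENNReal.ofReal (∫ x, (smoothSign (mollify K a x) * mollifiedRHS ν K v a x * χ x
        - smoothAbs (mollify K a x) * fderiv ℝ χ x c))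
      ≤ (∫⁻ x, ‖transportCommutator K v a x‖ₑ)
        + (∫⁻ x, ‖mollify K a x‖ₑ * (‖fderiv ℝ χ x‖ₑ * ‖v x - c‖ₑ))
        + ENNReal.ofReal ν * ∫⁻ x, ‖smoothAbs (mollify K a x)‖ₑ * ‖(Δ χ) x‖ₑ := by
  set f := mollify K a
  set r := transportCommutator K v a
  -- otherwise the right side is infinite
  by_cases hr : ∫⁻ x, ‖r x‖ₑ = ∞
  · rw [hr]; simp
  have hf : ContDiff ℝ ((⊤ : ℕ∞) : WithTop ℕ∞) f := contDiff_mollify hK ha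
  have hSf : Continuous (fun x => smoothSign (f x)) :=
    (contDiff_smoothSign (n := 0)).continuous.comp hf.continuous
  have hAf : Continuous (fun x => smoothAbs (f x)) :=
    (contDiff_smoothAbs (n := 0)).continuous.comp hf.continuous
  have hri : Integrable r :=
    ⟨(stronglyMeasurable_transportCommutator hK ham hvm).aestronglyMeasurable,
      lt_top_iff_ne_top.2 hr⟩
  have i1 : Integrable (fun x => smoothSign (f x) * χ x * r x) := by
    refine hri.bdd_mul (c := 1) (hSf.mul hχ.continuous).aestronglyMeasurable
      (Eventually.of_forall fun x => ?_)
    rw [norm_mul, Real.norm_eq_abs, Real.norm_of_nonneg (hχ0 x)]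
    exact mul_le_one₀ (abs_smoothSign_le_one _) (hχ0 x) (hχ1 x)
  obtain ⟨i2, i3, e1⟩ := integral_smoothSign_mul_transport hf hχ hv hdiv
  have i4 : Integrable (fun x => smoothSign (f x) * (Δ f) x * χ x) := by
    have : Continuous (fun x => smoothSign (f x) * (Δ f) x) := by
      refine hSf.mul ?_
      have : (Δ f) = mollify (Δ K) a := funext fun x => laplacian_mollify hK ha x
      rw [this]
      exact (contDiff_mollify hK.laplacian ha).continuous
    exact hχ.continuous_mul this
  have i5 : Integrable (fun x => smoothAbs (f x) * fderiv ℝ χ x c) :=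
    (hχ.fderiv_apply c).continuous_mul hAf
  have i6 : Integrable (fun x => smoothAbs (f x) * (Δ χ) x) := hχ.laplacian.continuous_mul hAf
  have e2 : ∫ x, (smoothSign (f x) * mollifiedRHS ν K v a x * χ x
        - smoothAbs (f x) * fderiv ℝ χ x c) =
      (∫ x, smoothSign (f x) * χ x * r x) + (∫ x, smoothAbs (f x) * fderiv ℝ χ x (v x - c))
        + ν * ∫ x, smoothSign (f x) * (Δ f) x * χ x := by
    have e3 : ∀ x, smoothSign (f x) * mollifiedRHS ν K v a x * χ x
        - smoothAbs (f x) * fderiv ℝ χ x c = smoothSign (f x) * χ x * r x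
          - smoothSign (f x) * fderiv ℝ f x (v x) * χ x
          + ν * (smoothSign (f x) * (Δ f) x * χ x) - smoothAbs (f x) * fderiv ℝ χ x c := by
      intro x
      rw [mollifiedRHS_eq hK ha hav]; ring
    simp only [e3, map_sub, mul_sub]
    have j1 : Integrable (fun x => smoothSign (f x) * χ x * r x
        - smoothSign (f x) * fderiv ℝ f x (v x) * χ x) := i1.sub i2
    have j2 : Integrable (fun x => smoothSign (f x) * χ x * r x
        - smoothSign (f x) * fderiv ℝ f x (v x) * χ x
        + ν * (smoothSign (f x) * (Δ f) x * χ x)) := j1.add (i4.const_mul ν)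
    rw [integral_sub j2 i5, integral_add j1 (i4.const_mul ν), integral_sub i1 i2, e1,
        integral_sub i3 i5, integral_const_mul]
    ring
  rw [e2]
  have b1 : ENNReal.ofReal (∫ x, smoothSign (f x) * χ x * r x) ≤ ∫⁻ x, ‖r x‖ₑ := by
    refine (ENNReal.ofReal_le_ofReal (Real.le_norm_self _)).trans ?_
    rw [ofReal_norm]
    refine (enorm_integral_le_lintegral_enorm _).trans (lintegral_mono fun x => ?_)
    rw [← ofReal_norm, ← ofReal_norm]
    refine ENNReal.ofReal_le_ofReal ?_
    rw [norm_mul, norm_mul, Real.norm_eq_abs (smoothSign _), Real.norm_of_nonneg (hχ0 x)]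
    exact mul_le_of_le_one_left (norm_nonneg _)
      (mul_le_one₀ (abs_smoothSign_le_one _) (hχ0 x) (hχ1 x))
  have b2 : ENNReal.ofReal (∫ x, smoothAbs (f x) * fderiv ℝ χ x (v x - c))
      ≤ ∫⁻ x, ‖f x‖ₑ * (‖fderiv ℝ χ x‖ₑ * ‖v x - c‖ₑ) := by
    refine (ENNReal.ofReal_le_ofReal (Real.le_norm_self _)).trans ?_
    rw [ofReal_norm]
    refine (enorm_integral_le_lintegral_enorm _).trans (lintegral_mono fun x => ?_)
    rw [enorm_mul]
    refine mul_le_mul' ?_ (ContinuousLinearMap.le_opENorm _ _)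
    rw [← ofReal_norm, ← ofReal_norm]
    refine ENNReal.ofReal_le_ofReal ?_
    rw [Real.norm_of_nonneg (smoothAbs_nonneg _)]
    exact smoothAbs_le_abs _
  have b3 : ENNReal.ofReal (ν * ∫ x, smoothSign (f x) * (Δ f) x * χ x)
      ≤ ENNReal.ofReal ν * ∫⁻ x, ‖smoothAbs (f x)‖ₑ * ‖(Δ χ) x‖ₑ := by
    rw [ENNReal.ofReal_mul hν]
    refine mul_le_mul' le_rfl ?_
    refine (ENNReal.ofReal_le_ofReal ((integral_smoothSign_mul_laplacian_le hf hχ hχ0).trans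
      (Real.le_norm_self _))).trans ?_
    rw [ofReal_norm]
    refine (enorm_integral_le_lintegral_enorm _).trans (lintegral_mono fun x => ?_)
    rw [enorm_mul]
  exact (ENNReal.ofReal_add_le.trans (add_le_add ENNReal.ofReal_add_le le_rfl)).trans
    (add_le_add (add_le_add b1 b2) b3)

/-! ### The chain rule along absolutely continuous curves -/

/-- Absolute continuity passes to functions whose increments are controlled by those of an
absolutely continuous function, such as compositions with a Lipschitz function. -/
theorem AbsolutelyContinuousOnInterval.of_dist_le_mul {X Y : Type*} [PseudoMetricSpace X]
    [PseudoMetricSpace Y] {f : ℝ → X} {g : ℝ → Y} {a b C : ℝ}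
    (hf : AbsolutelyContinuousOnInterval f a b)
    (h : ∀ s ∈ uIcc a b, ∀ t ∈ uIcc a b, dist (g s) (g t) ≤ C * dist (f s) (f t)) :
    AbsolutelyContinuousOnInterval g a b := by
  unfold AbsolutelyContinuousOnInterval at hf ⊢
  have h2 := hf.const_mul C
  rw [mul_zero] at h2
  refine squeeze_zero' (Eventually.of_forall fun _ => Finset.sum_nonneg fun _ _ => dist_nonneg)
    ?_ h2
  filter_upwards [mem_inf_of_right (mem_principal_self _)] with E hE
  rw [Finset.mul_sum]
  refine Finset.sum_le_sum fun i hi => ?_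
  have := hE.1 i hi
  exact h _ this.1 _ this.2

theorem IntervalIntegrable.absolutelyContinuousOnInterval_integral {E : Type*}
    [NormedAddCommGroup E] [NormedSpace ℝ E] {f : ℝ → E} {a b : ℝ}
    (hf : IntervalIntegrable f volume a b) :
    AbsolutelyContinuousOnInterval (fun t => ∫ s in a..t, f s) a b := by
  refine (hf.norm.absolutelyContinuousOnInterval_intervalIntegral
    (left_mem_uIcc)).of_dist_le_mul (C := 1) fun s hs t ht => ?_
  have i1 : IntervalIntegrable f volume a s := hf.mono_set (uIcc_subset_uIcc_left hs)
  have i2 : IntervalIntegrable f volume a t := hf.mono_set (uIcc_subset_uIcc_left ht)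
  rw [dist_eq_norm, dist_eq_norm, one_mul, intervalIntegral.integral_interval_sub_left i1 i2,
    intervalIntegral.integral_interval_sub_left i1.norm i2.norm]
  exact intervalIntegral.norm_integral_le_abs_integral_norm

/-- The chain rule along a curve whose components are indefinite integrals. The weight `T - t`
makes the boundary terms vanish and turns the identity into one for the integral over time. -/
theorem integral_smoothAbs_mul_moving_cutoff {E : Type*} [NormedAddCommGroup E] [NormedSpace ℝ E]
    [CompleteSpace E] {T : ℝ} (hT : 0 ≤ T) {F : ℝ → ℝ} (hF : IntegrableOn F (Icc 0 T))
    {c : ℝ → E} (hc : IntegrableOn c (Icc 0 T)) {χ : E → ℝ} (hχ : IsTestFunction χ) (x : E) :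
    ∫ t in Icc 0 T, smoothAbs (∫ s in Icc 0 t, F s) * χ (x - ∫ s in Icc 0 t, c s) =
      ∫ t in Icc 0 T, (T - t) * (smoothSign (∫ s in Icc 0 t, F s) * F t *
          χ (x - ∫ s in Icc 0 t, c s)
        - smoothAbs (∫ s in Icc 0 t, F s) * fderiv ℝ χ (x - ∫ s in Icc 0 t, c s) (c t)) := by
  have hF' : IntervalIntegrable F volume 0 T :=
    (intervalIntegrable_iff_integrableOn_Icc_of_le hT).2 hF
  have hc' : IntervalIntegrable c volume 0 T :=
    (intervalIntegrable_iff_integrableOn_Icc_of_le hT).2 hc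
  have eF : ∀ t ∈ Icc 0 T, ∫ s in Icc 0 t, F s = ∫ s in (0 : ℝ)..t, F s := fun t ht => by
    rw [intervalIntegral.integral_of_le ht.1, integral_Icc_eq_integral_Ioc]
  have ec : ∀ t ∈ Icc 0 T, ∫ s in Icc 0 t, c s = ∫ s in (0 : ℝ)..t, c s := fun t ht => by
    rw [intervalIntegral.integral_of_le ht.1, integral_Icc_eq_integral_Ioc]
  set A : ℝ → ℝ := fun t => ∫ s in (0 : ℝ)..t, F s
  set X : ℝ → E := fun t => ∫ s in (0 : ℝ)..t, c s
  have hA : AbsolutelyContinuousOnInterval (fun t => smoothAbs (A t)) 0 T :=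
    hF'.absolutelyContinuousOnInterval_integral.of_dist_le_mul (C := 1) fun s _ t _ => by
      rw [one_mul, Real.dist_eq, Real.dist_eq]
      exact abs_smoothAbs_sub_le _ _
  obtain ⟨C, hC⟩ := hχ.1.lipschitzWith_of_hasCompactSupport hχ.2 (by simp)
  have hX : AbsolutelyContinuousOnInterval (fun t => χ (x - X t)) 0 T :=
    hc'.absolutelyContinuousOnInterval_integral.of_dist_le_mul (C := C) fun s _ t _ => by
      refine (hC.dist_le_mul _ _).trans ?_
      rw [dist_sub_left]
  have hL : AbsolutelyContinuousOnInterval (fun t : ℝ => T - t) 0 T := by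
    refine ContDiffOn.absolutelyContinuousOnInterval ?_
    exact (contDiff_const.sub contDiff_id).contDiffOn
  have hg := hL.fun_mul (hA.fun_mul hX)
  have h0 := hg.integral_deriv_eq_sub
  have hA0 : smoothAbs (A 0) = 0 := by
    simp only [A, intervalIntegral.integral_same, smoothAbs_zero]
  rw [hA0, sub_self, zero_mul, zero_mul, mul_zero, sub_zero] at h0
  have hae : ∀ᵐ t, t ∈ uIcc 0 T → deriv (fun t => (T - t) * (smoothAbs (A t) * χ (x - X t))) t =
      (T - t) * (smoothSign (A t) * F t * χ (x - X t)
        - smoothAbs (A t) * fderiv ℝ χ (x - X t) (c t)) - smoothAbs (A t) * χ (x - X t) := by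
    filter_upwards [hF'.ae_hasDerivAt_integral, hc'.ae_hasDerivAt_integral] with t h1 h2 ht
    have d1 : HasDerivAt A (F t) t := h1 ht 0 left_mem_uIcc
    have d2 : HasDerivAt X (c t) t := h2 ht 0 left_mem_uIcc
    have d3 : HasDerivAt (fun t => smoothAbs (A t)) (smoothSign (A t) * F t) t :=
      (hasDerivAt_smoothAbs (A t)).comp t d1
    have d4 : HasDerivAt (fun t => χ (x - X t)) (fderiv ℝ χ (x - X t) (-c t)) t :=
      (hχ.1.differentiable (by simp) (x - X t)).hasFDerivAt.comp_hasDerivAt t (d2.const_sub x)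
    have d5 : HasDerivAt (fun t : ℝ => T - t) (-1) t := (hasDerivAt_id t).const_sub T
    refine (d5.mul (d3.mul d4)).deriv.trans ?_
    simp only [map_neg]
    simp only [Pi.mul_apply]
    ring
  have hderiv := hg.intervalIntegrable_deriv
  have hgi : IntervalIntegrable (fun t => smoothAbs (A t) * χ (x - X t)) volume 0 T :=
    (hA.fun_mul hX).continuousOn.intervalIntegrable
  have hae' : ∀ᵐ t, t ∈ uIoc 0 T → deriv (fun t => (T - t) * (smoothAbs (A t) * χ (x - X t))) t +
      smoothAbs (A t) * χ (x - X t) =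
      (T - t) * (smoothSign (A t) * F t * χ (x - X t)
        - smoothAbs (A t) * fderiv ℝ χ (x - X t) (c t)) := by
    filter_upwards [hae] with t ht h
    rw [ht (uIoc_subset_uIcc h)]; ring
  have key := intervalIntegral.integral_congr_ae hae'
  rw [intervalIntegral.integral_add hderiv hgi, h0, zero_add,
    intervalIntegral.integral_of_le hT, intervalIntegral.integral_of_le hT,
    ← integral_Icc_eq_integral_Ioc, ← integral_Icc_eq_integral_Ioc] at key
  have l : ∀ t ∈ Icc 0 T, smoothAbs (∫ s in Icc 0 t, F s) * χ (x - ∫ s in Icc 0 t, c s) =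
      smoothAbs (A t) * χ (x - X t) := fun t ht => by rw [eF t ht, ec t ht]
  rw [setIntegral_congr_fun measurableSet_Icc l, key]
  refine setIntegral_congr_fun measurableSet_Icc fun t ht => ?_
  simp only [eF t ht, ec t ht, A, X]

/-! ### Weighted increments and local integrability -/

/-- Integrated form of the mean value formula, with a weight `w`. -/
theorem HasWeakGradient.lintegral_mul_translate_sub_le
    {u : EuclideanSpace ℝ (Fin d) → EuclideanSpace ℝ (Fin d)}
    {G : EuclideanSpace ℝ (Fin d) → EuclideanSpace ℝ (Fin d) →L[ℝ] EuclideanSpace ℝ (Fin d)}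
    (h : HasWeakGradient u G) (hum : StronglyMeasurable u) (hGm : StronglyMeasurable G)
    {w : EuclideanSpace ℝ (Fin d) → ℝ≥0∞} (hw : Measurable w) (z : EuclideanSpace ℝ (Fin d)) :
    ∫⁻ x, w x * ‖u (x + z) - u x‖ₑ
      ≤ ‖z‖ₑ * ∫⁻ s in Icc (0 : ℝ) 1, ∫⁻ x, w x * ‖G (x + s • z)‖ₑ := by
  have hm : Measurable (fun p : EuclideanSpace ℝ (Fin d) × ℝ => w p.1 * ‖G (p.1 + p.2 • z)‖ₑ) :=
    (hw.comp measurable_fst).mul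
      (hGm.comp_measurable (g := fun p : EuclideanSpace ℝ (Fin d) × ℝ => p.1 + p.2 • z)
        (by fun_prop)).enorm
  calc ∫⁻ x, w x * ‖u (x + z) - u x‖ₑ
      ≤ ∫⁻ x, ‖z‖ₑ * ∫⁻ s in Icc (0 : ℝ) 1, w x * ‖G (x + s • z)‖ₑ := by
        refine lintegral_mono_ae ?_
        filter_upwards [h.translate_sub_ae_eq hum hGm z] with x hx
        have hmx : Measurable (fun s : ℝ => ‖G (x + s • z)‖ₑ) :=
          (hGm.comp_measurable (g := fun s : ℝ => x + s • z) (by fun_prop)).enorm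
        rw [hx, lintegral_const_mul _ hmx, ← mul_assoc, mul_comm ‖z‖ₑ, mul_assoc]
        gcongr
        refine (enorm_integral_le_lintegral_enorm _).trans ?_
        rw [← lintegral_const_mul _ hmx]
        refine lintegral_mono fun s => ?_
        rw [mul_comm]
        exact ContinuousLinearMap.le_opENorm _ _
    _ = ‖z‖ₑ * ∫⁻ x, ∫⁻ s in Icc (0 : ℝ) 1, w x * ‖G (x + s • z)‖ₑ :=
        lintegral_const_mul' _ _ enorm_ne_top
    _ = _ := by rw [lintegral_lintegral_swap hm.aemeasurable]

theorem HasWeakGradient.lintegral_mul_translate_sub_le_of_le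
    {u : EuclideanSpace ℝ (Fin d) → EuclideanSpace ℝ (Fin d)}
    {G : EuclideanSpace ℝ (Fin d) → EuclideanSpace ℝ (Fin d) →L[ℝ] EuclideanSpace ℝ (Fin d)}
    (h : HasWeakGradient u G) (hum : StronglyMeasurable u) (hGm : StronglyMeasurable G)
    {w : EuclideanSpace ℝ (Fin d) → ℝ≥0∞} (hw : Measurable w) {z : EuclideanSpace ℝ (Fin d)}
    {B : ℝ≥0∞} (hB : ∀ s ∈ Icc (0 : ℝ) 1, ∫⁻ x, w x * ‖G (x + s • z)‖ₑ ≤ B) :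
    ∫⁻ x, w x * ‖u (x + z) - u x‖ₑ ≤ ‖z‖ₑ * B := by
  refine (h.lintegral_mul_translate_sub_le hum hGm hw z).trans ?_
  gcongr
  refine (setLIntegral_mono measurable_const hB).trans ?_
  simp

/-- The `L^{q'}` norm of the indicator function of a ball, the constant in the local embedding of
`L^q` in `L¹`. -/
noncomputable def ballConst (d : ℕ) (q' : ℝ≥0∞) (R : ℝ) : ℝ≥0∞ :=
  eLpNorm ((Metric.closedBall (0 : EuclideanSpace ℝ (Fin d)) R).indicator fun _ => (1 : ℝ)) q'
    volume

theorem ballConst_lt_top (d : ℕ) (q' : ℝ≥0∞) (R : ℝ) : ballConst d q' R < ∞ := by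
  refine (memLp_indicator_const q' Metric.isClosed_closedBall.measurableSet (1 : ℝ)
    (Or.inr ?_)).2
  exact (isCompact_closedBall 0 R).measure_lt_top.ne

/-- The local embedding of `L^q` in `L¹`. -/
theorem setLIntegral_closedBall_enorm_le {F : Type*} [NormedAddCommGroup F]
    {q q' : ℝ≥0∞} (hq : ENNReal.HolderConjugate q q')
    {f : EuclideanSpace ℝ (Fin d) → F} (hf : AEStronglyMeasurable f volume) (R : ℝ) :
    ∫⁻ x in Metric.closedBall 0 R, ‖f x‖ₑ ≤ eLpNorm f q volume * ballConst d q' R := by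
  have h := lintegral_translate_mul_le (μ := volume) hq hf (g := (Metric.closedBall
    (0 : EuclideanSpace ℝ (Fin d)) R).indicator fun _ => (1 : ℝ))
    (aestronglyMeasurable_const.indicator Metric.isClosed_closedBall.measurableSet) 0 0
  simp only [add_zero] at h
  refine le_trans (le_of_eq ?_) h
  rw [← lintegral_indicator Metric.isClosed_closedBall.measurableSet]
  refine lintegral_congr fun x => ?_
  by_cases hx : x ∈ Metric.closedBall (0 : EuclideanSpace ℝ (Fin d)) R
  · simp only [indicator_of_mem hx, enorm_one, mul_one]
  · simp only [indicator_of_notMem hx, enorm_zero, mul_zero]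

/-- The product `a v` is locally integrable: `v` differs from its averages over unit balls by a
field in `L^{q'}`, and these averages are locally bounded. -/
theorem HasWeakGradient.setLIntegral_mul_le
    {q q' : ℝ≥0∞} (hq : ENNReal.HolderConjugate q q')
    {u : EuclideanSpace ℝ (Fin d) → EuclideanSpace ℝ (Fin d)}
    {G : EuclideanSpace ℝ (Fin d) → EuclideanSpace ℝ (Fin d) →L[ℝ] EuclideanSpace ℝ (Fin d)}
    (h : HasWeakGradient u G) (hum : StronglyMeasurable u) (hGm : StronglyMeasurable G)
    {a : EuclideanSpace ℝ (Fin d) → ℝ} (ha : StronglyMeasurable a) (R : ℝ) :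
    volume (Metric.closedBall (0 : EuclideanSpace ℝ (Fin d)) 1) *
        ∫⁻ x in Metric.closedBall 0 R, ‖a x‖ₑ * ‖u x‖ₑ
      ≤ volume (Metric.closedBall (0 : EuclideanSpace ℝ (Fin d)) 1) *
          (eLpNorm a q volume * eLpNorm G q' volume)
        + eLpNorm a q volume * ballConst d q' R *
          ∫⁻ x in Metric.closedBall 0 (R + 1), ‖u x‖ₑ := by
  set B : ℝ → Set (EuclideanSpace ℝ (Fin d)) := fun R => Metric.closedBall 0 R
  have hB (R) : MeasurableSet (B R) := Metric.isClosed_closedBall.measurableSet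
  have hm : Measurable (fun p : EuclideanSpace ℝ (Fin d) × EuclideanSpace ℝ (Fin d) =>
      ‖a p.1‖ₑ * ‖u (p.1 + p.2)‖ₑ) :=
    (ha.comp_measurable measurable_fst).enorm.mul
      (hum.comp_measurable (measurable_fst.add measurable_snd)).enorm
  have hm2 : Measurable (fun p : EuclideanSpace ℝ (Fin d) × EuclideanSpace ℝ (Fin d) =>
      ‖a p.1‖ₑ * ‖u (p.1 + p.2) - u p.1‖ₑ) :=
    (ha.comp_measurable measurable_fst).enorm.mul
      ((hum.comp_measurable (measurable_fst.add measurable_snd)).sub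
        (hum.comp_measurable measurable_fst)).enorm
  -- `u x = u (x + h) - (u (x + h) - u x)`, averaged over `h` in the unit ball
  calc volume (B 1) * ∫⁻ x in B R, ‖a x‖ₑ * ‖u x‖ₑ
      = ∫⁻ h in B 1, ∫⁻ x in B R, ‖a x‖ₑ * ‖u x‖ₑ := by
        rw [setLIntegral_const, mul_comm]
    _ ≤ ∫⁻ h in B 1, ((∫⁻ x, ‖a x‖ₑ * ‖u (x + h) - u x‖ₑ)
          + ∫⁻ x in B R, ‖a x‖ₑ * ‖u (x + h)‖ₑ) := by
        refine lintegral_mono fun h => ?_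
        calc ∫⁻ x in B R, ‖a x‖ₑ * ‖u x‖ₑ
            ≤ ∫⁻ x in B R, (‖a x‖ₑ * ‖u (x + h) - u x‖ₑ + ‖a x‖ₑ * ‖u (x + h)‖ₑ) := by
              refine lintegral_mono fun x => ?_
              rw [← mul_add]
              gcongr
              have : u x = u (x + h) - (u (x + h) - u x) := by abel
              conv_lhs => rw [this]
              exact (enorm_sub_le).trans (add_comm _ _).le
          _ = (∫⁻ x in B R, ‖a x‖ₑ * ‖u (x + h) - u x‖ₑ)
                + ∫⁻ x in B R, ‖a x‖ₑ * ‖u (x + h)‖ₑ :=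
              lintegral_add_left (hm2.comp measurable_prodMk_right) _
          _ ≤ _ := by gcongr; exact Measure.restrict_le_self
    _ = (∫⁻ h in B 1, ∫⁻ x, ‖a x‖ₑ * ‖u (x + h) - u x‖ₑ)
          + ∫⁻ h in B 1, ∫⁻ x in B R, ‖a x‖ₑ * ‖u (x + h)‖ₑ :=
        lintegral_add_left (hm2.lintegral_prod_left') _
    _ ≤ (∫⁻ h in B 1, eLpNorm a q volume * eLpNorm G q' volume)
          + ∫⁻ x in B R, ‖a x‖ₑ * ∫⁻ y in B (R + 1), ‖u y‖ₑ := by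
        gcongr ?_ + ?_
        · refine setLIntegral_mono measurable_const fun z hz => ?_
          refine (h.lintegral_mul_translate_sub_le_of_le hum hGm ha.enorm
            (B := eLpNorm a q volume * eLpNorm G q' volume) fun s _ => ?_).trans ?_
          · simpa using lintegral_translate_mul_le (μ := volume) hq ha.aestronglyMeasurable
              hGm.aestronglyMeasurable 0 (s • z)
          · refine mul_le_of_le_one_left zero_le ?_
            rw [← ofReal_norm]
            exact ENNReal.ofReal_le_one.2 (by simpa [B] using hz)
        · have hsw : AEMeasurable (Function.uncurry fun h x => ‖a x‖ₑ * ‖u (x + h)‖ₑ)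
              ((volume.restrict (B 1)).prod (volume.restrict (B R))) :=
            (hm.comp measurable_swap).aemeasurable
          rw [lintegral_lintegral_swap hsw]
          refine setLIntegral_mono' (hB R) fun x hx => ?_
          rw [lintegral_const_mul' _ _ enorm_ne_top]
          refine mul_le_mul' le_rfl ?_
          have := lintegral_ball_translate_le u (R := 1) (show ‖x‖ ≤ R by simpa [B] using hx)
          simp only [add_comm _ x] at this
          rwa [add_comm 1 R] at this
    _ ≤ _ := by
        rw [setLIntegral_const, mul_comm (volume (B 1)), lintegral_mul_const _ ha.enorm]
        gcongr
        exact setLIntegral_closedBall_enorm_le hq ha.aestronglyMeasurable R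

/-! ### Normalized solutions -/

/-- A solution together with a gradient `G` of the velocity, normalized so that all the functions
are measurable and the assumptions hold at every time. The exponents `p` and `p'` do not appear:
of the integrability in time, only its consequences by the Hölder inequality are recorded. -/
structure IsNormalizedSolution (ν T : ℝ) (q q' : ℝ≥0∞)
    (v : ℝ → EuclideanSpace ℝ (Fin d) → EuclideanSpace ℝ (Fin d))
    (G : ℝ → EuclideanSpace ℝ (Fin d) → EuclideanSpace ℝ (Fin d) →L[ℝ] EuclideanSpace ℝ (Fin d))
    (a : ℝ → EuclideanSpace ℝ (Fin d) → ℝ) : Prop where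
  a_meas : StronglyMeasurable (Function.uncurry a)
  v_meas : StronglyMeasurable (Function.uncurry v)
  G_meas : StronglyMeasurable (Function.uncurry G)
  a_memLp : ∀ t, MemLp (a t) q volume
  G_memLp : ∀ t, MemLp (G t) q' volume
  weakGradient : ∀ t, HasWeakGradient (v t) (G t)
  divFree : ∀ t, ∀ ψ : EuclideanSpace ℝ (Fin d) → ℝ, IsTestFunction ψ →
    ∫ x, fderiv ℝ ψ x (v t x) = 0
  lintegral_a_mul_G : ∫⁻ t in Icc 0 T, eLpNorm (a t) q volume * eLpNorm (G t) q' volume < ∞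
  lintegral_a_mul_v : ∀ R : ℝ, ∫⁻ t in Icc 0 T, eLpNorm (a t) q volume *
    ∫⁻ x in Metric.closedBall 0 R, ‖v t x‖ₑ < ∞
  lintegral_a : ∫⁻ t in Icc 0 T, eLpNorm (a t) q volume < ∞
  lintegral_G : ∫⁻ t in Icc 0 T, eLpNorm (G t) q' volume < ∞
  lintegral_v : ∀ R : ℝ, ∫⁻ t in Icc 0 T, ∫⁻ x in Metric.closedBall 0 R, ‖v t x‖ₑ < ∞
  weakEquation : ∀ φ : ℝ × EuclideanSpace ℝ (Fin d) → ℝ, IsTestFunction φ →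
    ∀ᵐ s ∂(volume.restrict (Icc 0 T)),
      ∫ z in Icc 0 s ×ˢ (univ : Set (EuclideanSpace ℝ (Fin d))),
          a z.1 z.2 *
            (deriv (fun t => φ (t, z.2)) z.1
              + fderiv ℝ (fun x => φ (z.1, x)) z.2 (v z.1 z.2)
              + ν * (Δ (fun x => φ (z.1, x))) z.2)
        = ∫ x, a s x * φ (s, x)

namespace IsNormalizedSolution

variable {ν T : ℝ} {q q' : ℝ≥0∞}
  {v : ℝ → EuclideanSpace ℝ (Fin d) → EuclideanSpace ℝ (Fin d)}
  {G : ℝ → EuclideanSpace ℝ (Fin d) → EuclideanSpace ℝ (Fin d) →L[ℝ] EuclideanSpace ℝ (Fin d)}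
  {a : ℝ → EuclideanSpace ℝ (Fin d) → ℝ}

theorem a_meas_slice (h : IsNormalizedSolution ν T q q' v G a) (t : ℝ) :
    StronglyMeasurable (a t) := h.a_meas.comp_measurable measurable_prodMk_left

theorem v_meas_slice (h : IsNormalizedSolution ν T q q' v G a) (t : ℝ) :
    StronglyMeasurable (v t) := h.v_meas.comp_measurable measurable_prodMk_left

theorem G_meas_slice (h : IsNormalizedSolution ν T q q' v G a) (t : ℝ) :
    StronglyMeasurable (G t) := h.G_meas.comp_measurable measurable_prodMk_left

theorem a_locInt (h : IsNormalizedSolution ν T q q' v G a)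
    (hq : ENNReal.HolderConjugate q q') (t : ℝ) : LocallyIntegrable (a t) :=
  (h.a_memLp t).locallyIntegrable hq.one_le

theorem v_locInt (h : IsNormalizedSolution ν T q q' v G a) (t : ℝ) : LocallyIntegrable (v t) :=
  (h.weakGradient t).1

theorem setLIntegral_a_mul_v_lt_top (h : IsNormalizedSolution ν T q q' v G a)
    (hq : ENNReal.HolderConjugate q q') (t R : ℝ) :
    ∫⁻ x in Metric.closedBall 0 R, ‖a t x‖ₑ * ‖v t x‖ₑ < ∞ := by
  have hle := (h.weakGradient t).setLIntegral_mul_le hq (h.v_meas_slice t) (h.G_meas_slice t)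
    (h.a_meas_slice t) R
  have hB : volume (Metric.closedBall (0 : EuclideanSpace ℝ (Fin d)) 1) < ∞ :=
    (isCompact_closedBall 0 1).measure_lt_top
  have hB0 : volume (Metric.closedBall (0 : EuclideanSpace ℝ (Fin d)) 1) ≠ 0 :=
    (Metric.measure_closedBall_pos volume 0 one_pos).ne'
  have hfin := hle.trans_lt (ENNReal.add_lt_top.2
    ⟨ENNReal.mul_lt_top hB (ENNReal.mul_lt_top (h.a_memLp t).2 (h.G_memLp t).2),
      ENNReal.mul_lt_top (ENNReal.mul_lt_top (h.a_memLp t).2 (ballConst_lt_top d q' R))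
        ((h.v_locInt t).lintegral_closedBall_lt_top _)⟩)
  by_contra hc
  rw [not_lt, top_le_iff] at hc
  rw [hc, ENNReal.mul_top hB0] at hfin
  exact lt_irrefl _ hfin

theorem av_locInt (h : IsNormalizedSolution ν T q q' v G a)
    (hq : ENNReal.HolderConjugate q q') (t : ℝ) :
    LocallyIntegrable (fun x => a t x • v t x) := by
  rw [locallyIntegrable_iff]
  intro k hk
  obtain ⟨R, hR⟩ := hk.isBounded.subset_closedBall 0
  refine IntegrableOn.mono_set (t := Metric.closedBall 0 R) ⟨?_, ?_⟩ hR
  · exact ((h.a_meas_slice t).smul (h.v_meas_slice t)).aestronglyMeasurable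
  · have := h.setLIntegral_a_mul_v_lt_top hq t R
    simpa only [HasFiniteIntegral, enorm_smul] using this

theorem lintegral_setLIntegral_a_mul_v_lt_top (h : IsNormalizedSolution ν T q q' v G a)
    (hq : ENNReal.HolderConjugate q q') (R : ℝ) :
    ∫⁻ t in Icc 0 T, ∫⁻ x in Metric.closedBall 0 R, ‖a t x‖ₑ * ‖v t x‖ₑ < ∞ := by
  have hB : volume (Metric.closedBall (0 : EuclideanSpace ℝ (Fin d)) 1) < ∞ :=
    (isCompact_closedBall 0 1).measure_lt_top
  have hB0 : volume (Metric.closedBall (0 : EuclideanSpace ℝ (Fin d)) 1) ≠ 0 :=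
    (Metric.measure_closedBall_pos volume 0 one_pos).ne'
  have hle := lintegral_mono (μ := volume.restrict (Icc 0 T)) fun t =>
    (h.weakGradient t).setLIntegral_mul_le hq (h.v_meas_slice t)
    (h.G_meas_slice t) (h.a_meas_slice t) R
  have hm1 : Measurable (fun t => eLpNorm (a t) q volume * eLpNorm (G t) q' volume) :=
    (measurable_eLpNorm_slice h.a_meas q).mul (measurable_eLpNorm_slice h.G_meas q')
  rw [lintegral_const_mul' _ _ hB.ne, lintegral_add_left (hm1.const_mul _),
    lintegral_const_mul' _ _ hB.ne] at hle
  have hfin := hle.trans_lt (ENNReal.add_lt_top.2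
    ⟨ENNReal.mul_lt_top hB h.lintegral_a_mul_G, by
      have : ∀ t, eLpNorm (a t) q volume * ballConst d q' R *
          (∫⁻ x in Metric.closedBall 0 (R + 1), ‖v t x‖ₑ) = ballConst d q' R *
          (eLpNorm (a t) q volume * ∫⁻ x in Metric.closedBall 0 (R + 1), ‖v t x‖ₑ) := by
        intro t; ring
      simp only [this]
      rw [lintegral_const_mul' _ _ (ballConst_lt_top d q' R).ne]
      exact ENNReal.mul_lt_top (ballConst_lt_top d q' R) (h.lintegral_a_mul_v _)⟩)
  by_contra hc
  rw [not_lt, top_le_iff] at hc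
  rw [hc, ENNReal.mul_top hB0] at hfin
  exact lt_irrefl _ hfin

theorem lintegral_setLIntegral_a_lt_top (h : IsNormalizedSolution ν T q q' v G a)
    (hq : ENNReal.HolderConjugate q q') (R : ℝ) :
    ∫⁻ t in Icc 0 T, ∫⁻ x in Metric.closedBall 0 R, ‖a t x‖ₑ < ∞ := by
  refine (lintegral_mono fun t => setLIntegral_closedBall_enorm_le hq
    (h.a_meas_slice t).aestronglyMeasurable R).trans_lt ?_
  rw [lintegral_mul_const' _ _ (ballConst_lt_top d q' R).ne]
  exact ENNReal.mul_lt_top h.lintegral_a (ballConst_lt_top d q' R)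

end IsNormalizedSolution

/-! ### The mollified equation -/

theorem HasCompactSupport.exists_enorm_le_indicator {F : Type*} [NormedAddCommGroup F]
    {f : EuclideanSpace ℝ (Fin d) → F} (hf : HasCompactSupport f) (hc : Continuous f) :
    ∃ C : ℝ≥0∞, C ≠ ∞ ∧ ∃ M : ℝ, ∀ z, ‖f z‖ₑ ≤ (Metric.closedBall 0 M).indicator (fun _ => C) z :=
        by
  obtain ⟨C, hC⟩ := hf.exists_bound_of_continuous hc
  obtain ⟨M, -, hM⟩ := hf.exists_forall_norm_le
  refine ⟨ENNReal.ofReal C, ENNReal.ofReal_ne_top, M, fun z => ?_⟩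
  by_cases hz : f z = 0
  · simp [hz]
  · rw [indicator_of_mem (by simpa using hM z hz), ← ofReal_norm]
    exact ENNReal.ofReal_le_ofReal (hC z)

theorem indicator_closedBall_mono (C : ℝ≥0∞) {M N : ℝ} (h : M ≤ N)
    (z : EuclideanSpace ℝ (Fin d)) :
    (Metric.closedBall 0 M).indicator (fun _ => C) z
      ≤ (Metric.closedBall 0 N).indicator (fun _ => C) z :=
  indicator_le_indicator_of_subset (Metric.closedBall_subset_closedBall h)
    (fun _ => zero_le) z

theorem indicator_closedBall_sub_le (C : ℝ≥0∞) {M R : ℝ} {x y : EuclideanSpace ℝ (Fin d)}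
    (hx : ‖x‖ ≤ R) :
    (Metric.closedBall 0 M).indicator (fun _ => C) (x - y)
      ≤ (Metric.closedBall 0 (R + M)).indicator (fun _ => C) y := by
  by_cases h : x - y ∈ Metric.closedBall (0 : EuclideanSpace ℝ (Fin d)) M
  · rw [indicator_of_mem h, indicator_of_mem]
    rw [mem_closedBall_zero_iff] at h ⊢
    calc ‖y‖ = ‖x - (x - y)‖ := by rw [sub_sub_cancel]
      _ ≤ ‖x‖ + ‖x - y‖ := norm_sub_le _ _
      _ ≤ _ := by linarith
  · rw [indicator_of_notMem h]; exact zero_le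

/-- Uniform bounds for the kernels occurring in the mollified equation. -/
theorem IsTestFunction.exists_kernel_bound {K : EuclideanSpace ℝ (Fin d) → ℝ}
    (hK : IsTestFunction K) (ν : ℝ) :
    ∃ C : ℝ≥0∞, C ≠ ∞ ∧ ∃ M : ℝ, ∀ x y w : EuclideanSpace ℝ (Fin d), ∀ R : ℝ, ‖x‖ ≤ R →
      ‖K (x - y)‖ₑ ≤ (Metric.closedBall 0 (R + M)).indicator (fun _ => C) y ∧
      ‖-(fderiv ℝ K (x - y) w) + ν * (Δ K) (x - y)‖ₑ
        ≤ (Metric.closedBall 0 (R + M)).indicator (fun _ => C) y * (‖w‖ₑ + 1) := by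
  obtain ⟨C1, hC1, M1, h1⟩ := hK.2.exists_enorm_le_indicator hK.continuous
  obtain ⟨C2, hC2, M2, h2⟩ := (hK.2.fderiv (𝕜 := ℝ)).exists_enorm_le_indicator
    (hK.1.continuous_fderiv (by simp))
  obtain ⟨C3, hC3, M3, h3⟩ := hK.laplacian.2.exists_enorm_le_indicator hK.laplacian.continuous
  set C := C1 + C2 + ‖ν‖ₑ * C3
  set M := max M1 (max M2 M3)
  refine ⟨C, by simp [C, hC1, hC2, ENNReal.mul_ne_top, hC3], M, fun x y w R hx => ?_⟩
  have hle (D : ℝ≥0∞) (N : ℝ) (hD : D ≤ C) (hN : N ≤ M) :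
      (Metric.closedBall 0 N).indicator (fun _ => D) (x - y)
        ≤ (Metric.closedBall 0 (R + M)).indicator (fun _ => C) y :=
    ((indicator_closedBall_mono D hN _).trans (indicator_le_indicator hD)).trans
      (indicator_closedBall_sub_le C hx)
  constructor
  · exact (h1 _).trans (hle _ _ ((le_self_add).trans (le_self_add)) (le_max_left _ _))
  · refine (enorm_add_le _ _).trans ?_
    rw [mul_add, mul_one, enorm_neg, enorm_mul]
    refine add_le_add ((ContinuousLinearMap.le_opENorm _ _).trans (mul_le_mul' ((h2 _).trans
      (hle _ _ (le_add_self.trans le_self_add)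
        ((le_max_left _ _).trans (le_max_right _ _)))) le_rfl)) ?_
    refine (mul_le_mul' le_rfl (h3 _)).trans ?_
    have e : ‖ν‖ₑ * (Metric.closedBall 0 M3).indicator (fun _ => C3) (x - y)
        = (Metric.closedBall 0 M3).indicator (fun _ => ‖ν‖ₑ * C3) (x - y) := by
      by_cases hz : x - y ∈ Metric.closedBall (0 : EuclideanSpace ℝ (Fin d)) M3
      · simp only [indicator_of_mem hz]
      · simp only [indicator_of_notMem hz, mul_zero]
    rw [e]
    exact hle _ _ le_add_self ((le_max_right _ _).trans (le_max_right _ _))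

theorem fderiv_comp_const_sub' {K : EuclideanSpace ℝ (Fin d) → ℝ}
    (hK : ContDiff ℝ ((⊤ : ℕ∞) : WithTop ℕ∞) K) (x y w : EuclideanSpace ℝ (Fin d)) :
    fderiv ℝ (fun y => K (x - y)) y w = -(fderiv ℝ K (x - y) w) := by
  have h1 : HasFDerivAt (fun y : EuclideanSpace ℝ (Fin d) => x - y)
      (-ContinuousLinearMap.id ℝ _) y := (hasFDerivAt_id y).const_sub x
  have h2 : HasFDerivAt (fun y => K (x - y)) _ y :=
    (hK.differentiable (by simp) (x - y)).hasFDerivAt.comp y h1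
  rw [h2.fderiv]
  simp

theorem laplacian_comp_const_sub {K : EuclideanSpace ℝ (Fin d) → ℝ}
    (hK : ContDiff ℝ ((⊤ : ℕ∞) : WithTop ℕ∞) K) (x y : EuclideanSpace ℝ (Fin d)) :
    (Δ (fun y => K (x - y))) y = (Δ K) (x - y) := by
  have hc : ContDiff ℝ ((⊤ : ℕ∞) : WithTop ℕ∞) (fun y => K (x - y)) :=
    hK.comp (contDiff_const.sub contDiff_id)
  rw [hc.laplacian_eq_sum_fderiv, hK.laplacian_eq_sum_fderiv]
  refine Finset.sum_congr rfl fun i _ => ?_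
  simp only [fderiv_comp_const_sub' hK]
  rw [fderiv_fun_neg]
  rw [_root_.neg_apply, fderiv_comp_const_sub' (hK.fderiv_apply_const _), neg_neg]

theorem laplacian_comp_sub_const {K : EuclideanSpace ℝ (Fin d) → ℝ}
    (hK : ContDiff ℝ ((⊤ : ℕ∞) : WithTop ℕ∞) K) (x y : EuclideanSpace ℝ (Fin d)) :
    (Δ (fun y => K (y - x))) y = (Δ K) (y - x) := by
  have hc : ContDiff ℝ ((⊤ : ℕ∞) : WithTop ℕ∞) (fun y => K (y - x)) :=
    hK.comp (contDiff_id.sub contDiff_const)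
  rw [hc.laplacian_eq_sum_fderiv, hK.laplacian_eq_sum_fderiv]
  have e (f : EuclideanSpace ℝ (Fin d) → ℝ) (y) :
      fderiv ℝ (fun y => f (y - x)) y = fderiv ℝ f (y - x) := fderiv_comp_sub _
  refine Finset.sum_congr rfl fun i _ => ?_
  simp only [e]
  rw [e (fun z => fderiv ℝ K z (EuclideanSpace.single i 1))]

theorem enorm_mollify_le {K a : EuclideanSpace ℝ (Fin d) → ℝ} {C : ℝ≥0∞} {N : ℝ}
    {x : EuclideanSpace ℝ (Fin d)}
    (h : ∀ y, ‖K (x - y)‖ₑ ≤ (Metric.closedBall 0 N).indicator (fun _ => C) y) (hC : C ≠ ∞) :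
    ‖mollify K a x‖ₑ ≤ C * ∫⁻ y in Metric.closedBall 0 N, ‖a y‖ₑ := by
  refine (enorm_integral_le_lintegral_enorm _).trans ?_
  rw [← lintegral_const_mul' _ _ hC, ← lintegral_indicator Metric.isClosed_closedBall.measurableSet]
  refine lintegral_mono fun y => ?_
  rw [enorm_mul, mul_comm]
  refine (mul_le_mul' (h y) le_rfl).trans (le_of_eq ?_)
  by_cases hy : y ∈ Metric.closedBall (0 : EuclideanSpace ℝ (Fin d)) N <;> simp [hy]

theorem enorm_mollifiedRHS_le {ν : ℝ} {K a : EuclideanSpace ℝ (Fin d) → ℝ} {C : ℝ≥0∞} {N : ℝ}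
    {v : EuclideanSpace ℝ (Fin d) → EuclideanSpace ℝ (Fin d)}
    {x : EuclideanSpace ℝ (Fin d)}
    (h : ∀ y w, ‖-(fderiv ℝ K (x - y) w) + ν * (Δ K) (x - y)‖ₑ
      ≤ (Metric.closedBall 0 N).indicator (fun _ => C) y * (‖w‖ₑ + 1)) (hC : C ≠ ∞) :
    ‖mollifiedRHS ν K v a x‖ₑ
      ≤ C * ∫⁻ y in Metric.closedBall 0 N, (‖a y‖ₑ * ‖v y‖ₑ + ‖a y‖ₑ) := by
  refine (enorm_integral_le_lintegral_enorm _).trans ?_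
  rw [← lintegral_const_mul' _ _ hC, ← lintegral_indicator Metric.isClosed_closedBall.measurableSet]
  refine lintegral_mono fun y => ?_
  rw [enorm_mul, mul_comm]
  refine (mul_le_mul' (h y (v y)) le_rfl).trans (le_of_eq ?_)
  by_cases hy : y ∈ Metric.closedBall (0 : EuclideanSpace ℝ (Fin d)) N
  · simp only [hy, indicator_of_mem]; ring
  · simp [hy]

namespace IsNormalizedSolution

variable {ν T : ℝ} {q q' : ℝ≥0∞}
  {v : ℝ → EuclideanSpace ℝ (Fin d) → EuclideanSpace ℝ (Fin d)}
  {G : ℝ → EuclideanSpace ℝ (Fin d) → EuclideanSpace ℝ (Fin d) →L[ℝ] EuclideanSpace ℝ (Fin d)}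
  {a : ℝ → EuclideanSpace ℝ (Fin d) → ℝ}

theorem measurable_setLIntegral_a (h : IsNormalizedSolution ν T q q' v G a) (N : ℝ) :
    Measurable (fun t => ∫⁻ y in Metric.closedBall 0 N, ‖a t y‖ₑ) :=
  h.a_meas.enorm.lintegral_prod_right'

theorem lintegral_setLIntegral_add_lt_top (h : IsNormalizedSolution ν T q q' v G a)
    (hq : ENNReal.HolderConjugate q q') (N : ℝ) :
    ∫⁻ t in Icc 0 T, ∫⁻ y in Metric.closedBall 0 N, (‖a t y‖ₑ * ‖v t y‖ₑ + ‖a t y‖ₑ) < ∞ := by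
  have e (t : ℝ) : ∫⁻ y in Metric.closedBall 0 N, (‖a t y‖ₑ * ‖v t y‖ₑ + ‖a t y‖ₑ)
      = (∫⁻ y in Metric.closedBall 0 N, ‖a t y‖ₑ * ‖v t y‖ₑ)
        + ∫⁻ y in Metric.closedBall 0 N, ‖a t y‖ₑ :=
    lintegral_add_right _ (h.a_meas_slice t).enorm
  simp only [e]
  rw [lintegral_add_right _ (h.measurable_setLIntegral_a N)]
  exact ENNReal.add_lt_top.2 ⟨h.lintegral_setLIntegral_a_mul_v_lt_top hq N,
    h.lintegral_setLIntegral_a_lt_top hq N⟩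

theorem stronglyMeasurable_mollify (h : IsNormalizedSolution ν T q q' v G a)
    {K : EuclideanSpace ℝ (Fin d) → ℝ} (hK : IsTestFunction K) :
    StronglyMeasurable (fun p : ℝ × EuclideanSpace ℝ (Fin d) => mollify K (a p.1) p.2) := by
  have : StronglyMeasurable (fun p : (ℝ × EuclideanSpace ℝ (Fin d)) × EuclideanSpace ℝ (Fin d) =>
      a p.1.1 p.2 * K (p.1.2 - p.2)) := by
    refine StronglyMeasurable.mul ?_ ?_
    · exact h.a_meas.comp_measurable ((measurable_fst.comp measurable_fst).prodMk measurable_snd)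
    · exact (hK.continuous.comp (by fun_prop)).stronglyMeasurable
  exact this.integral_prod_right'

theorem stronglyMeasurable_mollifiedRHS_integrand (h : IsNormalizedSolution ν T q q' v G a)
    {K : EuclideanSpace ℝ (Fin d) → ℝ} (hK : IsTestFunction K) :
    StronglyMeasurable (fun p : (ℝ × EuclideanSpace ℝ (Fin d)) × EuclideanSpace ℝ (Fin d) =>
      a p.1.1 p.2 * (-(fderiv ℝ K (p.1.2 - p.2) (v p.1.1 p.2)) + ν * (Δ K) (p.1.2 - p.2))) := by
  have hm : Measurable (fun p : (ℝ × EuclideanSpace ℝ (Fin d)) × EuclideanSpace ℝ (Fin d) =>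
      (p.1.1, p.2)) := (measurable_fst.comp measurable_fst).prodMk measurable_snd
  refine (h.a_meas.comp_measurable hm).mul (StronglyMeasurable.add ?_ ?_)
  · refine (StronglyMeasurable.clm_apply_fun ?_ (h.v_meas.comp_measurable hm)).neg
    exact ((hK.1.continuous_fderiv (by simp)).comp (by fun_prop)).stronglyMeasurable
  · exact ((hK.laplacian.continuous.comp
      (continuous_snd.comp continuous_fst |>.sub continuous_snd)).const_mul ν).stronglyMeasurable

theorem stronglyMeasurable_mollifiedRHS (h : IsNormalizedSolution ν T q q' v G a)
    {K : EuclideanSpace ℝ (Fin d) → ℝ} (hK : IsTestFunction K) :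
    StronglyMeasurable
      (fun p : ℝ × EuclideanSpace ℝ (Fin d) => mollifiedRHS ν K (v p.1) (a p.1) p.2) :=
  (h.stronglyMeasurable_mollifiedRHS_integrand hK).integral_prod_right'

theorem integrable_mollifiedRHS_integrand (h : IsNormalizedSolution ν T q q' v G a)
    (hq : ENNReal.HolderConjugate q q') {K : EuclideanSpace ℝ (Fin d) → ℝ}
    (hK : IsTestFunction K) (x : EuclideanSpace ℝ (Fin d)) :
    Integrable (fun p : ℝ × EuclideanSpace ℝ (Fin d) =>
      a p.1 p.2 * (-(fderiv ℝ K (x - p.2) (v p.1 p.2)) + ν * (Δ K) (x - p.2)))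
      ((volume.restrict (Icc 0 T)).prod volume) := by
  obtain ⟨C, hC, M, hb⟩ := hK.exists_kernel_bound ν
  have hm : StronglyMeasurable (fun p : ℝ × EuclideanSpace ℝ (Fin d) =>
      a p.1 p.2 * (-(fderiv ℝ K (x - p.2) (v p.1 p.2)) + ν * (Δ K) (x - p.2))) :=
    (h.stronglyMeasurable_mollifiedRHS_integrand (ν := ν) hK).comp_measurable
      (g := fun p : ℝ × EuclideanSpace ℝ (Fin d) => ((p.1, x), p.2)) (by fun_prop)
  refine ⟨hm.aestronglyMeasurable, ?_⟩
  rw [HasFiniteIntegral, lintegral_prod _ hm.enorm.aemeasurable]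
  refine lt_of_le_of_lt (lintegral_mono (g := fun t =>
    C * ∫⁻ y in Metric.closedBall 0 (‖x‖ + M), (‖a t y‖ₑ * ‖v t y‖ₑ + ‖a t y‖ₑ)) fun t => ?_) ?_
  · dsimp only
    rw [← lintegral_const_mul' _ _ hC,
      ← lintegral_indicator Metric.isClosed_closedBall.measurableSet]
    refine lintegral_mono fun y => ?_
    rw [enorm_mul, mul_comm]
    refine (mul_le_mul' (hb x y (v t y) ‖x‖ le_rfl).2 le_rfl).trans (le_of_eq ?_)
    by_cases hy : y ∈ Metric.closedBall (0 : EuclideanSpace ℝ (Fin d)) (‖x‖ + M)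
    · simp only [hy, indicator_of_mem]; ring
    · simp [hy]
  · rw [lintegral_const_mul' _ _ hC]
    exact ENNReal.mul_lt_top hC.lt_top (h.lintegral_setLIntegral_add_lt_top hq (‖x‖ + M))

/-- The mollified solution is, for every `x` and almost every time, the time integral of the
right-hand side of the mollified equation. -/
theorem mollified_equation (h : IsNormalizedSolution ν T q q' v G a)
    (hq : ENNReal.HolderConjugate q q') (hT : 0 < T) {K : EuclideanSpace ℝ (Fin d) → ℝ}
    (hK : IsTestFunction K) (x : EuclideanSpace ℝ (Fin d)) :
    ∀ᵐ t ∂(volume.restrict (Icc 0 T)),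
      ∫ s in Icc 0 t, mollifiedRHS ν K (v s) (a s) x = mollify K (a t) x := by
  -- a smooth function of time which equals `1` in a neighbourhood of `[0, T]`
  let η : ContDiffBump (T / 2) := ⟨T, T + 1, hT, by linarith⟩
  have hη1 : ∀ t ∈ Icc 0 T, η =ᶠ[𝓝 t] fun _ => 1 := fun t ht => by
    refine η.eventuallyEq_one_of_mem_ball ?_
    rw [Metric.mem_ball, Real.dist_eq, abs_lt]
    change -T < _ ∧ _ < T
    constructor <;> linarith [ht.1, ht.2]
  have hφ : IsTestFunction (fun p : ℝ × EuclideanSpace ℝ (Fin d) => η p.1 * K (x - p.2)) := by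
    refine ⟨(η.contDiff.comp contDiff_fst).mul (hK.1.comp (contDiff_const.sub contDiff_snd)), ?_⟩
    have hc : HasCompactSupport (fun y => K (x - y)) := hK.2.comp_homeomorph (Homeomorph.subLeft x)
    refine HasCompactSupport.intro (η.hasCompactSupport.isCompact.prod hc.isCompact) ?_
    rintro ⟨t, y⟩ hty
    simp only [mem_prod, not_and_or] at hty
    rcases hty with h1 | h1
    · simp [image_eq_zero_of_notMem_tsupport h1]
    · have : K (x - y) = 0 := image_eq_zero_of_notMem_tsupport (f := fun y => K (x - y)) h1
      simp [this]
  filter_upwards [h.weakEquation _ hφ, ae_restrict_mem measurableSet_Icc] with s hs hsT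
  have hηs : η s = 1 := (hη1 s hsT).eq_of_nhds
  simp only [hηs, one_mul] at hs
  rw [mollify, ← hs]
  have hsub : Icc 0 s ⊆ Icc 0 T := Icc_subset_Icc_right hsT.2
  have hI : IntegrableOn (fun p : ℝ × EuclideanSpace ℝ (Fin d) =>
      a p.1 p.2 * (-(fderiv ℝ K (x - p.2) (v p.1 p.2)) + ν * (Δ K) (x - p.2)))
      (Icc 0 s ×ˢ univ) (volume.prod volume) := by
    rw [IntegrableOn, ← Measure.prod_restrict, Measure.restrict_univ]
    exact (h.integrable_mollifiedRHS_integrand hq hK x).mono_measure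
      (Measure.prod_mono (Measure.restrict_mono hsub le_rfl) le_rfl)
  have hcongr : ∀ z ∈ Icc 0 s ×ˢ (univ : Set (EuclideanSpace ℝ (Fin d))),
      a z.1 z.2 * (deriv (fun t => η t * K (x - z.2)) z.1
        + fderiv ℝ (fun y => η z.1 * K (x - y)) z.2 (v z.1 z.2)
        + ν * (Δ (fun y => η z.1 * K (x - y))) z.2) =
      a z.1 z.2 * (-(fderiv ℝ K (x - z.2) (v z.1 z.2)) + ν * (Δ K) (x - z.2)) := by
    rintro ⟨t, y⟩ ⟨ht, -⟩
    have h1 := hη1 t (hsub ht)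
    have h2 : deriv (fun t => η t * K (x - y)) t = 0 := by
      have : (fun t => η t * K (x - y)) =ᶠ[𝓝 t] fun _ => 1 * K (x - y) := by
        filter_upwards [h1] with u hu
        rw [hu]
      rw [this.deriv_eq]; simp
    simp only [h2, h1.eq_of_nhds, one_mul, zero_add, fderiv_comp_const_sub' hK.1,
      laplacian_comp_const_sub hK.1]
  rw [setIntegral_congr_fun (measurableSet_Icc.prod MeasurableSet.univ) hcongr,
    Measure.volume_eq_prod, setIntegral_prod _ hI]
  simp only [Measure.restrict_univ]
  rfl

theorem integrableOn_mollifiedRHS (h : IsNormalizedSolution ν T q q' v G a)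
    (hq : ENNReal.HolderConjugate q q') {K : EuclideanSpace ℝ (Fin d) → ℝ}
    (hK : IsTestFunction K) (x : EuclideanSpace ℝ (Fin d)) :
    IntegrableOn (fun t => mollifiedRHS ν K (v t) (a t) x) (Icc 0 T) :=
  (h.integrable_mollifiedRHS_integrand hq hK x).integral_prod_left

end IsNormalizedSolution

/-! ### The estimate under a moving cutoff -/

theorem ofReal_integral_le_lintegral_ofReal {X : Type*} [MeasurableSpace X] {μ : Measure X}
    {f : X → ℝ} (hf : Integrable f μ) :
    ENNReal.ofReal (∫ x, f x ∂μ) ≤ ∫⁻ x, ENNReal.ofReal (f x) ∂μ := by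
  rw [integral_eq_lintegral_pos_part_sub_lintegral_neg_part hf]
  exact (ENNReal.ofReal_le_ofReal (sub_le_self _ ENNReal.toReal_nonneg)).trans
    ENNReal.ofReal_toReal_le

theorem stronglyMeasurable_integral_Icc {F : Type*} [NormedAddCommGroup F] [NormedSpace ℝ F]
    {c : ℝ → F} (hc : StronglyMeasurable c) :
    StronglyMeasurable (fun t => ∫ s in Icc 0 t, c s) := by
  have hm : MeasurableSet {p : ℝ × ℝ | p.2 ∈ Icc 0 p.1} :=
    (measurableSet_le measurable_const measurable_snd).inter
      (measurableSet_le measurable_snd measurable_fst)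
  have h := ((hc.comp_measurable measurable_snd).indicator hm).integral_prod_right' (ν := volume)
  have e : (fun t => ∫ s in Icc 0 t, c s) = fun t : ℝ => ∫ y,
      {p : ℝ × ℝ | p.2 ∈ Icc 0 p.1}.indicator
      (fun p : ℝ × ℝ => c p.2) (t, y) := by
    funext t
    rw [← integral_indicator measurableSet_Icc]
    rfl
  rw [e]
  exact h

namespace IsNormalizedSolution

variable {ν T : ℝ} {q q' : ℝ≥0∞}
  {v : ℝ → EuclideanSpace ℝ (Fin d) → EuclideanSpace ℝ (Fin d)}
  {G : ℝ → EuclideanSpace ℝ (Fin d) → EuclideanSpace ℝ (Fin d) →L[ℝ] EuclideanSpace ℝ (Fin d)}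
  {a : ℝ → EuclideanSpace ℝ (Fin d) → ℝ}

/-- The localized estimate in a frame that moves with the velocity `c`: the total mass of
`smoothAbs` of the mollified solution under the moving cutoff is controlled by the commutator, by
the flux of `v - c` through the cutoff, and by the diffusion through the cutoff. -/
theorem lintegral_smoothAbs_mul_cutoff_le (h : IsNormalizedSolution ν T q q' v G a)
    (hq : ENNReal.HolderConjugate q q') (hT : 0 < T) (hν : 0 ≤ ν)
    {K χ : EuclideanSpace ℝ (Fin d) → ℝ} (hK : IsTestFunction K) (hχ : IsTestFunction χ)
    (hχ0 : ∀ x, 0 ≤ χ x) (hχ1 : ∀ x, χ x ≤ 1)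
    {c : ℝ → EuclideanSpace ℝ (Fin d)} (hcm : StronglyMeasurable c)
    (hci : IntegrableOn c (Icc 0 T))
    (hac : ∫⁻ t in Icc 0 T, eLpNorm (a t) q volume * ‖c t‖ₑ < ∞) :
    ∫⁻ t in Icc 0 T, ∫⁻ x, ENNReal.ofReal
        (smoothAbs (mollify K (a t) x) * χ (x - ∫ s in Icc 0 t, c s))
      ≤ ENNReal.ofReal T * ∫⁻ t in Icc 0 T,
        ((∫⁻ x, ‖transportCommutator K (v t) (a t) x‖ₑ)
        + (∫⁻ x, ‖mollify K (a t) x‖ₑ *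
            (‖fderiv ℝ χ (x - ∫ s in Icc 0 t, c s)‖ₑ * ‖v t x - c t‖ₑ))
        + ENNReal.ofReal ν * ∫⁻ x, ‖smoothAbs (mollify K (a t) x)‖ₑ *
            ‖(Δ χ) (x - ∫ s in Icc 0 t, c s)‖ₑ) := by
  set X : ℝ → EuclideanSpace ℝ (Fin d) := fun t => ∫ s in Icc 0 t, c s
  have hXm : StronglyMeasurable X := stronglyMeasurable_integral_Icc hcm
  set N : ℝ := ∫ s in Icc 0 T, ‖c s‖
  have hXN : ∀ t ∈ Icc 0 T, ‖X t‖ ≤ N := fun t ht =>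
    (norm_integral_le_integral_norm _).trans (setIntegral_mono_set hci.norm
      (Eventually.of_forall fun _ => norm_nonneg _)
      (Icc_subset_Icc_right ht.2).eventuallyLE)
  obtain ⟨C, hC, M, hb⟩ := hK.exists_kernel_bound ν
  obtain ⟨D, hD, L, hDL⟩ := hχ.2.exists_enorm_le_indicator hχ.continuous
  obtain ⟨D', hD', L', hDL'⟩ := (hχ.2.fderiv (𝕜 := ℝ)).exists_enorm_le_indicator
    (hχ.1.continuous_fderiv (by simp))
  set R : ℝ := N + max L L'
  set B : Set (EuclideanSpace ℝ (Fin d)) := Metric.closedBall 0 R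
  have hBm : MeasurableSet B := Metric.isClosed_closedBall.measurableSet
  have hBv : volume B ≠ ∞ := (isCompact_closedBall 0 R).measure_lt_top.ne
  have hshift (D : ℝ≥0∞) (L : ℝ) (hL : N + L ≤ R) (t) (ht : t ∈ Icc 0 T) (x) :
      (Metric.closedBall 0 L).indicator (fun _ => D) (x - X t) ≤ B.indicator (fun _ => D) x := by
    have e : (Metric.closedBall (0 : EuclideanSpace ℝ (Fin d)) L).indicator (fun _ => D) (x - X t)
        = (Metric.closedBall 0 L).indicator (fun _ => D) (X t - x) := by
      have : x - X t ∈ Metric.closedBall (0 : EuclideanSpace ℝ (Fin d)) L ↔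
          X t - x ∈ Metric.closedBall (0 : EuclideanSpace ℝ (Fin d)) L := by
        rw [mem_closedBall_zero_iff, mem_closedBall_zero_iff, norm_sub_rev]
      by_cases hx : x - X t ∈ Metric.closedBall (0 : EuclideanSpace ℝ (Fin d)) L
      · rw [indicator_of_mem hx, indicator_of_mem (this.1 hx)]
      · rw [indicator_of_notMem hx, indicator_of_notMem (fun h' => hx (this.2 h'))]
    rw [e]
    exact (indicator_closedBall_sub_le D (hXN t ht)).trans (indicator_closedBall_mono D hL x)
  have hχb (t) (ht : t ∈ Icc 0 T) (x) : ‖χ (x - X t)‖ₑ ≤ B.indicator (fun _ => D) x :=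
    (hDL _).trans (hshift D L (by simp [R]) t ht x)
  have hχb' (t) (ht : t ∈ Icc 0 T) (x) : ‖fderiv ℝ χ (x - X t)‖ₑ ≤ B.indicator (fun _ => D') x :=
    (hDL' _).trans (hshift D' L' (by simp [R]) t ht x)
  -- joint measurability of the ingredients
  have hfm := h.stronglyMeasurable_mollify hK
  have hFm := h.stronglyMeasurable_mollifiedRHS hK
  have hsub : Measurable (fun p : ℝ × EuclideanSpace ℝ (Fin d) => p.2 - X p.1) :=
    measurable_snd.sub (hXm.measurable.comp measurable_fst)
  have hχm : StronglyMeasurable (fun p : ℝ × EuclideanSpace ℝ (Fin d) => χ (p.2 - X p.1)) :=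
    hχ.continuous.stronglyMeasurable.comp_measurable hsub
  have hχm' : StronglyMeasurable
      (fun p : ℝ × EuclideanSpace ℝ (Fin d) => fderiv ℝ χ (p.2 - X p.1) (c p.1)) :=
    StronglyMeasurable.clm_apply_fun
      ((hχ.1.continuous_fderiv (by simp)).stronglyMeasurable.comp_measurable hsub)
      (hcm.comp_measurable measurable_fst)
  have hAm : StronglyMeasurable
      (fun p : ℝ × EuclideanSpace ℝ (Fin d) => smoothAbs (mollify K (a p.1) p.2)) :=
    (contDiff_smoothAbs (n := 0)).continuous.comp_stronglyMeasurable hfm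
  have hSm : StronglyMeasurable
      (fun p : ℝ × EuclideanSpace ℝ (Fin d) => smoothSign (mollify K (a p.1) p.2)) :=
    (contDiff_smoothSign (n := 0)).continuous.comp_stronglyMeasurable hfm
  set g : ℝ × EuclideanSpace ℝ (Fin d) → ℝ := fun p =>
    smoothAbs (mollify K (a p.1) p.2) * χ (p.2 - X p.1)
  set H : ℝ × EuclideanSpace ℝ (Fin d) → ℝ := fun p =>
    smoothSign (mollify K (a p.1) p.2) * mollifiedRHS ν K (v p.1) (a p.1) p.2 * χ (p.2 - X p.1)
      - smoothAbs (mollify K (a p.1) p.2) * fderiv ℝ χ (p.2 - X p.1) (c p.1)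
  have hgm : StronglyMeasurable g := hAm.mul hχm
  have hHm : StronglyMeasurable H := ((hSm.mul hFm).mul hχm).sub (hAm.mul hχm')
  have hSle (u : ℝ) : ‖smoothSign u‖ₑ ≤ 1 := by
    rw [← ofReal_norm]
    exact ENNReal.ofReal_le_one.2 (abs_smoothSign_le_one u)
  set Ia : ℝ → ℝ≥0∞ := fun t => ∫⁻ y in Metric.closedBall 0 (R + M), ‖a t y‖ₑ
  set Iv : ℝ → ℝ≥0∞ := fun t =>
    ∫⁻ y in Metric.closedBall 0 (R + M), (‖a t y‖ₑ * ‖v t y‖ₑ + ‖a t y‖ₑ)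
  have hfb (t x) (hx : x ∈ B) : ‖mollify K (a t) x‖ₑ ≤ C * Ia t :=
    enorm_mollify_le (fun y => (hb x y 0 R (by simpa [B] using hx)).1) hC
  have hFb (t x) (hx : x ∈ B) : ‖mollifiedRHS ν K (v t) (a t) x‖ₑ ≤ C * Iv t :=
    enorm_mollifiedRHS_le (fun y w => (hb x y w R (by simpa [B] using hx)).2) hC
  have hIa : ∫⁻ t in Icc 0 T, Ia t < ∞ := h.lintegral_setLIntegral_a_lt_top hq _
  have hIv : ∫⁻ t in Icc 0 T, Iv t < ∞ := h.lintegral_setLIntegral_add_lt_top hq _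
  have hIc : ∫⁻ t in Icc 0 T, Ia t * ‖c t‖ₑ < ∞ := by
    refine lt_of_le_of_lt (lintegral_mono (g := fun t => ballConst d q' (R + M) *
      (eLpNorm (a t) q volume * ‖c t‖ₑ)) fun t => ?_) ?_
    · dsimp only
      rw [← mul_assoc, mul_comm (ballConst d q' (R + M))]
      exact mul_le_mul' (setLIntegral_closedBall_enorm_le hq
        (h.a_meas_slice t).aestronglyMeasurable _) le_rfl
    · rw [lintegral_const_mul' _ _ (ballConst_lt_top d q' _).ne]
      exact ENNReal.mul_lt_top (ballConst_lt_top d q' _) hac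
  -- both integrands are integrable over `[0, T] × ℝ^d`
  have hgi : Integrable g ((volume.restrict (Icc 0 T)).prod volume) := by
    refine ⟨hgm.aestronglyMeasurable, ?_⟩
    rw [HasFiniteIntegral, lintegral_prod _ hgm.enorm.aemeasurable]
    refine lt_of_le_of_lt (setLIntegral_mono' measurableSet_Icc
      (g := fun t => C * D * volume B * Ia t) fun t ht => ?_) ?_
    · calc ∫⁻ x, ‖g (t, x)‖ₑ ≤ ∫⁻ x, B.indicator (fun _ => C * Ia t * D) x := by
            refine lintegral_mono fun x => ?_
            simp only [g]
            rw [enorm_mul]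
            by_cases hx : x ∈ B
            · have h2 := hχb t ht x
              rw [indicator_of_mem hx] at h2 ⊢
              exact mul_le_mul' ((enorm_smoothAbs_le _).trans (hfb t x hx)) h2
            · have h2 := hχb t ht x
              rw [indicator_of_notMem hx, nonpos_iff_eq_zero] at h2
              rw [h2, mul_zero]; exact zero_le
        _ = C * Ia t * D * volume B := lintegral_indicator_const hBm _
        _ = _ := by ring
    · rw [lintegral_const_mul' _ _ (by finiteness)]
      exact ENNReal.mul_lt_top (by finiteness) hIa
  have hHi : Integrable H ((volume.restrict (Icc 0 T)).prod volume) := by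
    refine ⟨hHm.aestronglyMeasurable, ?_⟩
    rw [HasFiniteIntegral, lintegral_prod _ hHm.enorm.aemeasurable]
    refine lt_of_le_of_lt (setLIntegral_mono' measurableSet_Icc
      (g := fun t => C * D * volume B * Iv t + C * D' * volume B * (Ia t * ‖c t‖ₑ))
        fun t ht => ?_) ?_
    · calc ∫⁻ x, ‖H (t, x)‖ₑ
          ≤ ∫⁻ x, B.indicator (fun _ => C * Iv t * D + C * Ia t * (D' * ‖c t‖ₑ)) x := by
            refine lintegral_mono fun x => ?_
            simp only [H]
            refine (enorm_sub_le).trans ?_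
            rw [enorm_mul, enorm_mul, enorm_mul]
            have h4 := ContinuousLinearMap.le_opENorm (fderiv ℝ χ (x - X t)) (c t)
            have h2 := hχb t ht x
            have h3 := hχb' t ht x
            by_cases hx : x ∈ B
            · rw [indicator_of_mem hx] at h2 h3 ⊢
              refine add_le_add (mul_le_mul' ?_ h2)
                (mul_le_mul' ((enorm_smoothAbs_le _).trans (hfb t x hx))
                    (h4.trans (mul_le_mul' h3 le_rfl)))
              exact (mul_le_mul' (hSle _) (hFb t x hx)).trans (one_mul _).le
            · rw [indicator_of_notMem hx, nonpos_iff_eq_zero] at h2 h3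
              rw [h3, zero_mul, nonpos_iff_eq_zero] at h4
              rw [h2, h4, mul_zero, mul_zero, add_zero]; exact zero_le
        _ = (C * Iv t * D + C * Ia t * (D' * ‖c t‖ₑ)) * volume B :=
            lintegral_indicator_const hBm _
        _ = _ := by ring
    · have hmIv : Measurable Iv := by
        have : Measurable (fun p : ℝ × EuclideanSpace ℝ (Fin d) =>
          ‖a p.1 p.2‖ₑ * ‖v p.1 p.2‖ₑ + ‖a p.1 p.2‖ₑ) :=
          (h.a_meas.enorm.mul h.v_meas.enorm).add h.a_meas.enorm
        exact this.lintegral_prod_right'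
      rw [lintegral_add_left (hmIv.const_mul _), lintegral_const_mul' _ _ (by finiteness),
        lintegral_const_mul' _ _ (by finiteness)]
      exact ENNReal.add_lt_top.2 ⟨ENNReal.mul_lt_top (by finiteness) hIv,
        ENNReal.mul_lt_top (by finiteness) hIc⟩
  have hTH : Integrable (fun p : ℝ × EuclideanSpace ℝ (Fin d) => (T - p.1) * H p)
      ((volume.restrict (Icc 0 T)).prod volume) := by
    refine hHi.bdd_mul (c := T) (by fun_prop) ?_
    have : ∀ᵐ p : ℝ × EuclideanSpace ℝ (Fin d) ∂((volume.restrict (Icc 0 T)).prod volume),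
        p.1 ∈ Icc 0 T :=
      Measure.quasiMeasurePreserving_fst.ae (ae_restrict_mem measurableSet_Icc)
    filter_upwards [this] with p hp
    rw [Real.norm_of_nonneg (by linarith [hp.2])]
    linarith [hp.1]
  -- the chain rule in time, for each `x`
  have hx (x) : ∫ t in Icc 0 T, g (t, x) = ∫ t in Icc 0 T, (T - t) * H (t, x) := by
    have h1 := integral_smoothAbs_mul_moving_cutoff hT.le (h.integrableOn_mollifiedRHS hq hK x)
      hci hχ x
    have h2 := h.mollified_equation hq hT hK x
    have e1 : ∫ t in Icc 0 T, g (t, x) = ∫ t in Icc 0 T,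
        smoothAbs (∫ s in Icc 0 t, mollifiedRHS ν K (v s) (a s) x) * χ (x - X t) := by
      refine integral_congr_ae ?_
      filter_upwards [h2] with t ht
      simp only [g, ht]
    rw [e1, h1]
    refine integral_congr_ae ?_
    filter_upwards [h2] with t ht
    simp only [H, ht, X]
  calc ∫⁻ t in Icc 0 T, ∫⁻ x, ENNReal.ofReal (smoothAbs (mollify K (a t) x) * χ (x - X t))
      = ∫⁻ p, ENNReal.ofReal (g p) ∂((volume.restrict (Icc 0 T)).prod volume) :=
        (lintegral_prod _ hgm.measurable.ennreal_ofReal.aemeasurable).symm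
    _ = ENNReal.ofReal (∫ p, g p ∂((volume.restrict (Icc 0 T)).prod volume)) :=
        (ofReal_integral_eq_lintegral_ofReal hgi (Eventually.of_forall fun p =>
          mul_nonneg (smoothAbs_nonneg _) (hχ0 _))).symm
    _ = ENNReal.ofReal (∫ t in Icc 0 T, (T - t) * ∫ x, H (t, x)) := by
        rw [integral_prod_symm _ hgi]
        simp only [hx]
        rw [← integral_prod_symm (fun p : ℝ × EuclideanSpace ℝ (Fin d) => (T - p.1) * H p) hTH,
          integral_prod _ hTH]
        simp only [integral_const_mul]
    _ ≤ ∫⁻ t in Icc 0 T, ENNReal.ofReal ((T - t) * ∫ x, H (t, x)) := by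
        refine ofReal_integral_le_lintegral_ofReal ?_
        have := hTH.integral_prod_left
        simpa only [integral_const_mul] using this
    _ ≤ _ := by
        rw [← lintegral_const_mul' _ _ ENNReal.ofReal_ne_top]
        refine setLIntegral_mono' measurableSet_Icc fun t ht => ?_
        rw [ENNReal.ofReal_mul (by linarith [ht.2])]
        refine mul_le_mul' (ENNReal.ofReal_le_ofReal (by linarith [ht.1])) ?_
        have key := ofReal_integral_smoothAbs_balance_le hν hK (h.a_locInt hq t)
          (h.a_meas_slice t) (h.av_locInt hq t) (h.v_locInt t) (h.v_meas_slice t) (h.divFree t)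
          (hχ.comp_sub_const (X t)) (fun x => hχ0 _) (fun x => hχ1 _) (c t)
        have e (x) : fderiv ℝ (fun x => χ (x - X t)) x = fderiv ℝ χ (x - X t) :=
          fderiv_comp_sub _
        simp only [e, laplacian_comp_sub_const hχ.1] at key
        exact key

end IsNormalizedSolution

/-! ### Comparison of a field with its averages over balls -/

/-- Poincaré-type estimate along the segments that join the points of `S` to the points of `B`:
only the values of the gradient on a set `Z` that contains all these segments enter. -/
theorem HasWeakGradient.lintegral_segment_le
    {q q' : ℝ≥0∞} (hq : ENNReal.HolderConjugate q q')
    {u : EuclideanSpace ℝ (Fin d) → EuclideanSpace ℝ (Fin d)}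
    {G : EuclideanSpace ℝ (Fin d) → EuclideanSpace ℝ (Fin d) →L[ℝ] EuclideanSpace ℝ (Fin d)}
    (h : HasWeakGradient u G) (hum : StronglyMeasurable u) (hGm : StronglyMeasurable G)
    {f : EuclideanSpace ℝ (Fin d) → ℝ} (hf : StronglyMeasurable f)
    {S B Z : Set (EuclideanSpace ℝ (Fin d))} (hS : MeasurableSet S) (hB : MeasurableSet B)
    (hZ : MeasurableSet Z) {M : ℝ} (hM : ∀ x ∈ S, ∀ y ∈ B, ‖y - x‖ ≤ M)
    (hseg : ∀ x ∈ S, ∀ y ∈ B, ∀ s ∈ Icc (0 : ℝ) 1, x + s • (y - x) ∈ Z) :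
    ∫⁻ x in S, ∫⁻ y in B, ‖f x‖ₑ * ‖u y - u x‖ₑ
      ≤ ENNReal.ofReal M * volume (Metric.closedBall (0 : EuclideanSpace ℝ (Fin d)) M) *
        (eLpNorm f q volume * eLpNorm (Z.indicator G) q' volume) := by
  set N : ℝ≥0∞ := eLpNorm f q volume * eLpNorm (Z.indicator G) q' volume
  let W : EuclideanSpace ℝ (Fin d) → EuclideanSpace ℝ (Fin d) → ℝ≥0∞ :=
    fun z => (S ∩ (fun x => x + z) ⁻¹' B).indicator fun x => ‖f x‖ₑ
  have hset (z) : MeasurableSet (S ∩ (fun x => x + z) ⁻¹' B) :=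
    hS.inter (hB.preimage (measurable_add_const z))
  have hWm : Measurable (fun p : EuclideanSpace ℝ (Fin d) × EuclideanSpace ℝ (Fin d) =>
      W p.2 p.1 * ‖u (p.1 + p.2) - u p.1‖ₑ) := by
    have hset : MeasurableSet {p : EuclideanSpace ℝ (Fin d) × EuclideanSpace ℝ (Fin d) |
        p.1 ∈ S ∧ p.1 + p.2 ∈ B} :=
      (hS.preimage measurable_fst).inter (hB.preimage (measurable_fst.add measurable_snd))
    have e : (fun p : EuclideanSpace ℝ (Fin d) × EuclideanSpace ℝ (Fin d) => W p.2 p.1)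
        = {p : EuclideanSpace ℝ (Fin d) × EuclideanSpace ℝ (Fin d) |
          p.1 ∈ S ∧ p.1 + p.2 ∈ B}.indicator fun p => ‖f p.1‖ₑ := rfl
    refine Measurable.mul ?_ ((hum.comp_measurable (measurable_fst.add measurable_snd)).sub
      (hum.comp_measurable measurable_fst)).enorm
    rw [e]
    exact (hf.comp_measurable measurable_fst).enorm.indicator hset
  -- the substitution `y = x + z`: for a fixed `z` the weight selects `x ∈ S` with `x + z ∈ B`
  calc ∫⁻ x in S, ∫⁻ y in B, ‖f x‖ₑ * ‖u y - u x‖ₑ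
      = ∫⁻ x, ∫⁻ z, W z x * ‖u (x + z) - u x‖ₑ := by
        rw [← lintegral_indicator hS]
        refine lintegral_congr fun x => ?_
        by_cases hx : x ∈ S
        · rw [indicator_of_mem hx, ← lintegral_indicator hB, ← lintegral_add_left_eq_self _ x]
          refine lintegral_congr fun z => ?_
          by_cases hz : x + z ∈ B
          · rw [indicator_of_mem hz]
            simp only [W]
            rw [indicator_of_mem (show x ∈ S ∩ (fun x => x + z) ⁻¹' B from ⟨hx, hz⟩)]
          · rw [indicator_of_notMem hz]
            simp only [W]
            rw [indicator_of_notMem (fun h => hz h.2), zero_mul]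
        · rw [indicator_of_notMem hx]
          have : ∀ z, W z x = 0 := fun z => indicator_of_notMem (fun h => hx h.1) _
          simp [this]
    _ = ∫⁻ z, ∫⁻ x, W z x * ‖u (x + z) - u x‖ₑ :=
        lintegral_lintegral_swap hWm.aemeasurable
    _ ≤ ∫⁻ z : EuclideanSpace ℝ (Fin d),
          (Metric.closedBall 0 M).indicator (fun _ => ENNReal.ofReal M * N) z := by
        refine lintegral_mono fun z => ?_
        by_cases hz : z ∈ Metric.closedBall (0 : EuclideanSpace ℝ (Fin d)) M
        · rw [indicator_of_mem hz]
          refine (h.lintegral_mul_translate_sub_le_of_le hum hGm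
            (hf.enorm.indicator (hset z)) (B := N) fun s hs => ?_).trans ?_
          · have := lintegral_translate_mul_le (μ := volume) hq hf.aestronglyMeasurable
              (hGm.indicator hZ).aestronglyMeasurable 0 (s • z)
            simp only [add_zero] at this
            refine le_trans (lintegral_mono fun x => ?_) this
            by_cases hx : x ∈ S ∩ (fun x => x + z) ⁻¹' B
            · rw [indicator_of_mem hx, indicator_of_mem]
              simpa using hseg x hx.1 (x + z) hx.2 s hs
            · rw [indicator_of_notMem hx, zero_mul]
              exact zero_le
          · gcongr
            rw [← ofReal_norm]
            exact ENNReal.ofReal_le_ofReal (mem_closedBall_zero_iff.1 hz)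
        · rw [indicator_of_notMem hz]
          have : ∀ x, W z x = 0 := fun x => indicator_of_notMem (fun h => hz (by
            simpa using hM x h.1 (x + z) h.2)) _
          simp [this]
    _ = _ := by
        rw [lintegral_indicator_const Metric.isClosed_closedBall.measurableSet]
        ring

/-- The distance from `w` to an average of `u` is at most the average distance from `w` to `u`. -/
theorem measure_mul_enorm_sub_setAverage_le {X F : Type*} [MeasurableSpace X]
    [NormedAddCommGroup F] [NormedSpace ℝ F] [CompleteSpace F] {μ : Measure X} {B : Set X}
    (hB0 : μ B ≠ 0) (hB : μ B ≠ ∞) {u : X → F} (hu : IntegrableOn u B μ) (w : F) :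
    μ B * ‖w - ⨍ y in B, u y ∂μ‖ₑ ≤ ∫⁻ y in B, ‖u y - w‖ₑ ∂μ := by
  have hr : (μ.real B) ≠ 0 := by
    rw [measureReal_def]; exact (ENNReal.toReal_pos hB0 hB).ne'
  have e : (μ.real B) • (w - ⨍ y in B, u y ∂μ) = ∫ y in B, (w - u y) ∂μ := by
    have hw : IntegrableOn (fun _ => w) B μ := integrableOn_const (hs := hB) (by simp)
    rw [integral_sub hw hu, setIntegral_const, smul_sub,
      setAverage_eq, smul_inv_smul₀ hr]
  have e2 : μ B * ‖w - ⨍ y in B, u y ∂μ‖ₑ = ‖∫ y in B, (w - u y) ∂μ‖ₑ := by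
    rw [← e, enorm_smul, measureReal_def, Real.enorm_of_nonneg ENNReal.toReal_nonneg,
      ENNReal.ofReal_toReal hB]
  rw [e2]
  refine (enorm_integral_le_lintegral_enorm _).trans (le_of_eq ?_)
  refine lintegral_congr fun y => ?_
  rw [← enorm_neg, neg_sub]

/-- Comparison of `u` on `S` with its average over `B`, through the intermediate set `U`. -/
theorem HasWeakGradient.setLIntegral_mul_sub_setAverage_le
    {q q' : ℝ≥0∞} (hq : ENNReal.HolderConjugate q q')
    {u : EuclideanSpace ℝ (Fin d) → EuclideanSpace ℝ (Fin d)}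
    {G : EuclideanSpace ℝ (Fin d) → EuclideanSpace ℝ (Fin d) →L[ℝ] EuclideanSpace ℝ (Fin d)}
    (h : HasWeakGradient u G) (hum : StronglyMeasurable u) (hGm : StronglyMeasurable G)
    {f : EuclideanSpace ℝ (Fin d) → ℝ} (hf : StronglyMeasurable f)
    {S U B Z : Set (EuclideanSpace ℝ (Fin d))} (hS : MeasurableSet S) (hU : MeasurableSet U)
    (hB : MeasurableSet B) (hZ : MeasurableSet Z) (hB0 : volume B ≠ 0) (hBtop : volume B ≠ ∞)
    (huB : IntegrableOn u B)
    {M : ℝ} (hM1 : ∀ x ∈ S, ∀ y ∈ U, ‖y - x‖ ≤ M) (hM2 : ∀ x ∈ U, ∀ y ∈ B, ‖y - x‖ ≤ M)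
    (hseg1 : ∀ x ∈ S, ∀ y ∈ U, ∀ s ∈ Icc (0 : ℝ) 1, x + s • (y - x) ∈ Z)
    (hseg2 : ∀ x ∈ U, ∀ y ∈ B, ∀ s ∈ Icc (0 : ℝ) 1, x + s • (y - x) ∈ Z) :
    volume U * volume B * ∫⁻ x in S, ‖f x‖ₑ * ‖u x - ⨍ y in B, u y‖ₑ
      ≤ ENNReal.ofReal M * volume (Metric.closedBall (0 : EuclideanSpace ℝ (Fin d)) M) *
        eLpNorm (Z.indicator G) q' volume *
        (volume B * eLpNorm f q volume +
          (∫⁻ x in S, ‖f x‖ₑ) * eLpNorm (U.indicator fun _ => (1 : ℝ)) q volume) := by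
  set c := ⨍ y in B, u y
  have h1 := h.lintegral_segment_le hq hum hGm hf hS hU hZ hM1 hseg1
  have h2 := h.lintegral_segment_le hq hum hGm
    ((stronglyMeasurable_const (b := (1 : ℝ))).indicator hU) hU hB hZ hM2 hseg2
  have h2' : ∫⁻ w in U, volume B * ‖u w - c‖ₑ
      ≤ ENNReal.ofReal M * volume (Metric.closedBall (0 : EuclideanSpace ℝ (Fin d)) M) *
      (eLpNorm (U.indicator fun _ => (1 : ℝ)) q volume * eLpNorm (Z.indicator G) q' volume) := by
    refine le_trans (setLIntegral_mono' hU fun w hw => ?_) h2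
    rw [indicator_of_mem hw]
    simp only [enorm_one, one_mul]
    exact measure_mul_enorm_sub_setAverage_le hB0 hBtop huB (u w)
  have hwm : Measurable fun w => ‖u w - c‖ₑ := (hum.sub stronglyMeasurable_const).enorm
  have hsm (x) : Measurable fun w => ‖u w - u x‖ₑ := (hum.sub stronglyMeasurable_const).enorm
  -- the triangle inequality through `u w`, integrated over `w ∈ U`
  calc volume U * volume B * ∫⁻ x in S, ‖f x‖ₑ * ‖u x - c‖ₑ
      = ∫⁻ x in S, ∫⁻ w in U, volume B * (‖f x‖ₑ * ‖u x - c‖ₑ) := by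
        simp only [setLIntegral_const]
        rw [lintegral_mul_const _ ?_, lintegral_const_mul _ ?_]
        · ring
        · exact hf.enorm.mul hwm
        · exact (hf.enorm.mul hwm).const_mul _
    _ ≤ ∫⁻ x in S, (volume B * (∫⁻ w in U, ‖f x‖ₑ * ‖u w - u x‖ₑ)
          + ‖f x‖ₑ * ∫⁻ w in U, volume B * ‖u w - c‖ₑ) := by
        refine lintegral_mono fun x => ?_
        rw [← lintegral_const_mul' _ _ hBtop, ← lintegral_const_mul' _ _ enorm_ne_top,
          ← lintegral_add_left (((hsm x).const_mul _).const_mul _)]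
        refine lintegral_mono fun w => ?_
        dsimp only
        have : ‖u x - c‖ₑ ≤ ‖u w - u x‖ₑ + ‖u w - c‖ₑ := by
          have e : u x - c = (u w - c) - (u w - u x) := by abel
          rw [e]
          exact enorm_sub_le.trans (add_comm _ _).le
        calc volume B * (‖f x‖ₑ * ‖u x - c‖ₑ)
            ≤ volume B * (‖f x‖ₑ * (‖u w - u x‖ₑ + ‖u w - c‖ₑ)) := by gcongr
          _ = _ := by ring
    _ = volume B * (∫⁻ x in S, ∫⁻ w in U, ‖f x‖ₑ * ‖u w - u x‖ₑ)
          + (∫⁻ x in S, ‖f x‖ₑ) * ∫⁻ w in U, volume B * ‖u w - c‖ₑ := by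
        rw [lintegral_add_right _ (hf.enorm.mul_const _), lintegral_const_mul' _ _ hBtop,
          lintegral_mul_const _ hf.enorm]
    _ ≤ _ := by
        refine (add_le_add (mul_le_mul' le_rfl h1) (mul_le_mul' le_rfl h2')).trans (le_of_eq ?_)
        ring

/-- Since `1/q + 1/q' = 1`, the constants of `L^q` and `L^{q'}` multiply to the volume of the
ball. -/
theorem ballConst_mul_ballConst_le {q q' : ℝ≥0∞} (hq : ENNReal.HolderConjugate q q') (R : ℝ) :
    ballConst d q R * ballConst d q' R
      ≤ volume (Metric.closedBall (0 : EuclideanSpace ℝ (Fin d)) R) := by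
  by_cases hR : R < 0
  · simp [ballConst, Metric.closedBall_eq_empty.2 hR]
  have hV0 : volume (Metric.closedBall (0 : EuclideanSpace ℝ (Fin d)) R) ≠ ∞ :=
    (isCompact_closedBall 0 R).measure_lt_top.ne
  have key (q : ℝ≥0∞) : ballConst d q R
      ≤ volume (Metric.closedBall (0 : EuclideanSpace ℝ (Fin d)) R) ^ (1 / q.toReal) := by
    have := eLpNorm_indicator_const_le (μ := volume) (s := Metric.closedBall
      (0 : EuclideanSpace ℝ (Fin d)) R) (1 : ℝ) q
    simpa [ballConst] using this
  refine (mul_le_mul' (key q) (key q')).trans (le_of_eq ?_)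
  have e : 1 / q.toReal + 1 / q'.toReal = 1 := by
    have h1 := congrArg ENNReal.toReal hq.inv_add_inv_eq_one
    rw [ENNReal.toReal_add (by simp [hq.ne_zero]) (by simp [hq.symm.ne_zero]),
      ENNReal.toReal_inv, ENNReal.toReal_inv] at h1
    simpa using h1
  rw [← ENNReal.rpow_add_of_nonneg _ _ (by positivity) (by positivity), e, ENNReal.rpow_one]

theorem eLpNorm_indicator_one_le_ballConst {q : ℝ≥0∞} {U : Set (EuclideanSpace ℝ (Fin d))} {R : ℝ}
    (h : U ⊆ Metric.closedBall 0 R) :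
    eLpNorm (U.indicator fun _ => (1 : ℝ)) q volume ≤ ballConst d q R := by
  refine eLpNorm_mono fun x => ?_
  by_cases hx : x ∈ U
  · rw [indicator_of_mem hx, indicator_of_mem (h hx)]
  · rw [indicator_of_notMem hx, norm_zero]
    exact norm_nonneg _

/-- The constant in the comparison of a field with its average over a ball of radius `r`, when
everything takes place in the ball of radius `k r`. -/
noncomputable def averageConst (d : ℕ) (k : ℝ) : ℝ≥0∞ :=
  ENNReal.ofReal (2 * k) * ENNReal.ofReal ((2 * k) ^ d) * (1 + ENNReal.ofReal ((2 * k) ^ d))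

theorem averageConst_lt_top (d : ℕ) (k : ℝ) : averageConst d k < ∞ := by
  unfold averageConst; finiteness

/-- Scale invariant form of the comparison of `u` with its average over a ball, through an
intermediate ball of the same radius. -/
theorem HasWeakGradient.setLIntegral_mul_sub_ballAverage_le
    {q q' : ℝ≥0∞} (hq : ENNReal.HolderConjugate q q')
    {u : EuclideanSpace ℝ (Fin d) → EuclideanSpace ℝ (Fin d)}
    {G : EuclideanSpace ℝ (Fin d) → EuclideanSpace ℝ (Fin d) →L[ℝ] EuclideanSpace ℝ (Fin d)}
    (h : HasWeakGradient u G) (hum : StronglyMeasurable u) (hGm : StronglyMeasurable G)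
    {f : EuclideanSpace ℝ (Fin d) → ℝ} (hf : StronglyMeasurable f)
    {S Z : Set (EuclideanSpace ℝ (Fin d))} (hS : MeasurableSet S) (hZ : MeasurableSet Z)
    {k r : ℝ} (hk : 0 ≤ k) (hr : 0 < r) {m p : EuclideanSpace ℝ (Fin d)}
    (hm : ‖m‖ + r ≤ k * r) (hp : ‖p‖ + r ≤ k * r) (hSk : S ⊆ Metric.closedBall 0 (k * r))
    (hseg1 : ∀ x ∈ S, ∀ y ∈ Metric.closedBall m r, ∀ s ∈ Icc (0 : ℝ) 1, x + s • (y - x) ∈ Z)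
    (hseg2 : ∀ x ∈ Metric.closedBall m r, ∀ y ∈ Metric.closedBall p r, ∀ s ∈ Icc (0 : ℝ) 1,
      x + s • (y - x) ∈ Z) :
    ∫⁻ x in S, ‖f x‖ₑ * ‖u x - ⨍ y in Metric.closedBall p r, u y‖ₑ
      ≤ averageConst d k * ENNReal.ofReal r *
        (eLpNorm f q volume * eLpNorm (Z.indicator G) q' volume) := by
  have hU : Metric.closedBall m r ⊆ Metric.closedBall 0 (k * r) := by
    refine Metric.closedBall_subset_closedBall' ?_
    rw [dist_zero_right]; linarith
  have hB : Metric.closedBall p r ⊆ Metric.closedBall 0 (k * r) := by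
    refine Metric.closedBall_subset_closedBall' ?_
    rw [dist_zero_right]; linarith
  have hdist {x y : EuclideanSpace ℝ (Fin d)} (hx : x ∈ Metric.closedBall 0 (k * r))
      (hy : y ∈ Metric.closedBall 0 (k * r)) : ‖y - x‖ ≤ 2 * k * r := by
    rw [mem_closedBall_zero_iff] at hx hy
    linarith [norm_sub_le y x]
  have hV0 : volume (Metric.closedBall (0 : EuclideanSpace ℝ (Fin d)) r) ≠ 0 :=
    (Metric.measure_closedBall_pos volume 0 hr).ne'
  have hVt : volume (Metric.closedBall (0 : EuclideanSpace ℝ (Fin d)) r) ≠ ∞ :=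
    (isCompact_closedBall 0 r).measure_lt_top.ne
  have hVm := Measure.addHaar_closedBall_center (volume : Measure (EuclideanSpace ℝ (Fin d))) m r
  have hVp := Measure.addHaar_closedBall_center (volume : Measure (EuclideanSpace ℝ (Fin d))) p r
  have hW : volume (Metric.closedBall (0 : EuclideanSpace ℝ (Fin d)) (2 * k * r))
      = ENNReal.ofReal ((2 * k) ^ d) * volume (Metric.closedBall
        (0 : EuclideanSpace ℝ (Fin d)) r) := by
    rw [Measure.addHaar_closedBall_mul _ _ (by positivity) hr.le, finrank_euclideanSpace_fin]
  have key := h.setLIntegral_mul_sub_setAverage_le hq hum hGm hf hS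
    (Metric.isClosed_closedBall.measurableSet (s := Metric.closedBall m r))
    (Metric.isClosed_closedBall.measurableSet (s := Metric.closedBall p r)) hZ
    (by rwa [hVp]) (by rwa [hVp]) (h.1.integrableOn_isCompact (isCompact_closedBall p r))
    (M := 2 * k * r) (fun x hx y hy => hdist (hSk hx) (hU hy))
    (fun x hx y hy => hdist (hU hx) (hB hy)) hseg1 hseg2
  rw [hVm, hVp] at key
  have hkr : k * r ≤ 2 * k * r := by nlinarith
  have hfS : (∫⁻ x in S, ‖f x‖ₑ) * eLpNorm ((Metric.closedBall m r).indicator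
      fun _ => (1 : ℝ)) q volume ≤ eLpNorm f q volume *
        volume (Metric.closedBall (0 : EuclideanSpace ℝ (Fin d)) (2 * k * r)) := by
    calc _ ≤ (eLpNorm f q volume * ballConst d q' (2 * k * r)) * ballConst d q (2 * k * r) := by
          refine mul_le_mul' ?_ (eLpNorm_indicator_one_le_ballConst
            (hU.trans (Metric.closedBall_subset_closedBall hkr)))
          exact (lintegral_mono_set (hSk.trans (Metric.closedBall_subset_closedBall hkr))).trans
            (setLIntegral_closedBall_enorm_le hq hf.aestronglyMeasurable _)
      _ ≤ _ := by
          rw [mul_assoc, mul_comm (ballConst d q' _)]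
          exact mul_le_mul' le_rfl (ballConst_mul_ballConst_le hq _)
  set V := volume (Metric.closedBall (0 : EuclideanSpace ℝ (Fin d)) r)
  rw [hW] at hfS key
  have hV2 : V * V ≠ 0 := mul_ne_zero hV0 hV0
  have hV2t : V * V ≠ ∞ := ENNReal.mul_ne_top hVt hVt
  rw [← ENNReal.mul_le_mul_iff_right hV2 hV2t]
  refine key.trans ((mul_le_mul' le_rfl (add_le_add le_rfl hfS)).trans (le_of_eq ?_))
  rw [averageConst, ENNReal.ofReal_mul (by positivity : 0 ≤ 2 * k)]
  ring

/-- Growth of the averages: the average of `u` over a ball of radius `r` at distance `O(r)` from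
the origin exceeds its `L¹` norm on the unit ball at most by `O(r)`. -/
theorem HasWeakGradient.mul_enorm_ballAverage_le
    {q q' : ℝ≥0∞} (hq : ENNReal.HolderConjugate q q')
    {u : EuclideanSpace ℝ (Fin d) → EuclideanSpace ℝ (Fin d)}
    {G : EuclideanSpace ℝ (Fin d) → EuclideanSpace ℝ (Fin d) →L[ℝ] EuclideanSpace ℝ (Fin d)}
    (h : HasWeakGradient u G) (hum : StronglyMeasurable u) (hGm : StronglyMeasurable G)
    {k r : ℝ} (hr : 0 < r) {p : EuclideanSpace ℝ (Fin d)}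
    (hp : ‖p‖ + r ≤ k * r) (h1 : 1 ≤ k * r) :
    volume (Metric.closedBall (0 : EuclideanSpace ℝ (Fin d)) 1) *
        ‖⨍ y in Metric.closedBall p r, u y‖ₑ
      ≤ (∫⁻ x in Metric.closedBall 0 1, ‖u x‖ₑ) +
        averageConst d k * ballConst d q 1 * ENNReal.ofReal r * eLpNorm G q' volume := by
  have hk : 0 ≤ k := by
    by_contra hk
    nlinarith [norm_nonneg p]
  have hB : MeasurableSet (Metric.closedBall (0 : EuclideanSpace ℝ (Fin d)) 1) :=
    Metric.isClosed_closedBall.measurableSet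
  have key := h.setLIntegral_mul_sub_ballAverage_le hq hum hGm
    ((stronglyMeasurable_const (b := (1 : ℝ))).indicator hB) hB MeasurableSet.univ hk hr hp hp
    (Metric.closedBall_subset_closedBall h1) (fun _ _ _ _ _ _ => mem_univ _)
    (fun _ _ _ _ _ _ => mem_univ _)
  rw [indicator_univ] at key
  set c := ⨍ y in Metric.closedBall p r, u y
  calc _ = ∫⁻ x in Metric.closedBall (0 : EuclideanSpace ℝ (Fin d)) 1, ‖c‖ₑ := by
        rw [setLIntegral_const, mul_comm]
    _ ≤ ∫⁻ x in Metric.closedBall (0 : EuclideanSpace ℝ (Fin d)) 1, (‖u x‖ₑ +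
          ‖(Metric.closedBall 0 1).indicator (fun _ => (1 : ℝ)) x‖ₑ * ‖u x - c‖ₑ) := by
        refine setLIntegral_mono' hB fun x hx => ?_
        rw [indicator_of_mem hx, enorm_one, one_mul]
        have e : c = u x - (u x - c) := by abel
        conv_lhs => rw [e]
        exact enorm_sub_le
    _ ≤ _ := by
        rw [lintegral_add_left hum.enorm]
        refine add_le_add le_rfl (key.trans (le_of_eq ?_))
        rw [ballConst]
        ring

/-! ### The field on annuli -/

/-- A segment between points close to `p` and `w` stays away from the origin if `p` and `w` do and
the angle between them is at most a right angle. -/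
theorem quarter_le_norm_add_smul_sub {E : Type*} [NormedAddCommGroup E] [InnerProductSpace ℝ E]
    {R : ℝ} (hR : 0 ≤ R) {p w x y : E} (hp : R ≤ ‖p‖) (hw : R ≤ ‖w‖) (hpw : 0 ≤ inner ℝ p w)
    (hx : ‖x - p‖ ≤ R / 4) (hy : ‖y - w‖ ≤ R / 4) {s : ℝ} (hs : s ∈ Icc (0 : ℝ) 1) :
    R / 4 ≤ ‖x + s • (y - x)‖ := by
  have hs0 := hs.1
  have hs1 : 0 ≤ 1 - s := by linarith [hs.2]
  have e : x + s • (y - x) = ((1 - s) • p + s • w) - ((1 - s) • (p - x) + s • (w - y)) := by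
    module
  have h1 : ‖(1 - s) • (p - x) + s • (w - y)‖ ≤ R / 4 := by
    refine (norm_add_le _ _).trans ?_
    rw [norm_smul, norm_smul, Real.norm_of_nonneg hs0, Real.norm_of_nonneg hs1,
      norm_sub_rev p, norm_sub_rev w]
    nlinarith
  -- the squared norm is at least `((1 - s)² + s²) R² ≥ R² / 2`
  have h2 : R / 2 ≤ ‖(1 - s) • p + s • w‖ := by
    refine le_of_sq_le_sq ?_ (norm_nonneg _)
    rw [norm_add_sq_real, norm_smul, norm_smul, Real.norm_of_nonneg hs0, Real.norm_of_nonneg hs1,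
      real_inner_smul_left, real_inner_smul_right]
    have a1 : ((1 - s) * R) ^ 2 ≤ ((1 - s) * ‖p‖) ^ 2 := by gcongr
    have a2 : (s * R) ^ 2 ≤ (s * ‖w‖) ^ 2 := by gcongr
    have a3 : 0 ≤ (1 - s) * (s * inner ℝ p w) := by positivity
    nlinarith [mul_nonneg (sq_nonneg (2 * s - 1)) (sq_nonneg R)]
  rw [e]
  have := norm_sub_norm_le ((1 - s) • p + s • w) ((1 - s) • (p - x) + s • (w - y))
  linarith

/-- On the annulus `R ≤ |x| ≤ ΛR` the field `u` is close to its average over a ball of radius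
`R / 4` centred on the sphere of radius `R`, with an error that only sees the gradient far from the
origin. In dimension at least two, points of the annulus are joined to that ball by pairs of
segments that avoid the ball of radius `R / 4`; in dimension one, a field without divergence is
constant. -/
theorem HasWeakGradient.setLIntegral_annulus_mul_sub_average_le (hd : 1 ≤ d)
    {q q' : ℝ≥0∞} (hq : ENNReal.HolderConjugate q q')
    {u : EuclideanSpace ℝ (Fin d) → EuclideanSpace ℝ (Fin d)}
    {G : EuclideanSpace ℝ (Fin d) → EuclideanSpace ℝ (Fin d) →L[ℝ] EuclideanSpace ℝ (Fin d)}
    (h : HasWeakGradient u G) (hum : StronglyMeasurable u) (hGm : StronglyMeasurable G)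
    (htr : ∀ᵐ x, ∑ i, G x (EuclideanSpace.single i 1) i = 0)
    {f : EuclideanSpace ℝ (Fin d) → ℝ} (hf : StronglyMeasurable f)
    {Λ R : ℝ} (hΛ : 1 ≤ Λ) (hR : 0 < R) :
    ∫⁻ x in Metric.closedBall 0 (Λ * R) \ Metric.ball 0 R, ‖f x‖ₑ *
        ‖u x - ⨍ y in Metric.closedBall (R • EuclideanSpace.single ⟨0, hd⟩ (1 : ℝ)) (R / 4), u y‖ₑ
      ≤ 2 * averageConst d (4 * (Λ + 2)) * ENNReal.ofReal (R / 4) *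
        (eLpNorm f q volume * eLpNorm ((Metric.ball 0 (R / 4))ᶜ.indicator G) q' volume) := by
  set p : EuclideanSpace ℝ (Fin d) := R • EuclideanSpace.single ⟨0, hd⟩ (1 : ℝ) with hpdef
  have hpn : ‖p‖ = R := by
    simp [hpdef, norm_smul, abs_of_pos hR]
  set A : Set (EuclideanSpace ℝ (Fin d)) := Metric.closedBall 0 (Λ * R) \ Metric.ball 0 R
  have hAm : MeasurableSet A :=
    Metric.isClosed_closedBall.measurableSet.diff Metric.isOpen_ball.measurableSet
  have hk : 0 ≤ 4 * (Λ + 2) := by positivity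
  have hr : 0 < R / 4 := by positivity
  have hkr : 4 * (Λ + 2) * (R / 4) = (Λ + 2) * R := by ring
  have hle {w : EuclideanSpace ℝ (Fin d)} (hw : ‖w‖ = R) :
      ‖w‖ + R / 4 ≤ 4 * (Λ + 2) * (R / 4) := by
    rw [hkr, hw]; nlinarith
  have hAk : A ⊆ Metric.closedBall 0 (4 * (Λ + 2) * (R / 4)) := by
    refine sdiff_subset.trans (Metric.closedBall_subset_closedBall ?_)
    rw [hkr]; nlinarith
  -- if `d = 1`, the gradient equals its trace and vanishes
  rcases hd.eq_or_lt with hd1 | hd2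
  · have hG : ∀ᵐ x, univ.indicator G x = 0 := by
      subst hd1
      filter_upwards [htr] with x hx
      rw [indicator_univ]
      ext w i
      have hw : w = w 0 • EuclideanSpace.single 0 (1 : ℝ) := by
        ext j; fin_cases j; simp
      rw [hw, map_smul]
      fin_cases i
      simpa using Or.inr hx
    have key := h.setLIntegral_mul_sub_ballAverage_le hq hum hGm hf hAm MeasurableSet.univ hk hr
      (hle hpn) (hle hpn) hAk (fun _ _ _ _ _ _ => mem_univ _) (fun _ _ _ _ _ _ => mem_univ _)
    have hG0 : eLpNorm (univ.indicator G) q' volume = 0 := by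
      have : ∀ᵐ x, ‖univ.indicator G x‖ = ‖(0 : ℝ)‖ := hG.mono fun x hx =>
        (norm_eq_zero.2 hx).trans norm_zero.symm
      rw [eLpNorm_congr_norm_ae this]
      simp
    refine key.trans ?_
    rw [hG0, mul_zero, mul_zero]
    exact zero_le
  · have hZm : MeasurableSet (Metric.ball (0 : EuclideanSpace ℝ (Fin d)) (R / 4))ᶜ :=
      Metric.isOpen_ball.measurableSet.compl
    -- the intermediate ball is centred at `± R e`, with `e` orthogonal to `p` and the sign chosen
    -- according to the half space that contains `x`
    set e : EuclideanSpace ℝ (Fin d) := EuclideanSpace.single ⟨1, hd2⟩ (1 : ℝ)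
    set S : ℝ → Set (EuclideanSpace ℝ (Fin d)) := fun σ => A ∩ {x | 0 ≤ inner ℝ x (σ • e)}
    have hSm (σ) : MeasurableSet (S σ) := hAm.inter
      (measurableSet_le measurable_const (by fun_prop))
    have key {σ : ℝ} (hσ : |σ| = R) := by
      have hn : ‖σ • e‖ = R := by simp [e, norm_smul, hσ]
      have hpe : inner ℝ (σ • e) p = 0 := by
        simp [hpdef, e, real_inner_smul_left, real_inner_smul_right,
            EuclideanSpace.inner_single_left]
      refine h.setLIntegral_mul_sub_ballAverage_le hq hum hGm hf (hSm σ) hZm hk hr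
        (m := σ • e) (p := p) (hle hn) (hle hpn) (inter_subset_left.trans hAk) ?_ ?_
      · intro x hx y hy s hs
        rw [mem_compl_iff, mem_ball_zero_iff, not_lt]
        refine quarter_le_norm_add_smul_sub hR.le (p := x) (w := σ • e) ?_ hn.ge hx.2 ?_ ?_ hs
        · simpa using hx.1.2
        · simpa using hr.le
        · simpa [dist_eq_norm] using hy
      · intro x hx y hy s hs
        rw [mem_compl_iff, mem_ball_zero_iff, not_lt]
        refine quarter_le_norm_add_smul_sub hR.le (p := σ • e) (w := p) hn.ge hpn.ge hpe.ge ?_ ?_ hs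
        · simpa [dist_eq_norm] using hx
        · simpa [dist_eq_norm] using hy
    have hcover : A ⊆ S R ∪ S (-R) := by
      intro x hx
      rcases le_total 0 (inner ℝ x (R • e)) with h0 | h0
      · exact Or.inl ⟨hx, h0⟩
      · refine Or.inr ⟨hx, ?_⟩
        simpa [inner_neg_right] using h0
    refine (lintegral_mono_set hcover).trans ((lintegral_union_le _ _ _).trans ?_)
    refine (add_le_add (key (abs_of_pos hR)) (key (by rw [abs_neg, abs_of_pos hR]))).trans
      (le_of_eq ?_)
    ring

theorem mollify_rescaledKernel_eq {ρ : EuclideanSpace ℝ (Fin d) → ℝ} {ε : ℝ} (hε : 0 < ε)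
    (a : EuclideanSpace ℝ (Fin d) → ℝ) (x : EuclideanSpace ℝ (Fin d)) :
    mollify (rescaledKernel ρ ε) a x = ∫ z, a (x - ε • z) * ρ z := by
  rw [mollify, integral_eq_smul_integral_sub_smul _ hε x, ← integral_smul]
  refine integral_congr_ae (Eventually.of_forall fun z => ?_)
  have hε' : ε ^ d ≠ 0 := (pow_pos hε d).ne'
  simp only [rescaledKernel, sub_sub_cancel, smul_eq_mul, inv_smul_smul₀ hε.ne']
  field_simp

theorem enorm_mollify_rescaledKernel_le {ρ : EuclideanSpace ℝ (Fin d) → ℝ} {ε : ℝ} (hε : 0 < ε)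
    (a : EuclideanSpace ℝ (Fin d) → ℝ) (x : EuclideanSpace ℝ (Fin d)) :
    ‖mollify (rescaledKernel ρ ε) a x‖ₑ ≤ ∫⁻ z, ‖ρ z‖ₑ * ‖a (x - ε • z)‖ₑ := by
  rw [mollify_rescaledKernel_eq hε]
  refine (enorm_integral_le_lintegral_enorm _).trans (le_of_eq ?_)
  simp only [enorm_mul, mul_comm]

/-- The estimate on the annulus for a mollified weight, uniform in the scale of mollification. -/
theorem HasWeakGradient.setLIntegral_annulus_mollify_mul_le (hd : 1 ≤ d)
    {q q' : ℝ≥0∞} (hq : ENNReal.HolderConjugate q q')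
    {u : EuclideanSpace ℝ (Fin d) → EuclideanSpace ℝ (Fin d)}
    {G : EuclideanSpace ℝ (Fin d) → EuclideanSpace ℝ (Fin d) →L[ℝ] EuclideanSpace ℝ (Fin d)}
    (h : HasWeakGradient u G) (hum : StronglyMeasurable u) (hGm : StronglyMeasurable G)
    (htr : ∀ᵐ x, ∑ i, G x (EuclideanSpace.single i 1) i = 0)
    {a : EuclideanSpace ℝ (Fin d) → ℝ} (ha : StronglyMeasurable a)
    {ρ : EuclideanSpace ℝ (Fin d) → ℝ} (hρ : Continuous ρ) (hρs : ∀ z, ρ z ≠ 0 → ‖z‖ ≤ 1)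
    {ε : ℝ} (hε : 0 < ε) (hε1 : ε ≤ 1) {Λ R : ℝ} (hΛ : 1 ≤ Λ) (hR : 2 ≤ R) :
    ∫⁻ x in Metric.closedBall 0 (Λ * R) \ Metric.ball 0 R, ‖mollify (rescaledKernel ρ ε) a x‖ₑ *
        ‖u x - ⨍ y in Metric.closedBall (R • EuclideanSpace.single ⟨0, hd⟩ (1 : ℝ)) (R / 4), u y‖ₑ
      ≤ (∫⁻ z, ‖ρ z‖ₑ) * (2 * averageConst d (4 * (Λ + 2)) * ENNReal.ofReal (R / 4) *
        (eLpNorm ((Metric.ball 0 (R / 4))ᶜ.indicator a) q volume *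
          eLpNorm ((Metric.ball 0 (R / 4))ᶜ.indicator G) q' volume)) := by
  set c := ⨍ y in Metric.closedBall (R • EuclideanSpace.single ⟨0, hd⟩ (1 : ℝ)) (R / 4), u y
  set A : Set (EuclideanSpace ℝ (Fin d)) := Metric.closedBall 0 (Λ * R) \ Metric.ball 0 R
  set N := 2 * averageConst d (4 * (Λ + 2)) * ENNReal.ofReal (R / 4) *
        (eLpNorm ((Metric.ball 0 (R / 4))ᶜ.indicator a) q volume *
          eLpNorm ((Metric.ball 0 (R / 4))ᶜ.indicator G) q' volume)
  have hZm : MeasurableSet (Metric.ball (0 : EuclideanSpace ℝ (Fin d)) (R / 4))ᶜ :=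
    Metric.isOpen_ball.measurableSet.compl
  have hAm : MeasurableSet A :=
    Metric.isClosed_closedBall.measurableSet.diff Metric.isOpen_ball.measurableSet
  have huc : Measurable fun x => ‖u x - c‖ₑ := (hum.sub stronglyMeasurable_const).enorm
  have haz : Measurable fun p : EuclideanSpace ℝ (Fin d) × EuclideanSpace ℝ (Fin d) =>
      ‖ρ p.2‖ₑ * ‖a (p.1 - ε • p.2)‖ₑ :=
    (hρ.measurable.comp measurable_snd).enorm.mul
      (ha.comp_measurable (g := fun p : EuclideanSpace ℝ (Fin d) × EuclideanSpace ℝ (Fin d) =>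
        p.1 - ε • p.2) (by fun_prop)).enorm
  calc _ ≤ ∫⁻ x in A, ∫⁻ z, ‖ρ z‖ₑ * ‖a (x - ε • z)‖ₑ * ‖u x - c‖ₑ := by
        refine lintegral_mono fun x => ?_
        rw [lintegral_mul_const' _ _ enorm_ne_top]
        exact mul_le_mul' (enorm_mollify_rescaledKernel_le hε a x) le_rfl
    _ = ∫⁻ z, ‖ρ z‖ₑ * ∫⁻ x in A, ‖a (x - ε • z)‖ₑ * ‖u x - c‖ₑ := by
        rw [lintegral_lintegral_swap (haz.mul (huc.comp measurable_fst)).aemeasurable]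
        refine lintegral_congr fun z => ?_
        rw [← lintegral_const_mul' _ _ enorm_ne_top]
        simp only [mul_assoc]
    _ ≤ ∫⁻ z, ‖ρ z‖ₑ * N := by
        refine lintegral_mono fun z => ?_
        by_cases hz : ρ z = 0
        · simp [hz]
        refine mul_le_mul' le_rfl ?_
        have hz1 : ‖ε • z‖ ≤ 1 := by
          rw [norm_smul, Real.norm_of_nonneg hε.le]
          nlinarith [hρs z hz, norm_nonneg z]
        have key := h.setLIntegral_annulus_mul_sub_average_le hd hq hum hGm htr
          ((ha.indicator hZm).comp_measurable (measurable_sub_const (ε • z))) hΛ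
          (by linarith : 0 < R)
        have e : eLpNorm ((Metric.ball 0 (R / 4))ᶜ.indicator a ∘ fun x => x - ε • z) q volume
            = eLpNorm ((Metric.ball 0 (R / 4))ᶜ.indicator a) q volume :=
          eLpNorm_comp_measurePreserving (ha.indicator hZm).aestronglyMeasurable
            (measurePreserving_sub_right volume (ε • z))
        rw [e] at key
        refine le_trans (le_of_eq (setLIntegral_congr_fun hAm fun x hx => ?_)) key
        have hx1 : R ≤ ‖x‖ := by simpa using hx.2
        have : x - ε • z ∈ (Metric.ball (0 : EuclideanSpace ℝ (Fin d)) (R / 4))ᶜ := by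
          rw [mem_compl_iff, mem_ball_zero_iff, not_lt]
          linarith [norm_sub_norm_le x (ε • z)]
        simp only [Function.comp_apply, indicator_of_mem this, c]
    _ = _ := lintegral_mul_const _ hρ.measurable.enorm

/-! ### The moving frame and the vanishing errors -/

/-- The velocity of the moving frame at scale `R`: the average of `v(t)` over the ball of radius
`R / 4` centred at distance `R` from the origin. -/
noncomputable def frameVelocity (hd : 1 ≤ d)
    (v : ℝ → EuclideanSpace ℝ (Fin d) → EuclideanSpace ℝ (Fin d)) (R t : ℝ) :
    EuclideanSpace ℝ (Fin d) :=
  ⨍ y in Metric.closedBall (R • EuclideanSpace.single ⟨0, hd⟩ (1 : ℝ)) (R / 4), v t y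

namespace IsNormalizedSolution

variable {ν T : ℝ} {q q' : ℝ≥0∞}
  {v : ℝ → EuclideanSpace ℝ (Fin d) → EuclideanSpace ℝ (Fin d)}
  {G : ℝ → EuclideanSpace ℝ (Fin d) → EuclideanSpace ℝ (Fin d) →L[ℝ] EuclideanSpace ℝ (Fin d)}
  {a : ℝ → EuclideanSpace ℝ (Fin d) → ℝ}

theorem stronglyMeasurable_frameVelocity (h : IsNormalizedSolution ν T q q' v G a) (hd : 1 ≤ d)
    (R : ℝ) : StronglyMeasurable (frameVelocity hd v R) := by
  have : StronglyMeasurable fun t =>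
      ∫ y in Metric.closedBall (R • EuclideanSpace.single ⟨0, hd⟩ (1 : ℝ)) (R / 4), v t y :=
    h.v_meas.integral_prod_right
  have h2 := this.const_smul (volume.real
    (Metric.closedBall (R • EuclideanSpace.single (⟨0, hd⟩ : Fin d) (1 : ℝ)) (R / 4)))⁻¹
  refine (congrArg StronglyMeasurable (funext fun t => ?_)).mp h2
  rw [frameVelocity, setAverage_eq]
  rfl

theorem trace_ae_eq_zero (h : IsNormalizedSolution ν T q q' v G a) (t : ℝ) :
    ∀ᵐ x, ∑ i, G t x (EuclideanSpace.single i 1) i = 0 :=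
  (h.weakGradient t).trace_ae_eq_zero (h.divFree t)

/-- The velocity of the moving frame grows at most linearly with the scale. -/
theorem exists_enorm_frameVelocity_le (h : IsNormalizedSolution ν T q q' v G a) (hd : 1 ≤ d)
    (hq : ENNReal.HolderConjugate q q') :
    ∃ g : ℝ → ℝ≥0∞, ∫⁻ t in Icc 0 T, g t < ∞ ∧
      ∫⁻ t in Icc 0 T, eLpNorm (a t) q volume * g t < ∞ ∧
      ∀ R, 1 ≤ R → ∀ t, ‖frameVelocity hd v R t‖ₑ ≤ ENNReal.ofReal R * g t := by
  set V := volume (Metric.closedBall (0 : EuclideanSpace ℝ (Fin d)) 1)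
  have hV0 : V ≠ 0 := (Metric.measure_closedBall_pos volume 0 one_pos).ne'
  have hVt : V ≠ ∞ := (isCompact_closedBall 0 1).measure_lt_top.ne
  set κ : ℝ≥0∞ := averageConst d 5 * ballConst d q 1
  have hκ : κ ≠ ∞ := ENNReal.mul_ne_top (averageConst_lt_top d 5).ne (ballConst_lt_top d q 1).ne
  have hVi : V⁻¹ ≠ ∞ := ENNReal.inv_ne_top.2 hV0
  have hm : Measurable fun t => ∫⁻ x in Metric.closedBall 0 1, ‖v t x‖ₑ :=
    h.v_meas.enorm.lintegral_prod_right'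
  have hma := measurable_eLpNorm_slice h.a_meas (μ := volume) q
  refine ⟨fun t => V⁻¹ * ((∫⁻ x in Metric.closedBall 0 1, ‖v t x‖ₑ)
    + κ * eLpNorm (G t) q' volume), ?_, ?_, ?_⟩
  · rw [lintegral_const_mul' _ _ hVi, lintegral_add_left hm, lintegral_const_mul' _ _ hκ]
    have h1 := h.lintegral_v 1
    have h2 := h.lintegral_G
    finiteness
  · have e (t) : eLpNorm (a t) q volume * (V⁻¹ * ((∫⁻ x in Metric.closedBall 0 1, ‖v t x‖ₑ)
        + κ * eLpNorm (G t) q' volume)) = V⁻¹ * (eLpNorm (a t) q volume *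
          (∫⁻ x in Metric.closedBall 0 1, ‖v t x‖ₑ) +
          κ * (eLpNorm (a t) q volume * eLpNorm (G t) q' volume)) := by ring
    simp only [e]
    rw [lintegral_const_mul' _ _ hVi, lintegral_add_left (f := fun t => eLpNorm (a t) q volume *
        ∫⁻ x in Metric.closedBall 0 1, ‖v t x‖ₑ) (hma.mul hm),
      lintegral_const_mul' _ _ hκ]
    have h1 := h.lintegral_a_mul_v 1
    have h2 := h.lintegral_a_mul_G
    finiteness
  · intro R hR t
    have hR0 : 0 < R := by linarith
    have hpn : ‖R • EuclideanSpace.single (⟨0, hd⟩ : Fin d) (1 : ℝ)‖ = R := by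
      simp [norm_smul, abs_of_pos hR0]
    have key := (h.weakGradient t).mul_enorm_ballAverage_le hq (h.v_meas_slice t)
      (h.G_meas_slice t) (k := 5) (r := R / 4)
      (p := R • EuclideanSpace.single (⟨0, hd⟩ : Fin d) (1 : ℝ)) (by positivity)
      (by rw [hpn]; linarith) (by linarith)
    have h1R : 1 ≤ ENNReal.ofReal R := ENNReal.one_le_ofReal.2 hR
    calc ‖frameVelocity hd v R t‖ₑ = V⁻¹ * (V * ‖frameVelocity hd v R t‖ₑ) := by
          rw [← mul_assoc, ENNReal.inv_mul_cancel hV0 hVt, one_mul]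
      _ ≤ V⁻¹ * (ENNReal.ofReal R * (∫⁻ x in Metric.closedBall 0 1, ‖v t x‖ₑ) +
          κ * ENNReal.ofReal R * eLpNorm (G t) q' volume) := by
          refine mul_le_mul' le_rfl (key.trans (add_le_add ?_ ?_))
          · exact le_mul_of_one_le_left zero_le h1R
          · refine mul_le_mul' (mul_le_mul' le_rfl (ENNReal.ofReal_le_ofReal ?_)) le_rfl
            linarith
      _ = _ := by ring

/-- The product of the tails vanishes in the limit: one of the exponents `q`, `q'` is finite, and
the factor with this exponent has a vanishing tail. -/
theorem tendsto_lintegral_tail (h : IsNormalizedSolution ν T q q' v G a)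
    (hq : ENNReal.HolderConjugate q q') :
    Tendsto (fun R : ℝ => ∫⁻ t in Icc 0 T,
      eLpNorm ((Metric.ball 0 (R / 4))ᶜ.indicator (a t)) q volume *
        eLpNorm ((Metric.ball 0 (R / 4))ᶜ.indicator (G t)) q' volume) atTop (𝓝 0) := by
  have hZ (R : ℝ) : MeasurableSet (Metric.ball (0 : EuclideanSpace ℝ (Fin d)) R)ᶜ :=
    Metric.isOpen_ball.measurableSet.compl
  have hR4 : Tendsto (fun R : ℝ => R / 4) atTop atTop :=
    tendsto_id.atTop_div_const (by norm_num)
  have hle {F : Type _} [NormedAddCommGroup F] (f : EuclideanSpace ℝ (Fin d) → F) (R : ℝ)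
      (r : ℝ≥0∞) : eLpNorm ((Metric.ball 0 R)ᶜ.indicator f) r volume ≤ eLpNorm f r volume :=
    eLpNorm_indicator_le f
  have key := tendsto_lintegral_filter_of_dominated_convergence (μ := volume.restrict (Icc 0 T))
    (l := atTop) (F := fun (R : ℝ) t =>
      eLpNorm ((Metric.ball 0 (R / 4))ᶜ.indicator (a t)) q volume *
        eLpNorm ((Metric.ball 0 (R / 4))ᶜ.indicator (G t)) q' volume) (f := fun _ => 0)
    (fun t => eLpNorm (a t) q volume * eLpNorm (G t) q' volume)
    (Eventually.of_forall fun R => (measurable_eLpNorm_indicator h.a_meas (hZ _) q).mul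
      (measurable_eLpNorm_indicator h.G_meas (hZ _) q'))
    (Eventually.of_forall fun R => Eventually.of_forall fun t =>
      mul_le_mul' (hle _ _ _) (hle _ _ _))
    h.lintegral_a_mul_G.ne ?_
  · simpa using key
  · refine Eventually.of_forall fun t => ?_
    by_cases hqt : q = ∞
    · have hq't : q' ≠ ∞ := by
        rintro rfl
        have := hq.inv_add_inv_eq_one
        simp [hqt] at this
      have h1 := ((h.G_memLp t).tendsto_eLpNorm_indicator_compl_ball hq.symm.one_le hq't).comp hR4
      have h2 := ENNReal.Tendsto.const_mul h1 (Or.inr (h.a_memLp t).2.ne)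
      rw [mul_zero] at h2
      exact tendsto_of_tendsto_of_tendsto_of_le_of_le tendsto_const_nhds h2
        (fun _ => zero_le) (fun R => mul_le_mul' (hle _ _ _) le_rfl)
    · have h1 := ((h.a_memLp t).tendsto_eLpNorm_indicator_compl_ball hq.one_le hqt).comp hR4
      have h2 := ENNReal.Tendsto.mul_const h1 (Or.inr (h.G_memLp t).2.ne)
      rw [zero_mul] at h2
      exact tendsto_of_tendsto_of_tendsto_of_le_of_le tendsto_const_nhds h2
        (fun _ => zero_le) (fun R => mul_le_mul' le_rfl (hle _ _ _))

theorem measurable_lintegral_transportCommutator (h : IsNormalizedSolution ν T q q' v G a)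
    {K : EuclideanSpace ℝ (Fin d) → ℝ} (hK : IsTestFunction K) :
    Measurable fun t => ∫⁻ x, ‖transportCommutator K (v t) (a t) x‖ₑ := by
  have hm : StronglyMeasurable (fun p : (ℝ × EuclideanSpace ℝ (Fin d)) ×
      EuclideanSpace ℝ (Fin d) => a p.1.1 p.2 * fderiv ℝ K (p.1.2 - p.2)
        (v p.1.1 p.1.2 - v p.1.1 p.2)) := by
    have hm : Measurable (fun p : (ℝ × EuclideanSpace ℝ (Fin d)) × EuclideanSpace ℝ (Fin d) =>
      (p.1.1, p.2)) := (measurable_fst.comp measurable_fst).prodMk measurable_snd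
    refine (h.a_meas.comp_measurable hm).mul (StronglyMeasurable.clm_apply_fun ?_ ?_)
    · exact ((hK.1.continuous_fderiv (by simp)).comp (by fun_prop)).stronglyMeasurable
    · exact (h.v_meas.comp_measurable measurable_fst).sub (h.v_meas.comp_measurable hm)
  exact (hm.integral_prod_right' (ν := volume)).enorm.lintegral_prod_right'

/-- The commutator of the transport operator and the mollification vanishes in the limit: at each
time by the continuity of translations, and in the time integral by domination. -/
theorem tendsto_lintegral_transportCommutator (h : IsNormalizedSolution ν T q q' v G a)
    (hq : ENNReal.HolderConjugate q q') {ρ : EuclideanSpace ℝ (Fin d) → ℝ}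
    (hρ : IsTestFunction ρ) (hρs : ∀ z, ρ z ≠ 0 → ‖z‖ ≤ 1) :
    Tendsto (fun ε : ℝ => ∫⁻ t in Icc 0 T, ∫⁻ x,
      ‖transportCommutator (rescaledKernel ρ ε) (v t) (a t) x‖ₑ) (𝓝[>] 0) (𝓝 0) := by
  set C : ℝ≥0∞ := ∫⁻ z, ‖fderiv ℝ ρ z‖ₑ * ‖z‖ₑ
  have hC : C ≠ ∞ := by
    have hd : Continuous (fderiv ℝ ρ) := hρ.1.continuous_fderiv (by simp)
    have : Integrable (fun z => ‖fderiv ℝ ρ z‖ * ‖z‖) volume :=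
      (hd.norm.mul continuous_norm).integrable_of_hasCompactSupport
        ((hρ.2.fderiv (𝕜 := ℝ)).norm.mul_right)
    simpa [HasFiniteIntegral, enorm_mul] using this.2.ne
  have key := tendsto_lintegral_filter_of_dominated_convergence (μ := volume.restrict (Icc 0 T))
    (l := 𝓝[>] (0 : ℝ)) (F := fun ε t => ∫⁻ x,
      ‖transportCommutator (rescaledKernel ρ ε) (v t) (a t) x‖ₑ) (f := fun _ => 0)
    (fun t => C * (2 * (eLpNorm (a t) q volume * eLpNorm (G t) q' volume))) ?_ ?_ ?_ ?_
  · simpa using key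
  · filter_upwards [self_mem_nhdsWithin] with ε hε
    exact h.measurable_lintegral_transportCommutator (hρ.rescaledKernel hε)
  · filter_upwards [self_mem_nhdsWithin] with ε hε
    refine Eventually.of_forall fun t => lintegral_transportCommutator_le hρ hρs hε
      (h.weakGradient t) (h.v_meas_slice t) (h.G_meas_slice t) (h.trace_ae_eq_zero t)
      (h.a_meas_slice t) fun y k _ _ => ?_
    have hb (y k : EuclideanSpace ℝ (Fin d)) := lintegral_translate_mul_le (μ := volume) hq
      (h.a_meas_slice t).aestronglyMeasurable (h.G_meas_slice t).aestronglyMeasurable y k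
    have hm : Measurable fun x => ‖a t (x + y)‖ₑ * ‖G t (x + k)‖ₑ :=
      ((h.a_meas_slice t).comp_measurable (measurable_add_const y)).enorm.mul
        ((h.G_meas_slice t).comp_measurable (measurable_add_const k)).enorm
    calc ∫⁻ x, ‖a t (x + y) • G t (x + k) - a t x • G t x‖ₑ
        ≤ ∫⁻ x, (‖a t (x + y)‖ₑ * ‖G t (x + k)‖ₑ + ‖a t (x + 0)‖ₑ * ‖G t (x + 0)‖ₑ) := by
          refine lintegral_mono fun x => ?_
          rw [add_zero, ← enorm_smul, ← enorm_smul]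
          exact enorm_sub_le
      _ ≤ _ := by
          rw [lintegral_add_left hm, two_mul]
          exact add_le_add (hb y k) (hb 0 0)
  · rw [lintegral_const_mul' _ _ hC, lintegral_const_mul' _ _ (by simp)]
    have := h.lintegral_a_mul_G
    finiteness
  · refine Eventually.of_forall fun t => ENNReal.tendsto_nhds_zero.2 fun δ hδ => ?_
    have hδ' : 0 < δ / C := ENNReal.div_pos hδ.ne' hC
    obtain ⟨r, hr, hrδ⟩ := Metric.eventually_nhds_iff.1 (ENNReal.tendsto_nhds_zero.1
      ((h.a_memLp t).tendsto_lintegral_translate_smul_sub hq (h.G_memLp t)) _ hδ')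
    filter_upwards [self_mem_nhdsWithin, nhdsWithin_le_nhds (Iio_mem_nhds hr)] with ε hε hεr
    refine (lintegral_transportCommutator_le hρ hρs hε
      (h.weakGradient t) (h.v_meas_slice t) (h.G_meas_slice t) (h.trace_ae_eq_zero t)
      (h.a_meas_slice t) (ω := δ / C) fun y k hy hk => ?_).trans ENNReal.mul_div_le
    refine hrδ (y := (y, k)) ?_
    rw [dist_zero_right, Prod.norm_def]
    exact (max_le hy hk).trans_lt hεr

/-- The mollified solution converges to the solution, locally in `L¹`. -/
theorem tendsto_lintegral_mollify_sub (h : IsNormalizedSolution ν T q q' v G a)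
    (hq : ENNReal.HolderConjugate q q') {ρ : EuclideanSpace ℝ (Fin d) → ℝ}
    (hρ : IsTestFunction ρ) (hρs : ∀ z, ρ z ≠ 0 → ‖z‖ ≤ 1) (hρ1 : ∫ z, ρ z = 1) (R : ℝ) :
    Tendsto (fun ε : ℝ => ∫⁻ t in Icc 0 T, ∫⁻ x in Metric.closedBall 0 R,
      ‖mollify (rescaledKernel ρ ε) (a t) x - a t x‖ₑ) (𝓝[>] 0) (𝓝 0) := by
  set C : ℝ≥0∞ := ∫⁻ z, ‖ρ z‖ₑ
  have hC : C ≠ ∞ := hρ.integrable.2.ne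
  set B : Set (EuclideanSpace ℝ (Fin d)) := Metric.closedBall 0 R
  have hB : MeasurableSet B := Metric.isClosed_closedBall.measurableSet
  set g : EuclideanSpace ℝ (Fin d) → ℝ := B.indicator fun _ => 1
  have hgm : StronglyMeasurable g := stronglyMeasurable_const.indicator hB
  have hgq : MemLp g q' volume := ⟨hgm.aestronglyMeasurable, ballConst_lt_top d q' R⟩
  -- a bound by the translations of `a`, localized to the ball
  have main (t) {ε : ℝ} (hε : 0 < ε) {ω : ℝ≥0∞}
      (hω : ∀ y : EuclideanSpace ℝ (Fin d), ‖y‖ ≤ ε →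
        ∫⁻ x, ‖a t (x + y) • g (x + 0) - a t x • g x‖ₑ ≤ ω) :
      ∫⁻ x in B, ‖mollify (rescaledKernel ρ ε) (a t) x - a t x‖ₑ ≤ C * ω := by
    have hat := h.a_meas_slice t
    have hm : Measurable (Function.uncurry fun x z : EuclideanSpace ℝ (Fin d) =>
        ‖ρ z‖ₑ * ‖a t (x - ε • z) - a t x‖ₑ) :=
      (hρ.continuous.measurable.comp measurable_snd).enorm.mul
        ((hat.comp_measurable (g := fun p : EuclideanSpace ℝ (Fin d) × EuclideanSpace ℝ (Fin d) =>
          p.1 - ε • p.2) (by fun_prop)).sub (hat.comp_measurable measurable_fst)).enorm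
    calc _ ≤ ∫⁻ x in B, ∫⁻ z, ‖ρ z‖ₑ * ‖a t (x - ε • z) - a t x‖ₑ := by
          refine lintegral_mono fun x => ?_
          have hi : Integrable fun z => a t (x - ε • z) * ρ z := by
            have h1 := ((integrable_mul_comp_sub (hρ.rescaledKernel hε)
              (h.a_locInt hq t) x).comp_sub_left x).comp_smul hε.ne'
            have h2 := h1.const_mul (ε ^ d)
            refine h2.congr (Eventually.of_forall fun z => ?_)
            have hε' : ε ^ d ≠ 0 := (pow_pos hε d).ne'
            simp only [rescaledKernel, sub_sub_cancel, inv_smul_smul₀ hε.ne']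
            field_simp
          have e : mollify (rescaledKernel ρ ε) (a t) x - a t x
              = ∫ z, (a t (x - ε • z) * ρ z - a t x * ρ z) := by
            rw [mollify_rescaledKernel_eq hε, integral_sub hi (hρ.integrable.const_mul _),
              integral_const_mul, hρ1, mul_one]
          rw [e]
          refine (enorm_integral_le_lintegral_enorm _).trans (le_of_eq ?_)
          refine lintegral_congr fun z => ?_
          rw [← sub_mul, enorm_mul, mul_comm]
      _ = ∫⁻ z, ‖ρ z‖ₑ * ∫⁻ x in B, ‖a t (x - ε • z) - a t x‖ₑ := by
          rw [lintegral_lintegral_swap hm.aemeasurable]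
          refine lintegral_congr fun z => ?_
          rw [lintegral_const_mul' _ _ enorm_ne_top]
      _ ≤ ∫⁻ z, ‖ρ z‖ₑ * ω := by
          refine lintegral_mono fun z => ?_
          by_cases hz : ρ z = 0
          · simp [hz]
          refine mul_le_mul' le_rfl (le_trans ?_ (hω (-(ε • z)) ?_))
          · rw [← lintegral_indicator hB]
            refine lintegral_mono fun x => ?_
            by_cases hx : x ∈ B
            · simp [hx, g, sub_eq_add_neg]
            · simp [hx]
          · rw [norm_neg, norm_smul, Real.norm_of_nonneg hε.le]
            nlinarith [hρs z hz, norm_nonneg z]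
      _ = _ := lintegral_mul_const _ hρ.continuous.measurable.enorm
  have key := tendsto_lintegral_filter_of_dominated_convergence (μ := volume.restrict (Icc 0 T))
    (l := 𝓝[>] (0 : ℝ)) (F := fun ε t => ∫⁻ x in B,
      ‖mollify (rescaledKernel ρ ε) (a t) x - a t x‖ₑ) (f := fun _ => 0)
    (fun t => C * (2 * (eLpNorm (a t) q volume * ballConst d q' R))) ?_ ?_ ?_ ?_
  · simpa using key
  · filter_upwards [self_mem_nhdsWithin] with ε hε
    have hK := hρ.rescaledKernel (mem_Ioi.1 hε)
    exact ((h.stronglyMeasurable_mollify hK).sub h.a_meas).enorm.lintegral_prod_right'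
  · filter_upwards [self_mem_nhdsWithin] with ε hε
    refine Eventually.of_forall fun t => main t hε fun y _ => ?_
    have hb (y k : EuclideanSpace ℝ (Fin d)) := lintegral_translate_mul_le (μ := volume) hq
      (h.a_meas_slice t).aestronglyMeasurable hgm.aestronglyMeasurable y k
    have hm : Measurable fun x => ‖a t (x + y)‖ₑ * ‖g (x + 0)‖ₑ :=
      ((h.a_meas_slice t).comp_measurable (measurable_add_const y)).enorm.mul
        (hgm.comp_measurable (measurable_add_const 0)).enorm
    calc ∫⁻ x, ‖a t (x + y) • g (x + 0) - a t x • g x‖ₑ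
        ≤ ∫⁻ x, (‖a t (x + y)‖ₑ * ‖g (x + 0)‖ₑ + ‖a t (x + 0)‖ₑ * ‖g (x + 0)‖ₑ) := by
          refine lintegral_mono fun x => ?_
          rw [add_zero x, ← enorm_smul, ← enorm_smul]
          exact enorm_sub_le
      _ ≤ _ := by
          rw [lintegral_add_left hm, two_mul]
          exact add_le_add (hb y 0) (hb 0 0)
  · rw [lintegral_const_mul' _ _ hC, lintegral_const_mul' _ _ (by simp),
      lintegral_mul_const' _ _ (ballConst_lt_top d q' R).ne]
    have h1 := h.lintegral_a
    have h2 := ballConst_lt_top d q' R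
    finiteness
  · refine Eventually.of_forall fun t => ENNReal.tendsto_nhds_zero.2 fun δ hδ => ?_
    have hδ' : 0 < δ / C := ENNReal.div_pos hδ.ne' hC
    obtain ⟨r, hr, hrδ⟩ := Metric.eventually_nhds_iff.1 (ENNReal.tendsto_nhds_zero.1
      ((h.a_memLp t).tendsto_lintegral_translate_smul_sub hq hgq) _ hδ')
    filter_upwards [self_mem_nhdsWithin, nhdsWithin_le_nhds (Iio_mem_nhds hr)] with ε hε hεr
    refine (main t hε (ω := δ / C) fun y hy => ?_).trans ENNReal.mul_div_le
    refine hrδ (y := (y, 0)) ?_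
    rw [dist_zero_right, Prod.norm_def]
    simpa using hy.trans_lt hεr

end IsNormalizedSolution

/-! ### The recursive bound for the mass on balls -/

theorem ContDiff.laplacian_comp_smul {f : EuclideanSpace ℝ (Fin d) → ℝ}
    (hf : ContDiff ℝ ((⊤ : ℕ∞) : WithTop ℕ∞) f) (c : ℝ) (x : EuclideanSpace ℝ (Fin d)) :
    (Δ (fun y => f (c • y))) x = c ^ 2 * (Δ f) (c • x) := by
  have hc : ContDiff ℝ ((⊤ : ℕ∞) : WithTop ℕ∞) (fun y => f (c • y)) :=
    hf.comp (contDiff_const_smul c)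
  rw [hc.laplacian_eq_sum_fderiv, hf.laplacian_eq_sum_fderiv, Finset.mul_sum]
  refine Finset.sum_congr rfl fun i _ => ?_
  have e (g : EuclideanSpace ℝ (Fin d) → ℝ) (y) :
      fderiv ℝ (fun y => g (c • y)) y = c • fderiv ℝ g (c • y) := fderiv_comp_smul c
  have e1 : (fun y => fderiv ℝ (fun y => f (c • y)) y (EuclideanSpace.single i 1))
      = fun y => c • (fun z => fderiv ℝ f z (EuclideanSpace.single i 1)) (c • y) := by
    funext y; rw [e]; rfl
  rw [e1, fderiv_fun_const_smul, e (fun z => fderiv ℝ f z (EuclideanSpace.single i 1))]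
  · simp only [_root_.smul_apply, smul_eq_mul]; ring
  · exact ((hf.fderiv_apply_const _).comp (contDiff_const_smul c)).differentiable (by simp) x

/-- Cutoff functions at scale `R`, equal to one on the ball of radius `(L + 1) R` and supported in
the ball of radius `(L + 2) R`. -/
theorem exists_cutoff (d : ℕ) {L : ℝ} (hL : 0 ≤ L) :
    ∃ C : ℝ≥0∞, C ≠ ∞ ∧ ∀ R : ℝ, 0 < R → ∃ χ : EuclideanSpace ℝ (Fin d) → ℝ,
      IsTestFunction χ ∧ (∀ x, 0 ≤ χ x) ∧ (∀ x, χ x ≤ 1) ∧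
      (∀ x, ‖x‖ ≤ (L + 1) * R → χ x = 1) ∧
      (∀ x, ‖fderiv ℝ χ x‖ₑ ≤ C * ENNReal.ofReal R⁻¹) ∧
      (∀ x, fderiv ℝ χ x ≠ 0 → (L + 1) * R ≤ ‖x‖ ∧ ‖x‖ ≤ (L + 2) * R) ∧
      (∀ x, ‖(Δ χ) x‖ₑ ≤ C * ENNReal.ofReal (R⁻¹ ^ 2)) ∧
      (∀ x, (Δ χ) x ≠ 0 → ‖x‖ ≤ (L + 2) * R) := by
  let χ₀ : ContDiffBump (0 : EuclideanSpace ℝ (Fin d)) :=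
    ⟨L + 1, L + 2, by positivity, by linarith⟩
  have hχ₀ : IsTestFunction (χ₀ : EuclideanSpace ℝ (Fin d) → ℝ) :=
    ⟨χ₀.contDiff, χ₀.hasCompactSupport⟩
  obtain ⟨C₁, hC₁, M₁, h₁⟩ := (hχ₀.2.fderiv (𝕜 := ℝ)).exists_enorm_le_indicator
    (hχ₀.1.continuous_fderiv (by simp))
  obtain ⟨C₂, hC₂, M₂, h₂⟩ := hχ₀.laplacian.2.exists_enorm_le_indicator hχ₀.laplacian.continuous
  refine ⟨max C₁ C₂, by simp [hC₁, hC₂], fun R hR => ?_⟩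
  have hR' : 0 < R⁻¹ := inv_pos.2 hR
  have hn (x : EuclideanSpace ℝ (Fin d)) : ‖R⁻¹ • x‖ = R⁻¹ * ‖x‖ := by
    rw [norm_smul, Real.norm_of_nonneg hR'.le]
  have hone : ∀ x : EuclideanSpace ℝ (Fin d), ‖x‖ ≤ (L + 1) * R → χ₀ (R⁻¹ • x) = 1 := by
    intro x hx
    refine χ₀.one_of_mem_closedBall ?_
    rw [mem_closedBall_zero_iff, hn, inv_mul_le_iff₀ hR, mul_comm]
    exact hx
  have hzero : ∀ x : EuclideanSpace ℝ (Fin d), (L + 2) * R < ‖x‖ → χ₀ (R⁻¹ • x) = 0 := by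
    intro x hx
    refine χ₀.zero_of_le_dist ?_
    rw [dist_zero_right, hn, le_inv_mul_iff₀ hR, mul_comm]
    exact hx.le
  have hout (x : EuclideanSpace ℝ (Fin d)) (hx : (L + 2) * R < ‖x‖) :
      (fun y : EuclideanSpace ℝ (Fin d) => χ₀ (R⁻¹ • y)) =ᶠ[𝓝 x] fun _ => 0 := by
    filter_upwards [(isOpen_lt continuous_const continuous_norm).mem_nhds hx] with y hy
    exact hzero y hy
  refine ⟨fun x => χ₀ (R⁻¹ • x), ⟨hχ₀.1.comp (contDiff_const_smul R⁻¹),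
    hχ₀.2.comp_smul hR'.ne'⟩, fun x => χ₀.nonneg, fun x => χ₀.le_one, hone, fun x => ?_,
    fun x hx => ⟨?_, ?_⟩, fun x => ?_, fun x hx => ?_⟩
  · have e : fderiv ℝ (fun y : EuclideanSpace ℝ (Fin d) => χ₀ (R⁻¹ • y)) x
        = R⁻¹ • fderiv ℝ χ₀ (R⁻¹ • x) := fderiv_comp_smul R⁻¹
    rw [e, enorm_smul, mul_comm, Real.enorm_of_nonneg hR'.le]
    exact mul_le_mul' (((h₁ _).trans (indicator_le_self _ _ _)).trans (le_max_left _ _)) le_rfl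
  · by_contra hlt
    refine hx ?_
    have : (fun y : EuclideanSpace ℝ (Fin d) => χ₀ (R⁻¹ • y)) =ᶠ[𝓝 x] fun _ => 1 := by
      filter_upwards [(isOpen_lt continuous_norm continuous_const).mem_nhds (not_le.1 hlt)]
        with y hy
      exact hone y (le_of_lt hy)
    rw [this.fderiv_eq]
    simp
  · by_contra hlt
    refine hx ?_
    rw [(hout x (not_le.1 hlt)).fderiv_eq]
    simp
  · rw [hχ₀.1.laplacian_comp_smul, enorm_mul, mul_comm, Real.enorm_of_nonneg (sq_nonneg R⁻¹)]
    exact mul_le_mul' (((h₂ _).trans (indicator_le_self _ _ _)).trans (le_max_right _ _)) le_rfl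
  · by_contra hlt
    refine hx ?_
    rw [(InnerProductSpace.laplacian_congr_nhds (hout x (not_le.1 hlt))).eq_of_nhds,
      ContDiff.laplacian_eq_sum_fderiv contDiff_const]
    simp

/-- The mass of `smoothAbs` of the mollified solution on the ball of radius `R`. -/
noncomputable def smoothMass (T : ℝ) (K : EuclideanSpace ℝ (Fin d) → ℝ)
    (a : ℝ → EuclideanSpace ℝ (Fin d) → ℝ) (R : ℝ) : ℝ≥0∞ :=
  ∫⁻ t in Icc 0 T, ∫⁻ x in Metric.closedBall 0 R, ‖smoothAbs (mollify K (a t) x)‖ₑ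

/-- The product of the tails of the solution and of the gradient of the velocity at scale `R`. -/
noncomputable def tailMass (T : ℝ) (q q' : ℝ≥0∞)
    (G : ℝ → EuclideanSpace ℝ (Fin d) → EuclideanSpace ℝ (Fin d) →L[ℝ] EuclideanSpace ℝ (Fin d))
    (a : ℝ → EuclideanSpace ℝ (Fin d) → ℝ) (R : ℝ) : ℝ≥0∞ :=
  ∫⁻ t in Icc 0 T, eLpNorm ((Metric.ball 0 (R / 4))ᶜ.indicator (a t)) q volume *
        eLpNorm ((Metric.ball 0 (R / 4))ᶜ.indicator (G t)) q' volume

theorem antitone_tailMass (T : ℝ) (q q' : ℝ≥0∞)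
    (G : ℝ → EuclideanSpace ℝ (Fin d) → EuclideanSpace ℝ (Fin d) →L[ℝ] EuclideanSpace ℝ (Fin d))
    (a : ℝ → EuclideanSpace ℝ (Fin d) → ℝ) : Antitone (tailMass T q q' G a) := by
  intro R R' hRR'
  have key {F : Type _} [NormedAddCommGroup F] (f : EuclideanSpace ℝ (Fin d) → F) (r : ℝ≥0∞) :
      eLpNorm ((Metric.ball 0 (R' / 4))ᶜ.indicator f) r volume
        ≤ eLpNorm ((Metric.ball 0 (R / 4))ᶜ.indicator f) r volume := by
    refine eLpNorm_mono fun x => ?_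
    exact norm_indicator_le_of_subset
      (compl_subset_compl.2 (Metric.ball_subset_ball (by linarith))) f x
  exact lintegral_mono fun t => mul_le_mul' (key _ _) (key _ _)

namespace IsNormalizedSolution

variable {ν T : ℝ} {q q' : ℝ≥0∞}
  {v : ℝ → EuclideanSpace ℝ (Fin d) → EuclideanSpace ℝ (Fin d)}
  {G : ℝ → EuclideanSpace ℝ (Fin d) → EuclideanSpace ℝ (Fin d) →L[ℝ] EuclideanSpace ℝ (Fin d)}
  {a : ℝ → EuclideanSpace ℝ (Fin d) → ℝ}

/-- The mass on a ball is controlled by the commutator, by the tails, and, with the small factor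
`R⁻²` due to the diffusion, by the mass on a ball whose radius is larger by a fixed factor. -/
theorem exists_smoothMass_le (h : IsNormalizedSolution ν T q q' v G a) (hd : 1 ≤ d)
    (hq : ENNReal.HolderConjugate q q') (hT : 0 < T) (hν : 0 ≤ ν)
    {ρ : EuclideanSpace ℝ (Fin d) → ℝ} (hρ : IsTestFunction ρ)
    (hρs : ∀ z, ρ z ≠ 0 → ‖z‖ ≤ 1) :
    ∃ Λ : ℝ, 1 ≤ Λ ∧ ∃ D : ℝ≥0∞, D ≠ ∞ ∧ ∀ ε, 0 < ε → ε ≤ 1 → ∀ R, 2 ≤ R →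
      smoothMass T (rescaledKernel ρ ε) a R
        ≤ D * ((∫⁻ t in Icc 0 T, ∫⁻ x,
            ‖transportCommutator (rescaledKernel ρ ε) (v t) (a t) x‖ₑ) + tailMass T q q' G a R)
          + D * ENNReal.ofReal (R⁻¹ ^ 2) * smoothMass T (rescaledKernel ρ ε) a (Λ * R) := by
  obtain ⟨g, hg, hag, hgc⟩ := h.exists_enorm_frameVelocity_le hd hq
  set L : ℝ := (∫⁻ t in Icc 0 T, g t).toReal
  have hL : 0 ≤ L := ENNReal.toReal_nonneg
  have hgL : ∫⁻ t in Icc 0 T, g t = ENNReal.ofReal L := (ENNReal.ofReal_toReal hg.ne).symm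
  obtain ⟨C, hC, hcut⟩ := exists_cutoff d hL
  -- the cutoff is supported in the ball of radius `(L + 2) R`, whose centre moves by at most `L R`
  set Λ : ℝ := 2 * L + 2
  have hΛ : 1 ≤ Λ := by simp only [Λ]; linarith
  set Cρ : ℝ≥0∞ := ∫⁻ z, ‖ρ z‖ₑ
  have hCρ : Cρ ≠ ∞ := hρ.integrable.2.ne
  set κ : ℝ≥0∞ := C * Cρ * (2 * averageConst d (4 * (Λ + 2)))
  have hκ : κ ≠ ∞ := by
    have := averageConst_lt_top d (4 * (Λ + 2))
    simp only [κ]; finiteness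
  refine ⟨Λ, hΛ, ENNReal.ofReal T * (1 + κ + ENNReal.ofReal ν * C), by finiteness,
    fun ε hε hε1 R hR => ?_⟩
  have hR0 : 0 < R := by linarith
  set K := rescaledKernel ρ ε
  have hK : IsTestFunction K := hρ.rescaledKernel hε
  obtain ⟨χ, hχ, hχ0, hχ1, hχone, hdχ, hdχs, hΔχ, hΔχs⟩ := hcut R hR0
  set c := frameVelocity hd v R
  have hcm : StronglyMeasurable c := h.stronglyMeasurable_frameVelocity hd R
  have hcR : ∀ t, ‖c t‖ₑ ≤ ENNReal.ofReal R * g t := hgc R (by linarith)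
  have hcL : ∫⁻ t in Icc 0 T, ‖c t‖ₑ ≤ ENNReal.ofReal (R * L) := by
    refine (lintegral_mono hcR).trans (le_of_eq ?_)
    rw [lintegral_const_mul' _ _ ENNReal.ofReal_ne_top, hgL, ENNReal.ofReal_mul hR0.le]
  have hci : IntegrableOn c (Icc 0 T) :=
    ⟨hcm.aestronglyMeasurable, hcL.trans_lt ENNReal.ofReal_lt_top⟩
  have hac : ∫⁻ t in Icc 0 T, eLpNorm (a t) q volume * ‖c t‖ₑ < ∞ := by
    have : ∫⁻ t in Icc 0 T, eLpNorm (a t) q volume * ‖c t‖ₑ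
        ≤ ∫⁻ t in Icc 0 T, ENNReal.ofReal R * (eLpNorm (a t) q volume * g t) := by
      refine lintegral_mono fun t => ?_
      rw [mul_left_comm]
      exact mul_le_mul' le_rfl (hcR t)
    rw [lintegral_const_mul' _ _ ENNReal.ofReal_ne_top] at this
    exact this.trans_lt (by finiteness)
  set X : ℝ → EuclideanSpace ℝ (Fin d) := fun t => ∫ s in Icc 0 t, c s
  have hX : ∀ t ∈ Icc 0 T, ‖X t‖ ≤ L * R := by
    intro t ht
    have h1 : ‖X t‖ₑ ≤ ENNReal.ofReal (R * L) :=
      (enorm_integral_le_lintegral_enorm _).trans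
        ((lintegral_mono_set (Icc_subset_Icc_right ht.2)).trans hcL)
    rw [← ofReal_norm, ENNReal.ofReal_le_ofReal_iff (by positivity)] at h1
    linarith
  have main := h.lintegral_smoothAbs_mul_cutoff_le hq hT hν hK hχ hχ0 hχ1 hcm hci hac
  have hmo := h.stronglyMeasurable_mollify hK
  set A : Set (EuclideanSpace ℝ (Fin d)) := Metric.closedBall 0 (Λ * R) \ Metric.ball 0 R
  have hA : MeasurableSet A :=
    Metric.isClosed_closedBall.measurableSet.diff Metric.isOpen_ball.measurableSet
  set B : ℝ → Set (EuclideanSpace ℝ (Fin d)) := fun R => Metric.closedBall 0 R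
  have hB (R : ℝ) : MeasurableSet (B R) := Metric.isClosed_closedBall.measurableSet
  have hleft : smoothMass T K a R ≤ ∫⁻ t in Icc 0 T, ∫⁻ x, ENNReal.ofReal
      (smoothAbs (mollify K (a t) x) * χ (x - X t)) := by
    refine setLIntegral_mono' measurableSet_Icc fun t ht => ?_
    rw [← lintegral_indicator (hB R)]
    refine lintegral_mono fun x => ?_
    by_cases hx : x ∈ B R
    · have hx' : ‖x‖ ≤ R := mem_closedBall_zero_iff.1 hx
      rw [indicator_of_mem hx, hχone _ (by linarith [norm_sub_le x (X t), hX t ht]), mul_one,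
        Real.enorm_of_nonneg (smoothAbs_nonneg _)]
    · rw [indicator_of_notMem hx]
      exact zero_le
  -- the flux relative to the moving frame lives in the annulus
  have hflux (t) (ht : t ∈ Icc 0 T) :
      ∫⁻ x, ‖mollify K (a t) x‖ₑ * (‖fderiv ℝ χ (x - X t)‖ₑ * ‖v t x - c t‖ₑ)
        ≤ κ * (eLpNorm ((Metric.ball 0 (R / 4))ᶜ.indicator (a t)) q volume *
          eLpNorm ((Metric.ball 0 (R / 4))ᶜ.indicator (G t)) q' volume) := by
    have hRR : ENNReal.ofReal R⁻¹ * ENNReal.ofReal (R / 4) ≤ 1 := by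
      rw [← ENNReal.ofReal_mul (by positivity), ENNReal.ofReal_le_one]
      have : R⁻¹ * (R / 4) = 1 / 4 := by field_simp
      rw [this]; norm_num
    calc _ ≤ ∫⁻ x in A, C * ENNReal.ofReal R⁻¹ * (‖mollify K (a t) x‖ₑ * ‖v t x - c t‖ₑ) := by
          rw [← lintegral_indicator hA]
          refine lintegral_mono fun x => ?_
          by_cases hx : fderiv ℝ χ (x - X t) = 0
          · have h0 : ‖fderiv ℝ χ (x - X t)‖ₑ = 0 := by
              rw [← ofReal_norm, norm_eq_zero.2 hx, ENNReal.ofReal_zero]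
            rw [h0, zero_mul, mul_zero]
            exact zero_le
          · obtain ⟨h1, h2⟩ := hdχs _ hx
            have hxA : x ∈ A := by
              have n1 := norm_sub_le x (X t)
              have n2 := norm_sub_norm_le x (X t)
              have n3 := hX t ht
              refine ⟨mem_closedBall_zero_iff.2 ?_, fun hb => ?_⟩
              · simp only [Λ]; nlinarith
              · rw [mem_ball_zero_iff] at hb; nlinarith
            rw [indicator_of_mem hxA, mul_left_comm]
            exact mul_le_mul' (hdχ _) le_rfl
      _ ≤ C * ENNReal.ofReal R⁻¹ * (Cρ * (2 * averageConst d (4 * (Λ + 2)) *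
            ENNReal.ofReal (R / 4) *
            (eLpNorm ((Metric.ball 0 (R / 4))ᶜ.indicator (a t)) q volume *
              eLpNorm ((Metric.ball 0 (R / 4))ᶜ.indicator (G t)) q' volume))) := by
          rw [lintegral_const_mul' _ _ (by finiteness)]
          exact mul_le_mul' le_rfl ((h.weakGradient t).setLIntegral_annulus_mollify_mul_le hd hq
            (h.v_meas_slice t) (h.G_meas_slice t) (h.trace_ae_eq_zero t) (h.a_meas_slice t)
            hρ.continuous hρs hε hε1 hΛ hR)
      _ = κ * (eLpNorm ((Metric.ball 0 (R / 4))ᶜ.indicator (a t)) q volume *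
            eLpNorm ((Metric.ball 0 (R / 4))ᶜ.indicator (G t)) q' volume) *
            (ENNReal.ofReal R⁻¹ * ENNReal.ofReal (R / 4)) := by ring
      _ ≤ _ := mul_le_of_le_one_right zero_le hRR
  have hdiff (t) (ht : t ∈ Icc 0 T) :
      ∫⁻ x, ‖smoothAbs (mollify K (a t) x)‖ₑ * ‖(Δ χ) (x - X t)‖ₑ
        ≤ C * ENNReal.ofReal (R⁻¹ ^ 2) *
          ∫⁻ x in B (Λ * R), ‖smoothAbs (mollify K (a t) x)‖ₑ := by
    rw [← lintegral_const_mul' _ _ (by finiteness), ← lintegral_indicator (hB _)]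
    refine lintegral_mono fun x => ?_
    by_cases hx : (Δ χ) (x - X t) = 0
    · simp [hx]
    · have hxB : x ∈ B (Λ * R) := by
        refine mem_closedBall_zero_iff.2 ?_
        have h2 := hΔχs _ hx
        have n2 := norm_sub_norm_le x (X t)
        have n3 := hX t ht
        simp only [Λ]; nlinarith
      rw [indicator_of_mem hxB, mul_comm]
      exact mul_le_mul' (hΔχ _) le_rfl
  have hmB : Measurable fun t => ∫⁻ x in B (Λ * R), ‖smoothAbs (mollify K (a t) x)‖ₑ :=
    ((contDiff_smoothAbs (n := 0)).continuous.comp_stronglyMeasurable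
      hmo).enorm.lintegral_prod_right'
  refine hleft.trans (main.trans ?_)
  calc _ ≤ ENNReal.ofReal T * ∫⁻ t in Icc 0 T,
        ((∫⁻ x, ‖transportCommutator K (v t) (a t) x‖ₑ)
        + κ * (eLpNorm ((Metric.ball 0 (R / 4))ᶜ.indicator (a t)) q volume *
          eLpNorm ((Metric.ball 0 (R / 4))ᶜ.indicator (G t)) q' volume)
        + ENNReal.ofReal ν * (C * ENNReal.ofReal (R⁻¹ ^ 2) *
          ∫⁻ x in B (Λ * R), ‖smoothAbs (mollify K (a t) x)‖ₑ)) := by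
        refine mul_le_mul' le_rfl (setLIntegral_mono' measurableSet_Icc fun t ht => ?_)
        exact add_le_add (add_le_add le_rfl (hflux t ht)) (mul_le_mul' le_rfl (hdiff t ht))
    _ = ENNReal.ofReal T * ((∫⁻ t in Icc 0 T, ∫⁻ x, ‖transportCommutator K (v t) (a t) x‖ₑ)
        + κ * tailMass T q q' G a R
        + ENNReal.ofReal ν * (C * ENNReal.ofReal (R⁻¹ ^ 2) * smoothMass T K a (Λ * R))) := by
        rw [lintegral_add_right _ ((hmB.const_mul _).const_mul _),
          lintegral_add_left (h.measurable_lintegral_transportCommutator hK),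
          lintegral_const_mul' _ _ hκ, lintegral_const_mul' _ _ ENNReal.ofReal_ne_top,
          lintegral_const_mul' _ _ (by finiteness)]
        rfl
    _ ≤ ENNReal.ofReal T * ((1 + κ + ENNReal.ofReal ν * C) *
          (∫⁻ t in Icc 0 T, ∫⁻ x, ‖transportCommutator K (v t) (a t) x‖ₑ)
        + (1 + κ + ENNReal.ofReal ν * C) * tailMass T q q' G a R
        + (1 + κ + ENNReal.ofReal ν * C) *
          (ENNReal.ofReal (R⁻¹ ^ 2) * smoothMass T K a (Λ * R))) := by
        refine mul_le_mul' le_rfl (add_le_add (add_le_add ?_ (mul_le_mul' ?_ le_rfl)) ?_)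
        · refine le_mul_of_one_le_left zero_le ?_
          rw [add_assoc]; exact le_self_add
        · exact le_add_right (le_add_left le_rfl)
        · rw [← mul_assoc, ← mul_assoc, mul_assoc _ (ENNReal.ofReal _)]
          exact mul_le_mul' (le_add_left le_rfl) le_rfl
    _ = _ := by ring

end IsNormalizedSolution

/-! ### Iteration and passage to the limit -/

/-- The constant grows at most like the volume,
with a bound that does not depend on the exponent. -/
theorem ballConst_le {q q' : ℝ≥0∞} (hq : ENNReal.HolderConjugate q q') {R : ℝ} (hR : 1 ≤ R) :
    ballConst d q' R ≤ (1 + volume (Metric.closedBall (0 : EuclideanSpace ℝ (Fin d)) 1)) *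
      ENNReal.ofReal (R ^ d) := by
  set V := volume (Metric.closedBall (0 : EuclideanSpace ℝ (Fin d)) R)
  have h1 : ballConst d q' R ≤ V ^ (1 / q'.toReal) := by
    have := eLpNorm_indicator_const_le (μ := volume) (s := Metric.closedBall
      (0 : EuclideanSpace ℝ (Fin d)) R) (1 : ℝ) q'
    simpa [ballConst] using this
  have hp : 1 / q'.toReal ≤ 1 := by
    by_cases ht : q' = ∞
    · simp [ht]
    · have h1 : 1 ≤ q'.toReal := by
        rw [← ENNReal.toReal_one]
        exact (ENNReal.toReal_le_toReal ENNReal.one_ne_top ht).2 hq.symm.one_le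
      rw [div_le_one (by linarith)]
      exact h1
  have h2 : V ^ (1 / q'.toReal) ≤ 1 + V := by
    rcases le_total V 1 with hV | hV
    · exact (ENNReal.rpow_le_one hV (by positivity)).trans le_self_add
    · refine (ENNReal.rpow_le_rpow_of_exponent_le hV hp).trans ?_
      rw [ENNReal.rpow_one]
      exact le_add_self
  have h3 : V = ENNReal.ofReal (R ^ d) *
      volume (Metric.closedBall (0 : EuclideanSpace ℝ (Fin d)) 1) := by
    have := Measure.addHaar_closedBall_mul (volume : Measure (EuclideanSpace ℝ (Fin d))) 0
      (by linarith : 0 ≤ R) zero_le_one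
    rwa [mul_one, finrank_euclideanSpace_fin] at this
  refine h1.trans (h2.trans ?_)
  rw [add_mul, one_mul, mul_comm _ (ENNReal.ofReal _), h3]
  gcongr
  exact ENNReal.one_le_ofReal.2 (one_le_pow₀ hR)

/-- Iteration of a recursive bound for the mass on balls, in which each step gains a factor
`R⁻²`. The constant depends neither on the mass `m` nor on the errors `δ` and `τ`. -/
theorem exists_iterated_bound {Λ : ℝ} (hΛ : 1 ≤ Λ) {D : ℝ≥0∞} (hD : D ≠ ∞) (d n : ℕ) :
    ∃ D' : ℝ≥0∞, D' ≠ ∞ ∧ ∀ (m τ : ℝ → ℝ≥0∞) (δ : ℝ≥0∞), Antitone τ →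
      (∀ R, 2 ≤ R → m R ≤ D * ENNReal.ofReal (R ^ d)) →
      (∀ R, 2 ≤ R → m R ≤ D * (δ + τ R) + D * ENNReal.ofReal (R⁻¹ ^ 2) * m (Λ * R)) →
      ∀ R, 2 ≤ R → m R ≤ D' * (δ + τ R) + D' * ENNReal.ofReal (R ^ ((d : ℤ) - 2 * n)) := by
  induction n with
  | zero =>
    refine ⟨D, hD, fun m τ δ _ hg _ R hR => (hg R hR).trans ?_⟩
    simp only [Nat.cast_zero, mul_zero, sub_zero, zpow_natCast]
    exact le_add_self
  | succ n ih =>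
    obtain ⟨D', hD', h⟩ := ih
    set k : ℤ := (d : ℤ) - 2 * n
    refine ⟨D + D * D' + D * D' * ENNReal.ofReal (Λ ^ k), by finiteness,
      fun m τ δ hτ hg hs R hR => ?_⟩
    have hR0 : 0 < R := by linarith
    have hΛ0 : 0 < Λ := by linarith
    have hΛR : R ≤ Λ * R := le_mul_of_one_le_left hR0.le hΛ
    have h1 : ENNReal.ofReal (R⁻¹ ^ 2) ≤ 1 := by
      rw [ENNReal.ofReal_le_one]
      exact pow_le_one₀ (by positivity) (inv_le_one_of_one_le₀ (by linarith))
    have h2 : ENNReal.ofReal (R⁻¹ ^ 2) * ENNReal.ofReal ((Λ * R) ^ k)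
        = ENNReal.ofReal (Λ ^ k) * ENNReal.ofReal (R ^ ((d : ℤ) - 2 * (n + 1 : ℕ))) := by
      rw [← ENNReal.ofReal_mul (by positivity), ← ENNReal.ofReal_mul (by positivity)]
      congr 1
      have : (d : ℤ) - 2 * (n + 1 : ℕ) = k - 2 := by simp only [k]; push_cast; ring
      rw [this, mul_zpow, zpow_sub₀ hR0.ne' k 2, zpow_ofNat, inv_pow]
      ring
    calc m R ≤ D * (δ + τ R) + D * ENNReal.ofReal (R⁻¹ ^ 2) *
          (D' * (δ + τ R) + D' * ENNReal.ofReal ((Λ * R) ^ k)) := by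
          refine (hs R hR).trans (add_le_add le_rfl (mul_le_mul' le_rfl ?_))
          refine (h m τ δ hτ hg hs (Λ * R) (hR.trans hΛR)).trans ?_
          exact add_le_add (mul_le_mul' le_rfl (add_le_add le_rfl (hτ hΛR))) le_rfl
      _ = D * (δ + τ R) + D * D' * (δ + τ R) * ENNReal.ofReal (R⁻¹ ^ 2) +
          D * D' * (ENNReal.ofReal (R⁻¹ ^ 2) * ENNReal.ofReal ((Λ * R) ^ k)) := by ring
      _ ≤ D * (δ + τ R) + D * D' * (δ + τ R) * 1 +
          D * D' * (ENNReal.ofReal (Λ ^ k) *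
            ENNReal.ofReal (R ^ ((d : ℤ) - 2 * (n + 1 : ℕ)))) := by
          rw [h2]
          exact add_le_add (add_le_add le_rfl (mul_le_mul' le_rfl h1)) le_rfl
      _ = (D + D * D') * (δ + τ R) + (D * D' * ENNReal.ofReal (Λ ^ k)) *
            ENNReal.ofReal (R ^ ((d : ℤ) - 2 * (n + 1 : ℕ))) := by ring
      _ ≤ _ := by
          exact add_le_add (mul_le_mul' le_self_add le_rfl) (mul_le_mul' le_add_self le_rfl)

namespace IsNormalizedSolution

variable {ν T : ℝ} {q q' : ℝ≥0∞}
  {v : ℝ → EuclideanSpace ℝ (Fin d) → EuclideanSpace ℝ (Fin d)}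
  {G : ℝ → EuclideanSpace ℝ (Fin d) → EuclideanSpace ℝ (Fin d) →L[ℝ] EuclideanSpace ℝ (Fin d)}
  {a : ℝ → EuclideanSpace ℝ (Fin d) → ℝ}

/-- The mass on balls grows at most polynomially, uniformly in the scale of mollification. -/
theorem smoothMass_le (h : IsNormalizedSolution ν T q q' v G a)
    (hq : ENNReal.HolderConjugate q q') {ρ : EuclideanSpace ℝ (Fin d) → ℝ}
    (hρ : Continuous ρ) {ε : ℝ} (hε : 0 < ε) {R : ℝ} (hR : 1 ≤ R) :
    smoothMass T (rescaledKernel ρ ε) a R ≤ (∫⁻ z, ‖ρ z‖ₑ) *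
      ((∫⁻ t in Icc 0 T, eLpNorm (a t) q volume) *
        ((1 + volume (Metric.closedBall (0 : EuclideanSpace ℝ (Fin d)) 1)) *
          ENNReal.ofReal (R ^ d))) := by
  set B : Set (EuclideanSpace ℝ (Fin d)) := Metric.closedBall 0 R
  have hslice (t) : ∫⁻ x in B, ‖smoothAbs (mollify (rescaledKernel ρ ε) (a t) x)‖ₑ
      ≤ (∫⁻ z, ‖ρ z‖ₑ) * (eLpNorm (a t) q volume * ballConst d q' R) := by
    have ham := h.a_meas_slice t
    have hm : Measurable (Function.uncurry fun x z : EuclideanSpace ℝ (Fin d) =>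
        ‖ρ z‖ₑ * ‖a t (x - ε • z)‖ₑ) :=
      (hρ.measurable.comp measurable_snd).enorm.mul
        (ham.comp_measurable (g := fun p : EuclideanSpace ℝ (Fin d) × EuclideanSpace ℝ (Fin d) =>
          p.1 - ε • p.2) (by fun_prop)).enorm
    calc _ ≤ ∫⁻ x in B, ∫⁻ z, ‖ρ z‖ₑ * ‖a t (x - ε • z)‖ₑ :=
          lintegral_mono fun x => (enorm_smoothAbs_le _).trans
            (enorm_mollify_rescaledKernel_le hε (a t) x)
      _ = ∫⁻ z, ‖ρ z‖ₑ * ∫⁻ x in B, ‖a t (x - ε • z)‖ₑ := by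
          rw [lintegral_lintegral_swap hm.aemeasurable]
          refine lintegral_congr fun z => ?_
          rw [lintegral_const_mul' _ _ enorm_ne_top]
      _ ≤ ∫⁻ z, ‖ρ z‖ₑ * (eLpNorm (a t) q volume * ballConst d q' R) := by
          refine lintegral_mono fun z => mul_le_mul' le_rfl ?_
          have hmp := measurePreserving_sub_right (volume : Measure (EuclideanSpace ℝ (Fin d)))
            (ε • z)
          rw [← eLpNorm_comp_measurePreserving ham.aestronglyMeasurable hmp]
          exact setLIntegral_closedBall_enorm_le hq
            (ham.aestronglyMeasurable.comp_measurePreserving hmp) R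
      _ = _ := lintegral_mul_const _ hρ.measurable.enorm
  have hma := measurable_eLpNorm_slice h.a_meas (μ := volume) q
  calc smoothMass T (rescaledKernel ρ ε) a R
      ≤ ∫⁻ t in Icc 0 T, (∫⁻ z, ‖ρ z‖ₑ) * (eLpNorm (a t) q volume * ballConst d q' R) :=
        lintegral_mono hslice
    _ = (∫⁻ z, ‖ρ z‖ₑ) * ((∫⁻ t in Icc 0 T, eLpNorm (a t) q volume) * ballConst d q' R) := by
        rw [lintegral_const_mul _ (hma.mul_const _), lintegral_mul_const _ hma]
    _ ≤ _ := mul_le_mul' le_rfl (mul_le_mul' le_rfl (ballConst_le hq hR))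

theorem setLIntegral_smoothAbs_le_smoothMass_add (h : IsNormalizedSolution ν T q q' v G a)
    {K : EuclideanSpace ℝ (Fin d) → ℝ} (hK : IsTestFunction K) (R : ℝ) :
    ∫⁻ t in Icc 0 T, ∫⁻ x in Metric.closedBall 0 R, ‖smoothAbs (a t x)‖ₑ
      ≤ smoothMass T K a R +
        ∫⁻ t in Icc 0 T, ∫⁻ x in Metric.closedBall 0 R, ‖mollify K (a t) x - a t x‖ₑ := by
  have hmo := h.stronglyMeasurable_mollify hK
  have hs : Continuous smoothAbs := (contDiff_smoothAbs (n := 0)).continuous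
  have hms : Measurable fun t =>
      ∫⁻ x in Metric.closedBall 0 R, ‖smoothAbs (mollify K (a t) x)‖ₑ :=
    (hs.comp_stronglyMeasurable hmo).enorm.lintegral_prod_right'
  rw [smoothMass, ← lintegral_add_left hms]
  refine lintegral_mono fun t => ?_
  have hmt : StronglyMeasurable (mollify K (a t)) :=
    hmo.comp_measurable (measurable_prodMk_left (x := t))
  dsimp only
  rw [← lintegral_add_left (hs.comp_stronglyMeasurable hmt).enorm]
  refine lintegral_mono fun x => ?_
  dsimp only
  have e : smoothAbs (a t x) = smoothAbs (mollify K (a t) x) -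
      (smoothAbs (mollify K (a t) x) - smoothAbs (a t x)) := by abel
  rw [e]
  refine enorm_sub_le.trans (add_le_add le_rfl ?_)
  rw [enorm_le_iff_norm_le]
  exact abs_smoothAbs_sub_le _ _

/-- The mass of `smoothAbs` of the solution vanishes on every ball: the recursive bound is
iterated often enough to beat the polynomial growth, then the mollification is removed and the
scale tends to infinity. -/
theorem setLIntegral_smoothAbs_eq_zero (h : IsNormalizedSolution ν T q q' v G a) (hd : 1 ≤ d)
    (hq : ENNReal.HolderConjugate q q') (hT : 0 < T) (hν : 0 ≤ ν) (r : ℝ) :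
    ∫⁻ t in Icc 0 T, ∫⁻ x in Metric.closedBall 0 r, ‖smoothAbs (a t x)‖ₑ = 0 := by
  obtain ⟨ρ, hρ, hρs, hρ1⟩ := exists_mollifier d
  obtain ⟨Λ, hΛ, D, hD, hstep⟩ := h.exists_smoothMass_le hd hq hT hν hρ hρs
  set D₀ : ℝ≥0∞ := (∫⁻ z, ‖ρ z‖ₑ) * ((∫⁻ t in Icc 0 T, eLpNorm (a t) q volume) *
    (1 + volume (Metric.closedBall (0 : EuclideanSpace ℝ (Fin d)) 1)))
  have hD₀ : D₀ ≠ ∞ := by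
    have h1 : ∫⁻ z, ‖ρ z‖ₑ < ∞ := hρ.integrable.2
    have h2 := h.lintegral_a
    have h3 : volume (Metric.closedBall (0 : EuclideanSpace ℝ (Fin d)) 1) < ∞ :=
      (isCompact_closedBall 0 1).measure_lt_top
    simp only [D₀]; finiteness
  -- after `d` steps the remainder is `R ^ (d - 2 d)`, which tends to zero
  obtain ⟨D', hD', hit⟩ := exists_iterated_bound hΛ (D := D + D₀) (by finiteness) d d
  set comm : ℝ → ℝ≥0∞ := fun ε => ∫⁻ t in Icc 0 T, ∫⁻ x,
    ‖transportCommutator (rescaledKernel ρ ε) (v t) (a t) x‖ₑ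
  set τ := tailMass T q q' G a
  set err : ℝ → ℝ → ℝ≥0∞ := fun R ε => ∫⁻ t in Icc 0 T, ∫⁻ x in Metric.closedBall 0 R,
      ‖mollify (rescaledKernel ρ ε) (a t) x - a t x‖ₑ
  have hbound (ε) (hε : 0 < ε) (hε1 : ε ≤ 1) (R) (hR : 2 ≤ R) :=
    hit (smoothMass T (rescaledKernel ρ ε) a) τ (comm ε) (antitone_tailMass T q q' G a)
      (fun R hR => (h.smoothMass_le hq hρ.continuous hε (by linarith)).trans (by
        rw [← mul_assoc, ← mul_assoc]
        refine mul_le_mul' ?_ le_rfl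
        rw [mul_assoc]
        exact le_add_self))
      (fun R hR => (hstep ε hε hε1 R hR).trans
        (add_le_add (mul_le_mul' le_self_add le_rfl)
          (mul_le_mul' (mul_le_mul' le_self_add le_rfl) le_rfl))) R hR
  -- removal of the mollification
  have hlimit (R) (hR : 2 ≤ R) :
      ∫⁻ t in Icc 0 T, ∫⁻ x in Metric.closedBall 0 R, ‖smoothAbs (a t x)‖ₑ
        ≤ D' * τ R + D' * ENNReal.ofReal (R ^ ((d : ℤ) - 2 * d)) := by
    have hε : ∀ᶠ ε in 𝓝[>] (0 : ℝ),
        ∫⁻ t in Icc 0 T, ∫⁻ x in Metric.closedBall 0 R, ‖smoothAbs (a t x)‖ₑ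
          ≤ D' * (comm ε + τ R) + D' * ENNReal.ofReal (R ^ ((d : ℤ) - 2 * d)) + err R ε := by
      filter_upwards [self_mem_nhdsWithin, nhdsWithin_le_nhds (Iic_mem_nhds one_pos)]
        with ε hε hε1
      exact (h.setLIntegral_smoothAbs_le_smoothMass_add (hρ.rescaledKernel hε) R).trans
        (add_le_add (hbound ε hε hε1 R hR) le_rfl)
    have ht : Tendsto (fun ε => D' * (comm ε + τ R) +
        D' * ENNReal.ofReal (R ^ ((d : ℤ) - 2 * d)) + err R ε) (𝓝[>] 0)
        (𝓝 (D' * (0 + τ R) + D' * ENNReal.ofReal (R ^ ((d : ℤ) - 2 * d)) + 0)) :=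
      ((ENNReal.Tendsto.const_mul
        ((h.tendsto_lintegral_transportCommutator hq hρ hρs).add tendsto_const_nhds)
        (Or.inr hD')).add tendsto_const_nhds).add
        (h.tendsto_lintegral_mollify_sub hq hρ hρs hρ1 R)
    rw [zero_add, add_zero] at ht
    exact ge_of_tendsto ht hε
  have hzp : Tendsto (fun R : ℝ => ENNReal.ofReal (R ^ ((d : ℤ) - 2 * d))) atTop (𝓝 0) := by
    have h0 : (d : ℤ) - 2 * d < 0 := by omega
    have := ENNReal.tendsto_ofReal (tendsto_zpow_atTop_zero (𝕜 := ℝ) h0)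
    rwa [ENNReal.ofReal_zero] at this
  have hτ : Tendsto τ atTop (𝓝 0) := h.tendsto_lintegral_tail hq
  have hfin : Tendsto (fun R => D' * τ R + D' * ENNReal.ofReal (R ^ ((d : ℤ) - 2 * d))) atTop
      (𝓝 (D' * 0 + D' * 0)) :=
    (ENNReal.Tendsto.const_mul hτ (Or.inr hD')).add (ENNReal.Tendsto.const_mul hzp (Or.inr hD'))
  rw [mul_zero, add_zero] at hfin
  refine le_antisymm (ge_of_tendsto hfin ?_) zero_le
  filter_upwards [eventually_ge_atTop (max 2 r)] with R hR
  refine le_trans ?_ (hlimit R ((le_max_left _ _).trans hR))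
  exact lintegral_mono fun t => lintegral_mono_set
    (Metric.closedBall_subset_closedBall ((le_max_right _ _).trans hR))

theorem ae_eq_zero (h : IsNormalizedSolution ν T q q' v G a) (hd : 1 ≤ d)
    (hq : ENNReal.HolderConjugate q q') (hT : 0 < T) (hν : 0 ≤ ν) :
    ∀ᵐ z ∂((volume.restrict (Icc (0 : ℝ) T)).prod
      (volume : Measure (EuclideanSpace ℝ (Fin d)))), a z.1 z.2 = 0 := by
  have hm : Measurable fun p : ℝ × EuclideanSpace ℝ (Fin d) => ‖smoothAbs (a p.1 p.2)‖ₑ :=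
    ((contDiff_smoothAbs (n := 0)).continuous.comp_stronglyMeasurable h.a_meas).enorm
  have key (n : ℕ) : ∀ᵐ z ∂((volume.restrict (Icc (0 : ℝ) T)).prod
      (volume : Measure (EuclideanSpace ℝ (Fin d)))),
      z.2 ∈ Metric.closedBall 0 (n : ℝ) → a z.1 z.2 = 0 := by
    have h0 := h.setLIntegral_smoothAbs_eq_zero hd hq hT hν n
    have hB : MeasurableSet ((univ : Set ℝ) ×ˢ
        Metric.closedBall (0 : EuclideanSpace ℝ (Fin d)) (n : ℝ)) :=
      MeasurableSet.univ.prod Metric.isClosed_closedBall.measurableSet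
    have e : (volume.restrict (Icc (0 : ℝ) T)).prod
        (volume.restrict (Metric.closedBall (0 : EuclideanSpace ℝ (Fin d)) (n : ℝ)))
        = ((volume.restrict (Icc (0 : ℝ) T)).prod volume).restrict
          (univ ×ˢ Metric.closedBall 0 (n : ℝ)) := by
      rw [← Measure.prod_restrict, Measure.restrict_univ]
    rw [← lintegral_prod _ hm.aemeasurable, e, lintegral_eq_zero_iff hm,
      Filter.EventuallyEq, ae_restrict_iff' hB] at h0
    filter_upwards [h0] with z hz hzn
    have := hz ⟨mem_univ _, hzn⟩
    exact smoothAbs_eq_zero_iff.1 (by simpa using this)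
  filter_upwards [ae_all_iff.2 key] with z hz
  obtain ⟨n, hn⟩ := exists_nat_ge ‖z.2‖
  exact hz n (mem_closedBall_zero_iff.2 hn)

end IsNormalizedSolution

/-! ### Normalization of the representatives -/

/-- Hölder inequality for functions with values in `ℝ≥0∞`, such as norms in space as functions of
time. -/
theorem lintegral_mul_le_eLpNorm_mul_eLpNorm {X : Type*} [MeasurableSpace X] {μ : Measure X}
    {p p' : ℝ≥0∞} (hp : ENNReal.HolderConjugate p p') {A B : X → ℝ≥0∞} (hA : Measurable A)
    (hB : Measurable B) (hAt : ∀ x, A x ≠ ∞) (hBt : ∀ x, B x ≠ ∞) :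
    ∫⁻ x, A x * B x ∂μ ≤ eLpNorm A p μ * eLpNorm B p' μ := by
  have e {A : X → ℝ≥0∞} (hAt : ∀ x, A x ≠ ∞) (x : X) : ‖(A x).toReal‖ₑ = A x := by
    rw [Real.enorm_of_nonneg ENNReal.toReal_nonneg, ENNReal.ofReal_toReal (hAt x)]
  have eN {A : X → ℝ≥0∞} (hAt : ∀ x, A x ≠ ∞) (p : ℝ≥0∞) :
      eLpNorm (fun x => (A x).toReal) p μ = eLpNorm A p μ :=
    eLpNorm_congr_enorm_ae (Eventually.of_forall fun x => by rw [e hAt, enorm_eq_self])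
  have := eLpNorm_smul_le_mul_eLpNorm (μ := μ) (p := p) (q := p') (r := 1)
    (f := fun x => (B x).toReal) (φ := fun x => (A x).toReal)
    hB.ennreal_toReal.aestronglyMeasurable hA.ennreal_toReal.aestronglyMeasurable
  rw [eLpNorm_one_eq_lintegral_enorm, eN hAt, eN hBt] at this
  refine le_trans (le_of_eq (lintegral_congr fun x => ?_)) this
  rw [Pi.smul_apply', enorm_smul, e hAt, e hBt]

theorem lintegral_lt_top_of_eLpNorm_lt_top {X : Type*} [MeasurableSpace X] {μ : Measure X}
    [IsFiniteMeasure μ] {p p' : ℝ≥0∞} (hp : ENNReal.HolderConjugate p p') {A : X → ℝ≥0∞}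
    (hA : Measurable A) (hAt : ∀ x, A x ≠ ∞) (h : eLpNorm A p μ < ∞) : ∫⁻ x, A x ∂μ < ∞ := by
  have h1 := lintegral_mul_le_eLpNorm_mul_eLpNorm (μ := μ) hp hA
    (measurable_const (a := (1 : ℝ≥0∞))) hAt (fun _ => ENNReal.one_ne_top)
  simp only [mul_one] at h1
  refine h1.trans_lt (ENNReal.mul_lt_top h ?_)
  have : eLpNorm (fun _ : X => (1 : ℝ≥0∞)) p' μ = eLpNorm (fun _ : X => (1 : ℝ)) p' μ :=
    eLpNorm_congr_enorm_ae (Eventually.of_forall fun x => by simp)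
  rw [this]
  exact (memLp_const (1 : ℝ)).2

theorem ae_lt_top_of_eLpNorm_lt_top {X : Type*} [MeasurableSpace X] {μ : Measure X}
    {p : ℝ≥0∞} (hp : p ≠ 0) {A : X → ℝ≥0∞} (hA : AEMeasurable A μ) (h : eLpNorm A p μ < ∞) :
    ∀ᵐ x ∂μ, A x < ∞ := by
  by_cases hpt : p = ∞
  · rw [hpt, eLpNorm_exponent_top] at h
    filter_upwards [enorm_ae_le_eLpNormEssSup A μ] with x hx
    exact hx.trans_lt h
  · have h1 := lintegral_rpow_enorm_lt_top_of_eLpNorm_lt_top hp hpt h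
    simp only [enorm_eq_self] at h1
    filter_upwards [ae_lt_top' (hA.pow_const _) h1.ne] with x hx
    by_contra hc
    rw [not_lt, top_le_iff] at hc
    rw [hc, ENNReal.top_rpow_of_pos (ENNReal.toReal_pos hp hpt)] at hx
    exact lt_irrefl _ hx

theorem HasWeakGradient.congr_ae
    {u u' : EuclideanSpace ℝ (Fin d) → EuclideanSpace ℝ (Fin d)}
    {G G' : EuclideanSpace ℝ (Fin d) → EuclideanSpace ℝ (Fin d) →L[ℝ] EuclideanSpace ℝ (Fin d)}
    (h : HasWeakGradient u G) (hu : u' =ᵐ[volume] u) (hG : G' =ᵐ[volume] G) :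
    HasWeakGradient u' G' := by
  refine ⟨h.1.congr hu.symm, h.2.1.congr hG.symm, fun ψ hψ e => ?_⟩
  have h1 : ∫ x, fderiv ℝ ψ x e • u' x = ∫ x, fderiv ℝ ψ x e • u x :=
    integral_congr_ae (hu.mono fun x hx => by simp only [hx])
  have h2 : ∫ x, ψ x • G' x e = ∫ x, ψ x • G x e :=
    integral_congr_ae (hG.mono fun x hx => by simp only [hx])
  rw [h1, h2]
  exact h.2.2 ψ hψ e

theorem HasWeakGradient.zero : HasWeakGradient
    (fun _ : EuclideanSpace ℝ (Fin d) => (0 : EuclideanSpace ℝ (Fin d))) (fun _ => 0) :=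
  ⟨continuous_const.locallyIntegrable, continuous_const.locallyIntegrable, fun ψ _ e => by simp⟩

/-- Normalization: representatives that are measurable, and that vanish at the exceptional times,
satisfy the assumptions at every time. -/
theorem IsDistributionalSolution.exists_isNormalizedSolution {ν T : ℝ}
    {p p' q q' : ℝ≥0∞} (hp : ENNReal.HolderConjugate p p')
    {v : ℝ → EuclideanSpace ℝ (Fin d) → EuclideanSpace ℝ (Fin d)}
    (hv : MemLpHomogeneousSobolev v p' q') (hdiv : IsDivergenceFree v)
    {a : ℝ → EuclideanSpace ℝ (Fin d) → ℝ}
    (ha : MemMixedLp a p q (volume.restrict (Icc 0 T)) volume)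
    (hsol : IsDistributionalSolution ν T v a) :
    ∃ (v' : ℝ → EuclideanSpace ℝ (Fin d) → EuclideanSpace ℝ (Fin d))
      (G' : ℝ → EuclideanSpace ℝ (Fin d) → EuclideanSpace ℝ (Fin d) →L[ℝ]
        EuclideanSpace ℝ (Fin d)) (a' : ℝ → EuclideanSpace ℝ (Fin d) → ℝ),
      IsNormalizedSolution ν T q q' v' G' a' ∧
      ∀ᵐ z ∂((volume.restrict (Icc (0 : ℝ) T)).prod
        (volume : Measure (EuclideanSpace ℝ (Fin d)))), a' z.1 z.2 = a z.1 z.2 := by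
  obtain ⟨hvloc, G, hvG, hGm, hGn⟩ := hv
  obtain ⟨ham, han⟩ := ha
  set μ : Measure ℝ := volume.restrict (Icc (0 : ℝ) T)
  have hμle : μ ≤ volume.restrict (Ici (0 : ℝ)) := Measure.restrict_mono Icc_subset_Ici_self le_rfl
  have hGm' : AEStronglyMeasurable (Function.uncurry G) (μ.prod volume) :=
    hGm.mono_measure (Measure.prod_mono hμle le_rfl)
  have hvm : AEStronglyMeasurable (Function.uncurry v) (μ.prod volume) := by
    have h1 (n : ℕ) : AEStronglyMeasurable (Function.uncurry v) ((μ.prod volume).restrict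
        (univ ×ˢ Metric.ball (0 : EuclideanSpace ℝ (Fin d)) (n : ℝ))) := by
      rw [← Measure.prod_restrict, Measure.restrict_univ]
      exact (hvloc T n).1
    have h2 := aestronglyMeasurable_iUnion_iff.2 h1
    rwa [← prod_iUnion, Metric.iUnion_ball_nat, univ_prod_univ, Measure.restrict_univ] at h2
  -- the times at which all the assumptions hold and the representatives agree
  have hgood : ∀ᵐ t ∂μ, (∀ᵐ x, ham.mk _ (t, x) = a t x) ∧ (∀ᵐ x, hvm.mk _ (t, x) = v t x) ∧
      (∀ᵐ x, hGm'.mk _ (t, x) = G t x) ∧ HasWeakGradient (v t) (G t) ∧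
      (∀ ψ : EuclideanSpace ℝ (Fin d) → ℝ, IsTestFunction ψ →
        ∫ x, inner ℝ (v t x) (gradient ψ x) = 0) ∧
      eLpNorm (a t) q volume < ∞ ∧ eLpNorm (G t) q' volume < ∞ := by
    have h1 := Measure.ae_ae_of_ae_prod ham.ae_eq_mk
    have h3 := Measure.ae_ae_of_ae_prod hGm'.ae_eq_mk
    have h6 : ∀ᵐ t ∂μ, eLpNorm (a t) q volume < ∞ := by
      refine ae_lt_top_of_eLpNorm_lt_top hp.ne_zero ⟨_, measurable_eLpNorm_slice
        (μ := volume) (f := fun t x => ham.mk _ (t, x)) ham.stronglyMeasurable_mk q, ?_⟩ han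
      filter_upwards [h1] with t ht using eLpNorm_congr_ae ht
    have h7 : ∀ᵐ t ∂μ, eLpNorm (G t) q' volume < ∞ := by
      refine ae_lt_top_of_eLpNorm_lt_top hp.symm.ne_zero ⟨_, measurable_eLpNorm_slice
        (μ := volume) (f := fun t x => hGm'.mk _ (t, x)) hGm'.stronglyMeasurable_mk q', ?_⟩
        ((eLpNorm_mono_measure _ hμle).trans_lt hGn)
      filter_upwards [h3] with t ht using eLpNorm_congr_ae ht
    filter_upwards [h1, Measure.ae_ae_of_ae_prod hvm.ae_eq_mk, h3, ae_mono hμle hvG,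
      ae_mono hμle hdiv, h6, h7] with t t1 t2 t3 t4 t5 t6 t7
    exact ⟨t1.mono fun _ h => h.symm, t2.mono fun _ h => h.symm, t3.mono fun _ h => h.symm,
      t4, t5, t6, t7⟩
  obtain ⟨S, hS, hSm, hSg⟩ := hgood.exists_measurable_mem
  have hSE : MeasurableSet (S ×ˢ (univ : Set (EuclideanSpace ℝ (Fin d)))) :=
    hSm.prod MeasurableSet.univ
  let restr {F : Type} [Zero F] (f : ℝ × EuclideanSpace ℝ (Fin d) → F) (t : ℝ)
    (x : EuclideanSpace ℝ (Fin d)) : F := (S ×ˢ univ).indicator f (t, x)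
  have restr_mem {F : Type} [Zero F] (f : ℝ × EuclideanSpace ℝ (Fin d) → F) {t : ℝ} (ht : t ∈ S) :
      restr f t = fun x => f (t, x) := funext fun x => indicator_of_mem
          (by exact ⟨ht, mem_univ _⟩) _
  have restr_notMem {F : Type} [Zero F] (f : ℝ × EuclideanSpace ℝ (Fin d) → F) {t : ℝ}
      (ht : t ∉ S) : restr f t = fun x => 0 :=
    funext fun x => indicator_of_notMem (fun h => ht h.1) _
  have restr_sm {F : Type} [NormedAddCommGroup F] {f : ℝ × EuclideanSpace ℝ (Fin d) → F}
      (hf : StronglyMeasurable f) : StronglyMeasurable (Function.uncurry (restr f)) :=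
    hf.indicator hSE
  have restr_ae {F : Type} [Zero F] {f : ℝ × EuclideanSpace ℝ (Fin d) → F}
      {g : ℝ × EuclideanSpace ℝ (Fin d) → F} (h : g =ᵐ[μ.prod volume] f) :
      ∀ᵐ z ∂(μ.prod volume), restr f z.1 z.2 = g z := by
    have hz : ∀ᵐ z ∂(μ.prod (volume : Measure (EuclideanSpace ℝ (Fin d)))), z.1 ∈ S :=
      Measure.quasiMeasurePreserving_fst.ae hS
    filter_upwards [h, hz] with z h1 h2
    rw [restr_mem f h2, h1]
  set a' := restr (ham.mk _) with ha'
  set v' := restr (hvm.mk _) with hv'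
  set G' := restr (hGm'.mk _) with hG'
  have a'_eq {t} (ht : t ∈ S) : a' t =ᵐ[volume] a t := by
    rw [ha', restr_mem _ ht]; exact (hSg t ht).1
  have v'_eq {t} (ht : t ∈ S) : v' t =ᵐ[volume] v t := by
    rw [hv', restr_mem _ ht]; exact (hSg t ht).2.1
  have G'_eq {t} (ht : t ∈ S) : G' t =ᵐ[volume] G t := by
    rw [hG', restr_mem _ ht]; exact (hSg t ht).2.2.1
  have a'_sm : StronglyMeasurable (Function.uncurry a') := restr_sm ham.stronglyMeasurable_mk
  have v'_sm : StronglyMeasurable (Function.uncurry v') := restr_sm hvm.stronglyMeasurable_mk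
  have G'_sm : StronglyMeasurable (Function.uncurry G') := restr_sm hGm'.stronglyMeasurable_mk
  have a'_memLp (t) : MemLp (a' t) q volume := by
    refine ⟨(a'_sm.comp_measurable measurable_prodMk_left).aestronglyMeasurable, ?_⟩
    by_cases ht : t ∈ S
    · rw [eLpNorm_congr_ae (a'_eq ht)]
      exact (hSg t ht).2.2.2.2.2.1
    · rw [ha', restr_notMem _ ht]; simp
  have G'_memLp (t) : MemLp (G' t) q' volume := by
    refine ⟨(G'_sm.comp_measurable measurable_prodMk_left).aestronglyMeasurable, ?_⟩
    by_cases ht : t ∈ S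
    · rw [eLpNorm_congr_ae (G'_eq ht)]
      exact (hSg t ht).2.2.2.2.2.2
    · have h0 : eLpNorm (fun _ : EuclideanSpace ℝ (Fin d) =>
          (0 : EuclideanSpace ℝ (Fin d) →L[ℝ] EuclideanSpace ℝ (Fin d))) q' volume
          = eLpNorm (fun _ : EuclideanSpace ℝ (Fin d) => (0 : ℝ)) q' volume :=
        eLpNorm_congr_norm_ae (Eventually.of_forall fun x => by rw [norm_zero, norm_zero])
      rw [hG', restr_notMem _ ht, h0]; simp
  have wg (t) : HasWeakGradient (v' t) (G' t) := by
    by_cases ht : t ∈ S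
    · exact (hSg t ht).2.2.2.1.congr_ae (v'_eq ht) (G'_eq ht)
    · rw [hv', hG', restr_notMem _ ht, restr_notMem _ ht]
      exact HasWeakGradient.zero
  -- integrability in time, from the Hölder inequality with the exponents `p` and `p'`
  set A : ℝ → ℝ≥0∞ := fun t => eLpNorm (a' t) q volume
  set Γ : ℝ → ℝ≥0∞ := fun t => eLpNorm (G' t) q' volume
  set V : ℝ → ℝ → ℝ≥0∞ := fun R t => ∫⁻ x in Metric.closedBall 0 R, ‖v' t x‖ₑ
  have hAm : Measurable A := measurable_eLpNorm_slice a'_sm q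
  have hΓm : Measurable Γ := measurable_eLpNorm_slice G'_sm q'
  have hVm (R) : Measurable (V R) := v'_sm.enorm.lintegral_prod_right'
  have hAt (t) : A t ≠ ∞ := (a'_memLp t).2.ne
  have hΓt (t) : Γ t ≠ ∞ := (G'_memLp t).2.ne
  have hVt (R t) : V R t ≠ ∞ := ((wg t).1.lintegral_closedBall_lt_top R).ne
  have hAp : eLpNorm A p μ < ∞ := by
    refine lt_of_le_of_lt (le_of_eq (eLpNorm_congr_enorm_ae ?_)) han
    filter_upwards [hS] with t ht
    simp only [A, eLpNorm_congr_ae (a'_eq ht)]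
  have hΓp : eLpNorm Γ p' μ < ∞ := by
    refine lt_of_le_of_lt (le_of_eq (eLpNorm_congr_enorm_ae ?_))
      ((eLpNorm_mono_measure _ hμle).trans_lt hGn)
    filter_upwards [hS] with t ht
    simp only [Γ, eLpNorm_congr_ae (G'_eq ht)]
  have hVp (R) : eLpNorm (V R) p' μ < ∞ := by
    refine lt_of_le_of_lt (eLpNorm_mono_enorm_ae ?_) (hvloc T (R + 1)).2
    filter_upwards [hS] with t ht
    rw [enorm_eq_self, enorm_eq_self, eLpNorm_one_eq_lintegral_enorm]
    refine le_trans (le_of_eq ?_)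
      (lintegral_mono_set (Metric.closedBall_subset_ball (lt_add_one R)))
    exact lintegral_congr_ae (ae_restrict_of_ae ((v'_eq ht).mono fun x hx => by
      dsimp only; rw [hx]))
  refine ⟨v', G', a', ⟨a'_sm, v'_sm, G'_sm, a'_memLp, G'_memLp, wg, fun t ψ hψ => ?_, ?_,
    fun R => ?_, ?_, ?_, fun R => ?_, fun φ hφ => ?_⟩, restr_ae ham.ae_eq_mk⟩
  · by_cases ht : t ∈ S
    · rw [← (hSg t ht).2.2.2.2.1 ψ hψ]
      refine integral_congr_ae ((v'_eq ht).mono fun x hx => ?_)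
      simp only [inner_gradient_right_eq_fderiv, hx]
    · rw [hv', restr_notMem _ ht]; simp
  · exact (lintegral_mul_le_eLpNorm_mul_eLpNorm hp hAm hΓm hAt hΓt).trans_lt
      (ENNReal.mul_lt_top hAp hΓp)
  · exact (lintegral_mul_le_eLpNorm_mul_eLpNorm hp hAm (hVm R) hAt (hVt R)).trans_lt
      (ENNReal.mul_lt_top hAp (hVp R))
  · exact lintegral_lt_top_of_eLpNorm_lt_top hp hAm hAt hAp
  · exact lintegral_lt_top_of_eLpNorm_lt_top hp.symm hΓm hΓt hΓp
  · exact lintegral_lt_top_of_eLpNorm_lt_top hp.symm (hVm R) (hVt R) (hVp R)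
  · filter_upwards [hsol φ hφ, hS, ae_restrict_mem measurableSet_Icc] with s hs hsS hsT
    have e1 : ∫ x, a' s x * φ (s, x) = ∫ x, a s x * φ (s, x) :=
      integral_congr_ae ((a'_eq hsS).mono fun x hx => by simp only [hx])
    rw [e1, ← hs]
    refine integral_congr_ae ?_
    have hle : (volume : Measure (ℝ × EuclideanSpace ℝ (Fin d))).restrict (Icc 0 s ×ˢ univ)
        ≤ μ.prod volume := by
      rw [Measure.volume_eq_prod, ← Measure.prod_restrict, Measure.restrict_univ]
      exact Measure.prod_mono (Measure.restrict_mono (Icc_subset_Icc_right hsT.2) le_rfl) le_rfl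
    filter_upwards [ae_mono hle (restr_ae ham.ae_eq_mk),
      ae_mono hle (restr_ae hvm.ae_eq_mk)] with z h1 h2
    simp only [inner_gradient_right_eq_fderiv]
    rw [show a' z.1 z.2 = a z.1 z.2 from h1, show v' z.1 z.2 = v z.1 z.2 from h2]

theorem mainTheorem1 (d : ℕ) (hd : 1 ≤ d) (ν : ℝ) (hν : 0 ≤ ν)
    (p p' q q' : ℝ≥0∞) (hp : ENNReal.HolderConjugate p p') (hq : ENNReal.HolderConjugate q q')
    (v : ℝ → EuclideanSpace ℝ (Fin d) → EuclideanSpace ℝ (Fin d))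
    (hv : MemLpHomogeneousSobolev v p' q') (hdiv : IsDivergenceFree v)
    (T : ℝ) (hT : 0 < T)
    (a : ℝ → EuclideanSpace ℝ (Fin d) → ℝ)
    (ha : MemMixedLp a p q (volume.restrict (Icc 0 T)) volume)
    (hsol : IsDistributionalSolution ν T v a) :
    ∀ᵐ z ∂((volume.restrict (Icc (0 : ℝ) T)).prod
      (volume : Measure (EuclideanSpace ℝ (Fin d)))), a z.1 z.2 = 0 := by
  obtain ⟨v', G', a', h, hae⟩ := hsol.exists_isNormalizedSolution hp hv hdiv ha
  filter_upwards [hae, h.ae_eq_zero hd hq hT hν] with z h1 h2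
  rw [← h1, h2]
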